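/- **Conventions.** A word is a finite sequence of letters from $\{a,b,a^{-1},b^{-1}\}$, and the formal inverse of $w_1\cdots w_n$ is $w_n^{-1}\cdots w_1^{-1}$. A *labelling* is a map $\rho:\tfrac12\mathbf Z\to\{a,b,a^{-1},b^{-1}\}$ with $\rho(k)\in\{a,a^{-1}\}$ for $k\in\mathbf Z$ and $\rho(k)\in\{b,b^{-1}\}$ for $k\in\tfrac12\mathbf Z\setminus\mathbf Z$. A *block* is a set $X=\{k,k+\tfrac12,\dots,k+\tfrac n2\}$ with $k\in\tfrac12\mathbf Z$ and $n\ge 0$ an integer, and its word is $W_\rho(X)=\rho(k)\rho(k+\tfrac12)\cdots\rho(k+\tfrac n2)$. The labelling $\rho$ is *quasi-periodic* if (1) for each block $X$ there is an $N$ such that $W_\rho(X)$ is a string of consecutive letters of $W_\rho(Y)$ for every block $Y$ with at least $N$ elements, and (2) for each block $X$ there is a block $Y$ such that $W_\rho(Y)$ is the formal inverse of $W_\rho(X)$. Let $F$ be Thompson's group of piecewise linear orientation preserving homeomorphisms of $[0,1]$ with finitely many breakpoints, all of them dyadic rationals, and with all slopes integer powers of $2$. For a homeomorphism $f$ of $[0,1]$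 let $\mathrm{Supp}(f)=\{x: f(x)\ne x\}$, and let $F_{[r,s]}=\{f\in F:\mathrm{Supp}(f)\subseteq[r,s]\}$. Let $\iota(x)=1-x$ on $[0,1]$. Fix any $c_0\in F$ with $\mathrm{Supp}(c_0)=(0,\tfrac14)$, $c_0(x)>x$ on $(0,\tfrac14)$ and $c_0(x)=2x$ on $(0,\tfrac1{16})$, put $\nu_1=c_0\,(\iota\circ c_0\circ\iota)$, and fix any homeomorphisms $\nu_2,\nu_3$ of $[0,1]$ with supports in $(\tfrac1{16},\tfrac{15}{16})$ that generate the group $F_{[1/16,15/16]}$. For $i=1,2,3$ let $\zeta_i$ be the homeomorphism of $\mathbf R$ that preserves each interval $[n,n+1]$, $n\in\mathbf Z$, and acts on it as the translate of $\nu_i$ if $\rho(n+\tfrac12)=b$ and as the translate of $\iota\circ\nu_i\circ\iota$ if $\rho(n+\tfrac12)=b^{-1}$; let $\chi_i$ be the homeomorphism that preserves each $[n-\tfrac12,n+\tfrac12]$ and acts on it as the translate of $\nu_i$ if $\rho(n)=a$ and as the translate of $\iota\circ\nu_i\circ\iota$ if $\rho(n)=a^{-1}$. Let $G_\rho=\langle\zeta_1,\zeta_2,\zeta_3,\chi_1,\chi_2,\chi_3\rangle<\mathrm{Homeo}^+(\mathbf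 R)$. For $g$ in the commutator subgroup $[G,G]$ of a group $G$, the commutator length $cl(g)$ is the least $k$ such that $g$ is a product of $k$ commutators of elements of $G$, and the stable commutator length of $g$ is $\lim_{n\to\infty} cl(g^n)/n$. The group $G$ is *uniformly perfect* if for some $k$ every element of $G$ is a product of $k$ commutators. **Theorem.** Let $\rho$ be a quasi-periodic labelling. Then every $f\in G_\rho$ lies in $[G_\rho,G_\rho]$ and satisfies $cl(f)\le 3$. Hence $G_\rho$ is uniformly perfect, and the stable commutator length of every element of $G_\rho$ is $0$. -/

import Mathlib

open Set Filter Topology unitInterval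
open scoped ENNReal

namespace QuasiPeriodic

/-! ### Labellings -/

/-- The two letter types. -/
inductive Gen : Type
  | a
  | b
  deriving DecidableEq

/-- The alphabet `{a, b, a⁻¹, b⁻¹}`: the pair `(x, true)` is the letter `x` and `(x, false)` is its
formal inverse. The formal inverse of a word is then `FreeGroup.invRev`. -/
abbrev Letter : Type := Gen × Bool

/-- A map `ρ` on the half-integers `½ℤ` is encoded as a map on `ℤ`: the value `ρ m` is the letter
at the half-integer `m / 2`. It is a labelling if integers carry `a` or `a⁻¹` and the
half-integers that are not integers carry `b` or `b⁻¹`. -/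
structure IsLabelling (ρ : ℤ → Letter) : Prop where
  at_int : ∀ n : ℤ, (ρ (2 * n)).1 = Gen.a
  at_half : ∀ n : ℤ, (ρ (2 * n + 1)).1 = Gen.b

/-- The word read off `ρ` along the block `{k/2, (k+1)/2, …, (k+n)/2}`, which has `n + 1`
elements. -/
def blockWord (ρ : ℤ → Letter) (k : ℤ) (n : ℕ) : List Letter :=
  (List.range (n + 1)).map fun i => ρ (k + (i : ℤ))

/-- Quasi-periodic labellings: every word of a block occurs (as a string of consecutive letters) in
the word of every sufficiently large block, and the formal inverse of the word of a block is again
the word of a block. -/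
structure IsQuasiPeriodic (ρ : ℤ → Letter) : Prop where
  isLabelling : IsLabelling ρ
  recurrent : ∀ (k : ℤ) (n : ℕ), ∃ N : ℕ, ∀ (k' : ℤ) (n' : ℕ), N ≤ n' + 1 →
    blockWord ρ k n <:+: blockWord ρ k' n'
  inverse : ∀ (k : ℤ) (n : ℕ), ∃ (k' : ℤ) (n' : ℕ),
    blockWord ρ k' n' = FreeGroup.invRev (blockWord ρ k n)

/-! ### Thompson's group `F`

`Homeo⁺([0,1])` and `Homeo⁺(ℝ)` are the groups of order automorphisms `I ≃o I` and `ℝ ≃o ℝ`. -/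

/-- `x` is a dyadic rational, i.e. an element of `ℤ[1/2]`. -/
def IsDyadic (x : ℝ) : Prop := ∃ (m : ℤ) (n : ℕ), x = (m : ℝ) / 2 ^ n

/-- Thompson's group `F`, as a set of homeomorphisms of `[0,1]`: away from a finite set of dyadic
rationals the map is locally affine with slope an integer power of `2`. -/
def thompsonF : Set (I ≃o I) :=
  {f | ∃ S : Finset ℝ, (∀ s ∈ S, IsDyadic s) ∧ ∀ x : I, (x : ℝ) ∉ S →
    ∃ (k : ℤ) (c : ℝ), ∀ᶠ y : I in 𝓝 x, (f y : ℝ) = (2 : ℝ) ^ k * (y : ℝ) + c}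

/-- The (open) support of a homeomorphism of `[0,1]`. -/
def supp (f : I ≃o I) : Set ℝ := {x | ∃ y : I, (y : ℝ) = x ∧ f y ≠ y}

/-- `F_{[r,s]}`: the elements of `F` supported in `[r,s]`. -/
def thompsonFOn (r s : ℝ) : Set (I ≃o I) := {f | f ∈ thompsonF ∧ supp f ⊆ Icc r s}

/-- `ι ∘ f ∘ ι`, where `ι x = 1 - x` is the orientation reversing isometry of `[0,1]`. -/
def conjIota (f : I ≃o I) : I ≃o I where
  toFun x := σ (f (σ x))
  invFun x := σ (f.symm (σ x))
  left_inv x := by simp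
  right_inv x := by simp
  map_rel_iff' := by
    intro x y
    change σ (f (σ x)) ≤ σ (f (σ y)) ↔ x ≤ y
    rw [unitInterval.symm_le_symm, f.le_iff_le, unitInterval.symm_le_symm]

/-- The element `ν₁ = c₀ c₁`, where `c₁ = ι ∘ c₀ ∘ ι`. -/
def nuOne (c₀ : I ≃o I) : I ≃o I := c₀ * conjIota c₀

/-- The conditions on the choice of `c₀, ν₂, ν₃`, which together with `ν₁ = c₀ c₁` generate the
model group on `[0,1]`. -/
structure IsAdmissible (c₀ ν₂ ν₃ : I ≃o I) : Prop where
  mem_F : c₀ ∈ thompsonF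
  supp_eq : supp c₀ = Ioo 0 (1 / 4)
  lt_apply : ∀ x : I, (x : ℝ) ∈ Ioo (0 : ℝ) (1 / 4) → x < c₀ x
  apply_eq : ∀ x : I, (x : ℝ) ∈ Ioo (0 : ℝ) (1 / 16) → (c₀ x : ℝ) = 2 * (x : ℝ)
  supp_two : supp ν₂ ⊆ Ioo (1 / 16) (15 / 16)
  supp_three : supp ν₃ ⊆ Ioo (1 / 16) (15 / 16)
  closure_eq : (Subgroup.closure {ν₂, ν₃} : Set (I ≃o I)) = thompsonFOn (1 / 16) (15 / 16)

/-! ### The group `G_ρ` -/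

/-- The fractional part as a point of `[0,1]`. -/
noncomputable def fractI (x : ℝ) : I := ⟨Int.fract x, Int.fract_nonneg x, (Int.fract_lt_one x).le⟩

/-- The map of `ℝ` preserving each `[n,n+1]`, on which it is the translate of `φ n`. -/
noncomputable def glueFun (φ : ℤ → (I ≃o I)) (x : ℝ) : ℝ := (⌊x⌋ : ℝ) + (φ ⌊x⌋ (fractI x) : ℝ)

theorem glueFun_apply (φ : ℤ → (I ≃o I)) (n : ℤ) (t : I) :
    glueFun φ ((n : ℝ) + (t : ℝ)) = (n : ℝ) + (φ n t : ℝ) := by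
  rcases eq_or_lt_of_le t.2.2 with h | h
  · have ht : t = 1 := Subtype.ext h
    subst ht
    have hf : ⌊(n : ℝ) + ((1 : I) : ℝ)⌋ = n + 1 := by simp
    have h0 : fractI ((n : ℝ) + ((1 : I) : ℝ)) = ⊥ := by
      apply Subtype.ext
      simp [fractI]
    have h1 : φ n 1 = 1 := (φ n).map_top
    unfold glueFun
    rw [h0, OrderIso.map_bot, hf, h1]
    simp
  · have hf : ⌊(n : ℝ) + (t : ℝ)⌋ = n := by
      rw [Int.floor_intCast_add, Int.floor_eq_zero_iff.2 ⟨t.2.1, h⟩, add_zero]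
    have h0 : fractI ((n : ℝ) + (t : ℝ)) = t := by
      apply Subtype.ext
      simp [fractI, Int.fract_eq_self.2 ⟨t.2.1, h⟩]
    unfold glueFun
    rw [h0, hf]

theorem floor_add_fractI (x : ℝ) : (⌊x⌋ : ℝ) + (fractI x : ℝ) = x := Int.floor_add_fract x

theorem glueFun_comp (φ ψ : ℤ → (I ≃o I)) (h : ∀ n t, φ n (ψ n t) = t) (x : ℝ) :
    glueFun φ (glueFun ψ x) = x := by
  change glueFun φ ((⌊x⌋ : ℝ) + (ψ ⌊x⌋ (fractI x) : ℝ)) = x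
  rw [glueFun_apply, h, floor_add_fractI]

theorem glueFun_strictMono (φ : ℤ → (I ≃o I)) : StrictMono (glueFun φ) := by
  have hm : Monotone (glueFun φ) := by
    intro x y hxy
    rcases eq_or_lt_of_le (Int.floor_mono hxy) with h | h
    · have hle : fractI x ≤ fractI y := by
        rw [← Subtype.coe_le_coe]
        have hx := floor_add_fractI x
        have hy := floor_add_fractI y
        rw [h] at hx
        linarith
      have := (φ ⌊y⌋).monotone hle
      unfold glueFun
      rw [h]
      exact add_le_add_right (Subtype.coe_le_coe.2 this) _
    · have h1 : (⌊x⌋ : ℝ) + 1 ≤ (⌊y⌋ : ℝ) := by exact_mod_cast h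
      have h2 := (φ ⌊x⌋ (fractI x)).2.2
      have h3 := (φ ⌊y⌋ (fractI y)).2.1
      unfold glueFun
      linarith
  exact hm.strictMono_of_injective (Function.LeftInverse.injective
    (g := glueFun fun n => (φ n).symm) fun x => glueFun_comp _ _ (fun n t => by simp) x)

/-- The homeomorphism of `ℝ` preserving each `[n,n+1]`, on which it is the translate of `φ n`. -/
noncomputable def glue (φ : ℤ → (I ≃o I)) : ℝ ≃o ℝ where
  toFun := glueFun φ
  invFun := glueFun fun n => (φ n).symm
  left_inv := glueFun_comp _ _ fun n t => by simp
  right_inv := glueFun_comp _ _ fun n t => by simp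
  map_rel_iff' := (glueFun_strictMono φ).le_iff_le

/-- `ν` or `ι ∘ ν ∘ ι`, according to whether the letter is positive or negative. -/
def orient (l : Letter) (ν : I ≃o I) : I ≃o I := if l.2 = true then ν else conjIota ν

/-- The homeomorphism `ζ` of `ℝ` built from `ν`: on `[n,n+1]` it is the translate of `ν` if
`ρ(n+½) = b` and of `ι ∘ ν ∘ ι` if `ρ(n+½) = b⁻¹`. -/
noncomputable def zeta (ρ : ℤ → Letter) (ν : I ≃o I) : ℝ ≃o ℝ :=
  glue fun n => orient (ρ (2 * n + 1)) ν

/-- The homeomorphism `χ` of `ℝ` built from `ν`: on `[n-½,n+½]` it is the translate of `ν` if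
`ρ(n) = a` and of `ι ∘ ν ∘ ι` if `ρ(n) = a⁻¹`. -/
noncomputable def chi (ρ : ℤ → Letter) (ν : I ≃o I) : ℝ ≃o ℝ :=
  ((OrderIso.addRight (1 / 2 : ℝ)).trans (glue fun n => orient (ρ (2 * n)) ν)).trans
    (OrderIso.addRight (1 / 2 : ℝ)).symm

/-- The group `G_ρ = ⟨ζ₁, ζ₂, ζ₃, χ₁, χ₂, χ₃⟩` of homeomorphisms of the real line. -/
noncomputable def groupG (ρ : ℤ → Letter) (c₀ ν₂ ν₃ : I ≃o I) : Subgroup (ℝ ≃o ℝ) :=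
  Subgroup.closure {zeta ρ (nuOne c₀), zeta ρ ν₂, zeta ρ ν₃,
    chi ρ (nuOne c₀), chi ρ ν₂, chi ρ ν₃}

/-! ### Commutator length -/

/-- `g` is a product of `k` commutators of elements of `G`. -/
def IsProdOfCommutators {G : Type*} [Group G] (k : ℕ) (g : G) : Prop :=
  ∃ l : List G, l.length = k ∧ (∀ c ∈ l, c ∈ commutatorSet G) ∧ l.prod = g

/-- The commutator length `cl(g)`: the least `k` such that `g` is a product of `k` commutators, and
`⊤` if there is none. -/
noncomputable def commutatorLength {G : Type*} [Group G] (g : G) : ℕ∞ :=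
  ⨅ (k : ℕ) (_ : IsProdOfCommutators k g), (k : ℕ∞)

/-- `G` is uniformly perfect: for some `k`, every element is a product of `k` commutators. -/
def IsUniformlyPerfect (G : Type*) [Group G] : Prop :=
  ∃ k : ℕ, ∀ g : G, IsProdOfCommutators k g

/-- The stable commutator length of `g` exists and equals `s`: `s = lim cl(gⁿ) / n`. -/
def HasStableCommutatorLength {G : Type*} [Group G] (g : G) (s : ℝ≥0∞) : Prop :=
  Tendsto (fun n : ℕ => (commutatorLength (g ^ n) : ℝ≥0∞) / (n : ℝ≥0∞)) atTop (𝓝 s)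

end QuasiPeriodic

open scoped commutatorElement

namespace QuasiPeriodic

/-! ### Dyadic piecewise linear homeomorphisms of the line -/

/-! An element of `G_ρ` moves points a bounded distance, and its action near a point depends only on
the word of `ρ` read nearby, up to formal inversion (`groupG_le_localGroup`). It therefore commutes
with every isometry `x ↦ ± x + t` that matches a long enough word. Conversely, a dyadic PL map with
compact support in an interval can be spread: copy it along all occurrences of a word around the
interval, reversing it at occurrences of the inverse word. If the word is long enough for the copies
to be disjoint, the result lies in `G_ρ` (`plc_le_spreadGroup`).

Spreading starts from the generators, which spread along single letters. A commutator of spreads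
along two words survives only where both words occur, so it is a spread along their union. Since the
groups `plc a b` are perfect, nothing is lost by passing to commutators, and induction reaches every
word. Disjointness of the copies comes from quasi-periodicity: a reflection matching the word would
flip the sign of a letter it fixes, and a short translation is excluded because the presence of
inverse words prevents `ρ` from being periodic (`IsQuasiPeriodic.exists_separates`).

The bound 3 is 1 + 2. The germ of `f` at `0` is the germ of a single commutator of compactly
supported maps; spreading both entries gives a commutator in `G_ρ` that agrees with `f` near every
occurrence of a central word (`exists_commutator_eq_near`). The quotient is the identity near these
occurrences, which are relatively dense. They cut the line into cells with finitely many isometry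
types (`finite_cellSetoid`), so the quotient is the spread of a finite family of compactly supported
maps. In a finite product of groups `plc`, perfectness and displacement of supports write any
element as two commutators (`exists_eq_commutator_mul_commutator`), and these spread back to `G_ρ`
(`exists_eq_two_commutators`).

Perfectness of `plc a b` comes from the hypothesis that two elements generate `F_{[1/16,15/16]}`:
the end slopes map this group onto `ℤ²`, so they already detect its abelianization
(`plc_le_commutator_of_closure`). -/

theorem IsDyadic.intCast (n : ℤ) : IsDyadic n := ⟨n, 0, by simp⟩

theorem IsDyadic.add {x y : ℝ} (hx : IsDyadic x) (hy : IsDyadic y) : IsDyadic (x + y) := by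
  obtain ⟨m, n, rfl⟩ := hx
  obtain ⟨m', n', rfl⟩ := hy
  refine ⟨m * 2 ^ n' + m' * 2 ^ n, n + n', ?_⟩
  push_cast
  rw [pow_add]
  field_simp

theorem IsDyadic.neg {x : ℝ} (hx : IsDyadic x) : IsDyadic (-x) := by
  obtain ⟨m, n, rfl⟩ := hx
  exact ⟨-m, n, by push_cast; ring⟩

theorem IsDyadic.sub {x y : ℝ} (hx : IsDyadic x) (hy : IsDyadic y) : IsDyadic (x - y) := by
  rw [sub_eq_add_neg]
  exact hx.add hy.neg

theorem IsDyadic.two_zpow_mul {x : ℝ} (hx : IsDyadic x) (k : ℤ) : IsDyadic ((2 : ℝ) ^ k * x) := by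
  obtain ⟨m, n, rfl⟩ := hx
  obtain ⟨j, rfl | rfl⟩ := k.eq_nat_or_neg
  · exact ⟨2 ^ j * m, n, by push_cast; rw [zpow_natCast]; ring⟩
  · refine ⟨m, n + j, ?_⟩
    rw [zpow_neg, zpow_natCast, pow_add]
    field_simp

theorem IsDyadic.of_two_zpow_mul {x : ℝ} {k : ℤ} (hx : IsDyadic ((2 : ℝ) ^ k * x)) :
    IsDyadic x := by
  have := hx.two_zpow_mul (-k)
  rwa [← mul_assoc, ← zpow_add₀ two_ne_zero, neg_add_cancel, zpow_zero, one_mul] at this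

theorem IsDyadic.two_zpow (k : ℤ) : IsDyadic ((2 : ℝ) ^ k) := by
  have := (IsDyadic.intCast 1).two_zpow_mul k
  simpa using this

theorem isDyadic_add_iff {x y : ℝ} (hy : IsDyadic y) : IsDyadic (x + y) ↔ IsDyadic x :=
  ⟨fun h => by simpa using h.sub hy, fun h => h.add hy⟩

theorem exists_isDyadic_btwn {x y : ℝ} (h : x < y) : ∃ z, IsDyadic z ∧ x < z ∧ z < y := by
  obtain ⟨n, hn⟩ := exists_pow_lt_of_lt_one (sub_pos.2 h) (y := (1 / 2 : ℝ)) (by norm_num)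
  have h2 : (0 : ℝ) < 2 ^ n := by positivity
  refine ⟨((⌊x * 2 ^ n⌋ + 1 : ℤ) : ℝ) / 2 ^ n, ⟨_, n, rfl⟩, ?_, ?_⟩
  · rw [lt_div_iff₀ h2]
    push_cast
    exact Int.lt_floor_add_one _
  · rw [div_lt_iff₀ h2]
    push_cast
    have h1 := Int.floor_le (x * 2 ^ n)
    rw [div_pow, one_pow, div_lt_iff₀ h2] at hn
    nlinarith

/-- Along the filter `l`, the map `f` is affine with slope `2 ^ k` and value `f x` at `x`. -/
def AffineGerm (f : ℝ ≃o ℝ) (l : Filter ℝ) (x : ℝ) (k : ℤ) : Prop :=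
  ∀ᶠ z in l, f z = f x + (2 : ℝ) ^ k * (z - x)

theorem AffineGerm.mul {f g : ℝ ≃o ℝ} {l l' : Filter ℝ} {x : ℝ} {k m : ℤ}
    (hg : AffineGerm g l' (f x) m) (hf : AffineGerm f l x k) (h : Tendsto f l l') :
    AffineGerm (g * f) l x (m + k) := by
  filter_upwards [hf, h.eventually hg] with z h1 h2
  rw [RelIso.mul_apply, RelIso.mul_apply, h2, h1, zpow_add₀ two_ne_zero]
  ring

theorem AffineGerm.inv {f : ℝ ≃o ℝ} {l l' : Filter ℝ} {x : ℝ} {k : ℤ}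
    (hf : AffineGerm f l (f⁻¹ x) k) (h : Tendsto (f⁻¹ : ℝ ≃o ℝ) l' l) :
    AffineGerm f⁻¹ l' x (-k) := by
  filter_upwards [h.eventually hf] with z h1
  rw [RelIso.apply_inv_self, RelIso.apply_inv_self] at h1
  have h2 : (2 : ℝ) ^ k ≠ 0 := by positivity
  have h3 : z - x = 2 ^ k * (f⁻¹ z - f⁻¹ x) := by linarith
  rw [zpow_neg, h3]
  field_simp
  ring

theorem tendsto_nhdsGT (f : ℝ ≃o ℝ) (x : ℝ) : Tendsto f (𝓝[>] x) (𝓝[>] (f x)) :=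
  f.continuous.continuousWithinAt.tendsto_nhdsWithin fun _ h => f.strictMono h

theorem tendsto_nhdsLT (f : ℝ ≃o ℝ) (x : ℝ) : Tendsto f (𝓝[<] x) (𝓝[<] (f x)) :=
  f.continuous.continuousWithinAt.tendsto_nhdsWithin fun _ h => f.strictMono h

/-- Piecewise linear homeomorphisms of the line whose breakpoints are dyadic and locally finite and
whose slopes are powers of `2`, and which preserve the set of dyadic rationals. -/
structure IsPL (f : ℝ ≃o ℝ) : Prop where
  right : ∀ x, ∃ k, AffineGerm f (𝓝[>] x) x k
  left : ∀ x, ∃ k, AffineGerm f (𝓝[<] x) x k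
  affine : ∀ x, ¬ IsDyadic x → ∃ k, AffineGerm f (𝓝 x) x k
  dyadic_iff : ∀ x, IsDyadic (f x) ↔ IsDyadic x

theorem IsPL.one : IsPL 1 where
  right x := ⟨0, Eventually.of_forall fun z => by simp⟩
  left x := ⟨0, Eventually.of_forall fun z => by simp⟩
  affine x _ := ⟨0, Eventually.of_forall fun z => by simp⟩
  dyadic_iff x := by simp

theorem IsPL.mul {f g : ℝ ≃o ℝ} (hf : IsPL f) (hg : IsPL g) : IsPL (f * g) where
  right x := by
    obtain ⟨k, hk⟩ := hg.right x
    obtain ⟨m, hm⟩ := hf.right (g x)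
    exact ⟨_, hm.mul hk (tendsto_nhdsGT g x)⟩
  left x := by
    obtain ⟨k, hk⟩ := hg.left x
    obtain ⟨m, hm⟩ := hf.left (g x)
    exact ⟨_, hm.mul hk (tendsto_nhdsLT g x)⟩
  affine x hx := by
    obtain ⟨k, hk⟩ := hg.affine x hx
    obtain ⟨m, hm⟩ := hf.affine (g x) (by rwa [hg.dyadic_iff])
    exact ⟨_, hm.mul hk (g.continuous.tendsto x)⟩
  dyadic_iff x := by rw [RelIso.mul_apply, hf.dyadic_iff, hg.dyadic_iff]

theorem IsPL.inv {f : ℝ ≃o ℝ} (hf : IsPL f) : IsPL f⁻¹ where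
  right x := by
    obtain ⟨k, hk⟩ := hf.right (f⁻¹ x)
    exact ⟨_, hk.inv (tendsto_nhdsGT f⁻¹ x)⟩
  left x := by
    obtain ⟨k, hk⟩ := hf.left (f⁻¹ x)
    exact ⟨_, hk.inv (tendsto_nhdsLT f⁻¹ x)⟩
  affine x hx := by
    obtain ⟨k, hk⟩ := hf.affine (f⁻¹ x) (by rwa [← hf.dyadic_iff, RelIso.apply_inv_self])
    exact ⟨_, hk.inv ((f⁻¹ : ℝ ≃o ℝ).continuous.tendsto x)⟩
  dyadic_iff x := by rw [← hf.dyadic_iff, RelIso.apply_inv_self]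

theorem AffineGerm.congr {f g : ℝ ≃o ℝ} {l : Filter ℝ} {x : ℝ} {k : ℤ} (hg : AffineGerm g l x k)
    (hx : f x = g x) (h : ∀ᶠ z in l, f z = g z) : AffineGerm f l x k := by
  filter_upwards [hg, h] with z h1 h2
  rw [h2, h1, hx]

/-- All clauses of `IsPL` concern germs, so glued maps can be checked piece by piece. Two-sided
agreement with one piece is demanded only at non-dyadic points, which leaves gluing at dyadic points
free. -/
theorem IsPL.of_local {f : ℝ ≃o ℝ}
    (hr : ∀ x, ∃ g, IsPL g ∧ f x = g x ∧ ∀ᶠ z in 𝓝[>] x, f z = g z)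
    (hl : ∀ x, ∃ g, IsPL g ∧ f x = g x ∧ ∀ᶠ z in 𝓝[<] x, f z = g z)
    (ha : ∀ x, ¬ IsDyadic x → ∃ g, IsPL g ∧ ∀ᶠ z in 𝓝 x, f z = g z) : IsPL f where
  right x := by
    obtain ⟨g, hg, h1, h2⟩ := hr x
    obtain ⟨k, hk⟩ := hg.right x
    exact ⟨k, hk.congr h1 h2⟩
  left x := by
    obtain ⟨g, hg, h1, h2⟩ := hl x
    obtain ⟨k, hk⟩ := hg.left x
    exact ⟨k, hk.congr h1 h2⟩
  affine x hx := by
    obtain ⟨g, hg, h2⟩ := ha x hx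
    obtain ⟨k, hk⟩ := hg.affine x hx
    exact ⟨k, hk.congr h2.self_of_nhds h2⟩
  dyadic_iff x := by
    obtain ⟨g, hg, h1, -⟩ := hr x
    rw [h1, hg.dyadic_iff]

/-- The group of all `f` with `IsPL f`. -/
def plGroup : Subgroup (ℝ ≃o ℝ) where
  carrier := {f | IsPL f}
  mul_mem' := IsPL.mul
  one_mem' := IsPL.one
  inv_mem' := IsPL.inv

/-! ### Supports -/

/-- The homeomorphisms which are the identity off `K`. -/
def suppGroup (K : Set ℝ) : Subgroup (ℝ ≃o ℝ) where
  carrier := {f | ∀ x ∉ K, f x = x}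
  mul_mem' {f g} hf hg x hx := by rw [RelIso.mul_apply, hg x hx, hf x hx]
  one_mem' x _ := rfl
  inv_mem' {f} hf x hx := by
    conv_lhs => rw [← hf x hx]
    exact RelIso.inv_apply_self f x

theorem mem_suppGroup {K : Set ℝ} {f : ℝ ≃o ℝ} : f ∈ suppGroup K ↔ ∀ x ∉ K, f x = x := Iff.rfl

theorem suppGroup_mono {K L : Set ℝ} (h : K ⊆ L) : suppGroup K ≤ suppGroup L :=
  fun _ hf x hx => hf x fun h' => hx (h h')

theorem apply_mem_of_mem_suppGroup {K : Set ℝ} {f : ℝ ≃o ℝ} (hf : f ∈ suppGroup K) {x : ℝ}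
    (hx : x ∈ K) : f x ∈ K := by
  by_contra h
  have := hf _ h
  exact h (by rwa [f.injective this])

/-- Dyadic piecewise linear homeomorphisms supported in `[a, b]`. -/
def plOn (a b : ℝ) : Subgroup (ℝ ≃o ℝ) := plGroup ⊓ suppGroup (Icc a b)

/-- Dyadic piecewise linear homeomorphisms compactly supported in `(a, b)`. -/
def plc (a b : ℝ) : Subgroup (ℝ ≃o ℝ) where
  carrier := {f | ∃ a' b', a < a' ∧ b' < b ∧ f ∈ plOn a' b'}
  mul_mem' := by
    rintro f g ⟨a₁, b₁, h1, h2, hf⟩ ⟨a₂, b₂, h3, h4, hg⟩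
    refine ⟨min a₁ a₂, max b₁ b₂, lt_min h1 h3, max_lt h2 h4, mul_mem ?_ ?_⟩
    · exact ⟨hf.1, suppGroup_mono (Icc_subset_Icc (min_le_left _ _) (le_max_left _ _)) hf.2⟩
    · exact ⟨hg.1, suppGroup_mono (Icc_subset_Icc (min_le_right _ _) (le_max_right _ _)) hg.2⟩
  one_mem' := ⟨a + 1, b - 1, by linarith, by linarith, one_mem _⟩
  inv_mem' := by
    rintro f ⟨a₁, b₁, h1, h2, hf⟩
    exact ⟨a₁, b₁, h1, h2, inv_mem hf⟩

theorem plOn_le_plc {a a' b b' : ℝ} (h1 : a < a') (h2 : b' < b) : plOn a' b' ≤ plc a b := by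
  intro f hf
  exact ⟨a', b', h1, h2, hf⟩

theorem plOn_mono {a a' b b' : ℝ} (h1 : a ≤ a') (h2 : b' ≤ b) : plOn a' b' ≤ plOn a b :=
  fun _ hf => ⟨hf.1, suppGroup_mono (Icc_subset_Icc h1 h2) hf.2⟩

theorem plc_mono {a a' b b' : ℝ} (h1 : a ≤ a') (h2 : b' ≤ b) : plc a' b' ≤ plc a b :=
  fun _ ⟨a₁, b₁, h3, h4, hf⟩ => ⟨a₁, b₁, h1.trans_lt h3, h4.trans_le h2, hf⟩

theorem isPL_of_mem_plc {a b : ℝ} {f : ℝ ≃o ℝ} (hf : f ∈ plc a b) : IsPL f := by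
  obtain ⟨_, _, _, _, h⟩ := hf
  exact h.1

theorem plc_le_suppGroup {a b : ℝ} : plc a b ≤ suppGroup (Ioo a b) := by
  rintro f ⟨a', b', h1, h2, hf⟩
  exact suppGroup_mono (Icc_subset_Ioo h1 h2) hf.2

/-- A dyadic piecewise linear homeomorphism fixing a dyadic point `p` can be replaced by the
identity to the right of `p`. -/
theorem exists_truncation {f : ℝ ≃o ℝ} (hf : IsPL f) {p : ℝ} (hp : IsDyadic p) (hfp : f p = p) :
    ∃ g : ℝ ≃o ℝ, IsPL g ∧ (∀ x ≤ p, g x = f x) ∧ ∀ x, p ≤ x → g x = x := by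
  have hle : ∀ x, f x ≤ p ↔ x ≤ p := fun x => by rw [← f.le_iff_le (x := x), hfp]
  have hlt : ∀ x, f x < p ↔ x < p := fun x => by rw [← f.lt_iff_lt (x := x), hfp]
  have hsymm : ∀ x, f.symm x ≤ p ↔ x ≤ p := fun x => by rw [← hle, f.apply_symm_apply]
  have hmono : StrictMono fun x => if x ≤ p then f x else x := by
    intro x y hxy
    dsimp only
    split_ifs with h1 h2 h2
    · exact f.strictMono hxy
    · exact ((hle x).2 h1).trans_lt (not_le.1 h2)
    · exact absurd (hxy.le.trans h2) h1
    · exact hxy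
  let g : ℝ ≃o ℝ :=
    { toFun := fun x => if x ≤ p then f x else x
      invFun := fun x => if x ≤ p then f.symm x else x
      left_inv := fun x => by
        by_cases h : x ≤ p
        · simp [h, hle]
        · simp [h]
      right_inv := fun x => by
        by_cases h : x ≤ p
        · simp [h, hsymm]
        · simp [h]
      map_rel_iff' := hmono.le_iff_le }
  have h1 : ∀ x ≤ p, g x = f x := fun x hx => if_pos hx
  have h2 : ∀ x, p ≤ x → g x = x := by
    intro x hx
    rcases hx.eq_or_lt with rfl | hx
    · rw [h1 _ le_rfl, hfp]
    · exact if_neg (not_le.2 hx)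
  refine ⟨g, IsPL.of_local (fun x => ?_) (fun x => ?_) (fun x hx => ?_), h1, h2⟩
  · rcases lt_or_ge x p with h | h
    · refine ⟨f, hf, h1 x h.le, ?_⟩
      filter_upwards [mem_nhdsWithin_of_mem_nhds (Iio_mem_nhds h)] with z hz
      exact h1 z (le_of_lt hz)
    · refine ⟨1, IsPL.one, h2 x h, ?_⟩
      filter_upwards [self_mem_nhdsWithin] with z hz
      exact h2 z (h.trans (le_of_lt hz))
  · rcases le_or_gt x p with h | h
    · refine ⟨f, hf, h1 x h, ?_⟩
      filter_upwards [self_mem_nhdsWithin] with z hz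
      exact h1 z ((le_of_lt hz).trans h)
    · refine ⟨1, IsPL.one, h2 x h.le, ?_⟩
      filter_upwards [mem_nhdsWithin_of_mem_nhds (Ioi_mem_nhds h)] with z hz
      exact h2 z (le_of_lt hz)
  · have hne : x ≠ p := fun h => hx (h ▸ hp)
    rcases hne.lt_or_gt with h | h
    · refine ⟨f, hf, ?_⟩
      filter_upwards [Iio_mem_nhds h] with z hz
      exact h1 z (le_of_lt hz)
    · refine ⟨1, IsPL.one, ?_⟩
      filter_upwards [Ioi_mem_nhds h] with z hz
      exact h2 z (le_of_lt hz)

/-! ### Conjugation by affine maps -/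

/-- Conjugation by the affine map `x ↦ u x + c`. -/
noncomputable def affConj (u : ℝˣ) (c : ℝ) : (ℝ ≃o ℝ) →* (ℝ ≃o ℝ) where
  toFun f :=
    { toFun := fun x => u * f ((u : ℝ)⁻¹ * (x - c)) + c
      invFun := fun x => u * f.symm ((u : ℝ)⁻¹ * (x - c)) + c
      left_inv := fun x => by simp
      right_inv := fun x => by simp
      map_rel_iff' := by
        intro x y
        change (u : ℝ) * f ((u : ℝ)⁻¹ * (x - c)) + c ≤ u * f ((u : ℝ)⁻¹ * (y - c)) + c ↔ x ≤ y
        rcases lt_or_gt_of_ne u.ne_zero with h | h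
        · rw [add_le_add_iff_right, mul_le_mul_left_of_neg h, f.le_iff_le,
            mul_le_mul_left_of_neg (inv_lt_zero.2 h), sub_le_sub_iff_right]
        · rw [add_le_add_iff_right, mul_le_mul_iff_right₀ h, f.le_iff_le,
            mul_le_mul_iff_right₀ (inv_pos.2 h), sub_le_sub_iff_right] }
  map_one' := by
    ext x
    simp
  map_mul' f g := by
    ext x
    simp

theorem affConj_def (u : ℝˣ) (c : ℝ) (f : ℝ ≃o ℝ) (x : ℝ) :
    affConj u c f x = u * f ((u : ℝ)⁻¹ * (x - c)) + c := rfl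

theorem affConj_apply (u : ℝˣ) (c : ℝ) (f : ℝ ≃o ℝ) (x : ℝ) :
    affConj u c f (u * x + c) = u * f x + c := by
  rw [affConj_def]
  simp

/-- The unit `2 ^ j` of `ℝ`. -/
noncomputable def twoPow (j : ℤ) : ℝˣ := Units.mk0 ((2 : ℝ) ^ j) (by positivity)

theorem coe_twoPow (j : ℤ) : (twoPow j : ℝ) = 2 ^ j := rfl

theorem IsPL.affConj_twoPow {f : ℝ ≃o ℝ} (hf : IsPL f) (j : ℤ) {c : ℝ} (hc : IsDyadic c) :
    IsPL (affConj (twoPow j) c f) := by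
  have hj : (0 : ℝ) < 2 ^ j := by positivity
  have key : ∀ (x : ℝ) (k : ℤ) (l l' : Filter ℝ),
      Tendsto (fun z : ℝ => ((2 : ℝ) ^ j)⁻¹ * (z - c)) l l' →
      AffineGerm f l' (((2 : ℝ) ^ j)⁻¹ * (x - c)) k →
      AffineGerm (affConj (twoPow j) c f) l x k := by
    intro x k l l' ht hk
    filter_upwards [ht.eventually hk] with z hz
    rw [affConj_def, affConj_def, coe_twoPow, hz]
    field_simp
    ring
  have hcont : Continuous fun z : ℝ => ((2 : ℝ) ^ j)⁻¹ * (z - c) := by fun_prop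
  have hmono : StrictMono fun z : ℝ => ((2 : ℝ) ^ j)⁻¹ * (z - c) := fun x y h =>
    mul_lt_mul_of_pos_left (by linarith) (inv_pos.2 hj)
  have hdy : ∀ x, IsDyadic (((2 : ℝ) ^ j)⁻¹ * (x - c)) ↔ IsDyadic x := by
    intro x
    rw [← zpow_neg]
    constructor
    · intro h
      simpa using h.of_two_zpow_mul.add hc
    · intro h
      exact (h.sub hc).two_zpow_mul _
  refine ⟨fun x => ?_, fun x => ?_, fun x hx => ?_, fun x => ?_⟩
  · obtain ⟨k, hk⟩ := hf.right (((2 : ℝ) ^ j)⁻¹ * (x - c))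
    exact ⟨k, key x k _ _ (hcont.continuousWithinAt.tendsto_nhdsWithin
      fun _ h => hmono (mem_Ioi.1 h)) hk⟩
  · obtain ⟨k, hk⟩ := hf.left (((2 : ℝ) ^ j)⁻¹ * (x - c))
    exact ⟨k, key x k _ _ (hcont.continuousWithinAt.tendsto_nhdsWithin (t := Iio _)
      fun z (h : z < x) => hmono h) hk⟩
  · obtain ⟨k, hk⟩ := hf.affine (((2 : ℝ) ^ j)⁻¹ * (x - c)) (by rwa [hdy])
    exact ⟨k, key x k _ _ (hcont.tendsto x) hk⟩
  · rw [affConj_def, isDyadic_add_iff hc, coe_twoPow, ← hdy x, ← hf.dyadic_iff (((2 : ℝ) ^ j)⁻¹ * (x - c))]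
    exact ⟨fun h => h.of_two_zpow_mul, fun h => h.two_zpow_mul _⟩

theorem affConj_neg_one_apply (c : ℝ) (f : ℝ ≃o ℝ) (x : ℝ) :
    affConj (-1) c f x = c - f (c - x) := by
  rw [affConj_def, Units.val_neg, Units.val_one]
  have : (-1 : ℝ)⁻¹ * (x - c) = c - x := by rw [inv_neg_one]; ring
  rw [this]
  ring

theorem IsPL.affConj_neg_one {f : ℝ ≃o ℝ} (hf : IsPL f) {c : ℝ} (hc : IsDyadic c) :
    IsPL (affConj (-1) c f) := by
  have key : ∀ (x : ℝ) (k : ℤ) (l l' : Filter ℝ),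
      Tendsto (fun z : ℝ => c - z) l l' → AffineGerm f l' (c - x) k →
      AffineGerm (affConj (-1) c f) l x k := by
    intro x k l l' ht hk
    filter_upwards [ht.eventually hk] with z hz
    rw [affConj_neg_one_apply, affConj_neg_one_apply, hz]
    ring
  have hcont : Continuous fun z : ℝ => c - z := by fun_prop
  have hdy : ∀ x, IsDyadic (c - x) ↔ IsDyadic x := fun x =>
    ⟨fun h => by simpa using hc.sub h, fun h => hc.sub h⟩
  refine ⟨fun x => ?_, fun x => ?_, fun x hx => ?_, fun x => ?_⟩
  · obtain ⟨k, hk⟩ := hf.left (c - x)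
    exact ⟨k, key x k _ _ (hcont.continuousWithinAt.tendsto_nhdsWithin
      fun _ h => sub_lt_sub_left (mem_Ioi.1 h) c) hk⟩
  · obtain ⟨k, hk⟩ := hf.right (c - x)
    exact ⟨k, key x k _ _ (hcont.continuousWithinAt.tendsto_nhdsWithin
      fun _ h => sub_lt_sub_left (mem_Iio.1 h) c) hk⟩
  · obtain ⟨k, hk⟩ := hf.affine (c - x) (by rwa [hdy])
    exact ⟨k, key x k _ _ (hcont.tendsto x) hk⟩
  · rw [affConj_neg_one_apply, hdy, hf.dyadic_iff, hdy]

theorem affConj_neg_one_mem_plc {f : ℝ ≃o ℝ} {a b c : ℝ} (hf : f ∈ plc a b) (hc : IsDyadic c) :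
    affConj (-1) c f ∈ plc (c - b) (c - a) := by
  obtain ⟨a', b', h1, h2, hf⟩ := hf
  refine ⟨c - b', c - a', by linarith, by linarith, IsPL.affConj_neg_one hf.1 hc, fun x hx => ?_⟩
  rw [affConj_neg_one_apply, hf.2 _ fun h => hx ⟨by linarith [h.2], by linarith [h.1]⟩]
  ring

/-! ### Homeomorphisms of the unit interval as homeomorphisms of the line -/

theorem exists_eq_intCast_add (x : ℝ) : ∃ (n : ℤ) (t : I), x = n + t :=
  ⟨⌊x⌋, fractI x, (floor_add_fractI x).symm⟩

theorem glue_apply (φ : ℤ → (I ≃o I)) (n : ℤ) (t : I) :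
    glue φ ((n : ℝ) + (t : ℝ)) = (n : ℝ) + (φ n t : ℝ) := glueFun_apply φ n t

/-- Extension of a homeomorphism of `[0, 1]` to the line by the identity. -/
noncomputable def ext : (I ≃o I) →* (ℝ ≃o ℝ) where
  toFun f := glue fun n => if n = 0 then f else 1
  map_one' := by
    ext x
    obtain ⟨n, t, rfl⟩ := exists_eq_intCast_add x
    rw [glue_apply]
    simp
  map_mul' f g := by
    ext x
    obtain ⟨n, t, rfl⟩ := exists_eq_intCast_add x
    rw [RelIso.mul_apply, glue_apply, glue_apply, glue_apply]
    split_ifs <;> simp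

theorem ext_apply_coe (f : I ≃o I) (t : I) : ext f t = f t := by
  have := glue_apply (fun n => if n = 0 then f else 1) 0 t
  change glue _ _ = _
  simpa using this

theorem ext_mem_suppGroup (f : I ≃o I) : ext f ∈ suppGroup (Icc 0 1) := by
  intro x hx
  obtain ⟨n, t, rfl⟩ := exists_eq_intCast_add x
  by_cases hn : n = 0
  · subst hn
    exact absurd (by simp) hx
  · change glue _ _ = _
    rw [glue_apply, if_neg hn]
    simp

theorem ext_apply_eq_self_iff {f : I ≃o I} {x : ℝ} : ext f x = x ↔ x ∉ supp f := by
  by_cases hx : x ∈ Icc (0 : ℝ) 1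
  · rw [show x = ((⟨x, hx⟩ : I) : ℝ) from rfl, ext_apply_coe]
    constructor
    · rintro h ⟨y, hy, hne⟩
      have : y = ⟨x, hx⟩ := Subtype.ext hy
      subst this
      exact hne (Subtype.ext h)
    · intro h
      by_contra hne
      exact h ⟨⟨x, hx⟩, rfl, fun h' => hne (congrArg Subtype.val h')⟩
  · refine iff_of_true (ext_mem_suppGroup f x hx) ?_
    rintro ⟨y, rfl, -⟩
    exact hx y.2

theorem ext_mem_suppGroup_iff {f : I ≃o I} {K : Set ℝ} : ext f ∈ suppGroup K ↔ supp f ⊆ K := by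
  rw [mem_suppGroup]
  constructor
  · intro h x hx
    by_contra hK
    exact ext_apply_eq_self_iff.1 (h x hK) hx
  · intro h x hx
    exact ext_apply_eq_self_iff.2 fun h' => hx (h h')

theorem ext_conjIota (f : I ≃o I) : ext (conjIota f) = affConj (-1) 1 (ext f) := by
  ext x
  rw [affConj_neg_one_apply]
  by_cases hx : x ∈ Icc (0 : ℝ) 1
  · obtain ⟨t, rfl⟩ : ∃ t : I, (t : ℝ) = x := ⟨⟨x, hx⟩, rfl⟩
    have h1 : (1 : ℝ) - t = ((unitInterval.symm t : I) : ℝ) := rfl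
    rw [h1, ext_apply_coe, ext_apply_coe]
    rfl
  · rw [ext_mem_suppGroup _ x hx, ext_mem_suppGroup _ (1 - x)]
    · ring
    · exact fun h => hx ⟨by linarith [h.2], by linarith [h.1]⟩

theorem exists_ext_eq {f : ℝ ≃o ℝ} (hf : f ∈ suppGroup (Icc 0 1)) : ∃ g, ext g = f := by
  have h1 : ∀ t : I, f t ∈ Icc (0 : ℝ) 1 := fun t => apply_mem_of_mem_suppGroup hf t.2
  have h2 : ∀ t : I, f⁻¹ t ∈ Icc (0 : ℝ) 1 := fun t =>
    apply_mem_of_mem_suppGroup (inv_mem hf) t.2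
  let g : I ≃o I :=
    { toFun := fun t => ⟨f t, h1 t⟩
      invFun := fun t => ⟨f⁻¹ t, h2 t⟩
      left_inv := fun t => Subtype.ext (RelIso.inv_apply_self f t)
      right_inv := fun t => Subtype.ext (RelIso.apply_inv_self f t)
      map_rel_iff' := f.le_iff_le }
  refine ⟨g, ?_⟩
  ext x
  by_cases hx : x ∈ Icc (0 : ℝ) 1
  · rw [show x = ((⟨x, hx⟩ : I) : ℝ) from rfl, ext_apply_coe]
    rfl
  · rw [ext_mem_suppGroup _ x hx, hf x hx]

/-! ### Thompson's group -/

/-- Infinitely many breakpoints would accumulate at some `x`; but the one-sided affine germs at `x`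
leave no breakpoint in a punctured neighbourhood. -/
theorem finite_breakpoints {f : ℝ ≃o ℝ} (hf : IsPL f) (a b : ℝ) :
    {x ∈ Icc a b | ¬ ∃ k, AffineGerm f (𝓝 x) x k}.Finite := by
  by_contra hinf
  obtain ⟨x, -, hx⟩ := Set.Infinite.exists_accPt_of_subset_isCompact hinf
    (isCompact_Icc (a := a) (b := b)) fun x hx => hx.1
  have key : ∀ (S : Set ℝ) (k : ℤ), IsOpen S → AffineGerm f (𝓝[S] x) x k →
      ∀ᶠ z in 𝓝[S] x, ∃ k, AffineGerm f (𝓝 z) z k := by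
    intro S k hS h
    filter_upwards [eventually_eventually_nhdsWithin.2 h, h, self_mem_nhdsWithin] with z h1 h2 h3
    rw [hS.nhdsWithin_eq h3] at h1
    refine ⟨k, ?_⟩
    filter_upwards [h1] with w hw
    rw [hw, h2]
    ring
  obtain ⟨k, hk⟩ := hf.right x
  obtain ⟨l, hl⟩ := hf.left x
  have h1 : ∀ᶠ z in 𝓝[≠] x, ∃ k, AffineGerm f (𝓝 z) z k := by
    rw [← Iio_union_Ioi, nhdsWithin_union]
    exact eventually_sup.2 ⟨key _ l isOpen_Iio hl, key _ k isOpen_Ioi hk⟩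
  obtain ⟨z, h2, h3⟩ := (((accPt_iff_frequently_nhdsNE).1 hx).and_eventually h1).exists
  exact h2.2 h3

theorem mem_thompsonF_of_isPL {f : I ≃o I} (hf : IsPL (ext f)) : f ∈ thompsonF := by
  refine ⟨(finite_breakpoints hf 0 1).toFinset, fun s hs => ?_, fun x hx => ?_⟩
  · rw [Finite.mem_toFinset] at hs
    by_contra h
    exact hs.2 (hf.affine s h)
  · rw [Finite.mem_toFinset] at hx
    have : ∃ k, AffineGerm (ext f) (𝓝 (x : ℝ)) x k := by
      by_contra h
      exact hx ⟨x.2, h⟩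
    obtain ⟨k, hk⟩ := this
    refine ⟨k, f x - 2 ^ k * x, ?_⟩
    have := (continuous_subtype_val.tendsto x).eventually hk
    filter_upwards [this] with y hy
    rw [ext_apply_coe, ext_apply_coe] at hy
    rw [hy]
    ring

theorem zpow_mul_add_unique {k l : ℤ} {c d : ℝ} {x y : ℝ} (hxy : x ≠ y)
    (h1 : (2 : ℝ) ^ k * x + c = 2 ^ l * x + d) (h2 : (2 : ℝ) ^ k * y + c = 2 ^ l * y + d) :
    c = d := by
  have : ((2 : ℝ) ^ k - 2 ^ l) * (x - y) = 0 := by linear_combination h1 - h2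
  have h3 : (2 : ℝ) ^ k - 2 ^ l = 0 := by simpa [sub_ne_zero.2 hxy] using this
  have : (2 : ℝ) ^ k = 2 ^ l := by linarith
  rw [this] at h1
  linarith

/-- Connectedness: the points with the same germ as the midpoint `m` and those with another affine
germ form disjoint open sets covering the interval. -/
theorem affine_on_Ioo {f : ℝ → ℝ} {a b : ℝ} (hab : a < b)
    (h : ∀ x ∈ Ioo a b, ∃ (k : ℤ) (c : ℝ), ∀ᶠ z in 𝓝 x, f z = 2 ^ k * z + c) :
    ∃ (k : ℤ) (c : ℝ), ∀ z ∈ Ioo a b, f z = 2 ^ k * z + c := by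
  obtain ⟨m, hm⟩ := nonempty_Ioo.2 hab
  obtain ⟨k, c, hk⟩ := h m hm
  refine ⟨k, c, ?_⟩
  let U := {x | ∀ᶠ z in 𝓝 x, f z = 2 ^ k * z + c}
  let V := {x | ∃ (l : ℤ) (d : ℝ), (l, d) ≠ (k, c) ∧ ∀ᶠ z in 𝓝 x, f z = 2 ^ l * z + d}
  have hU : IsOpen U := isOpen_iff_mem_nhds.2 fun x hx => eventually_eventually_nhds.2 hx
  have hV : IsOpen V := by
    refine isOpen_iff_mem_nhds.2 fun x ⟨l, d, h1, h2⟩ => ?_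
    filter_upwards [eventually_eventually_nhds.2 h2] with y hy
    exact ⟨l, d, h1, hy⟩
  have hUV : Disjoint U V := by
    rw [Set.disjoint_left]
    rintro x h1 ⟨l, d, h2, h3⟩
    have h4 : ∀ᶠ z in 𝓝[≠] x, (2 : ℝ) ^ k * z + c = 2 ^ l * z + d := by
      filter_upwards [mem_nhdsWithin_of_mem_nhds (h1.and h3)] with z hz
      rw [← hz.1, hz.2]
    obtain ⟨y, hy, hy'⟩ := (h4.and self_mem_nhdsWithin).exists
    have hx' : (2 : ℝ) ^ k * x + c = 2 ^ l * x + d := by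
      rw [← h1.self_of_nhds, h3.self_of_nhds]
    have hcd := zpow_mul_add_unique hy' hy hx'
    apply h2
    have : ((2 : ℝ) ^ k - 2 ^ l) * (x - y) = 0 := by linear_combination hx' - hy
    have h5 : (2 : ℝ) ^ k - 2 ^ l = 0 := by
      simpa [sub_ne_zero.2 (Ne.symm hy')] using this
    have h6 : k = l := zpow_right_injective₀ (by norm_num) (by norm_num)
      (show (2 : ℝ) ^ k = 2 ^ l by linarith)
    rw [h6, hcd]
  have hsub : Ioo a b ⊆ U :=
    isPreconnected_Ioo.subset_left_of_subset_union hU hV hUV (fun x hx => by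
      obtain ⟨l, d, hl⟩ := h x hx
      by_cases hld : (l, d) = (k, c)
      · left
        obtain ⟨rfl, rfl⟩ := Prod.mk.inj hld
        exact hl
      · exact Or.inr ⟨l, d, hld, hl⟩) ⟨m, hm, hk⟩
  exact fun z hz => (hsub hz).self_of_nhds

/-- The substantial clause is preservation of dyadics, which needs dyadic intercepts on all affine
pieces. The identity on the negative axis provides the initial intercept `0`, and dyadic breakpoints
pass dyadicity on to the next piece. -/
theorem isPL_of_finite {f : ℝ ≃o ℝ} {S : Set ℝ} (hS : S.Finite) (hdy : ∀ x ∈ S, IsDyadic x)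
    (h0 : ∀ x ≤ 0, f x = x)
    (h : ∀ x ∉ S, ∃ (k : ℤ) (c : ℝ), ∀ᶠ z in 𝓝 x, f z = 2 ^ k * z + c) : IsPL f := by
  have hnb : ∀ x, ∀ᶠ z in 𝓝[≠] x, z ∉ S := by
    intro x
    have : (S \ {x})ᶜ ∈ 𝓝 x := (hS.subset sdiff_subset).isClosed.isOpen_compl.mem_nhds (by simp)
    filter_upwards [mem_nhdsWithin_of_mem_nhds this, self_mem_nhdsWithin] with z h1 h2 h3
    exact h1 ⟨h3, h2⟩
  have hR : ∀ x, ∃ y > x, ∃ (k : ℤ) (c : ℝ), ∀ z ∈ Ico x y, f z = 2 ^ k * z + c := by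
    intro x
    have h1 : ∀ᶠ z in 𝓝[>] x, z ∉ S := nhdsWithin_mono _ (fun z hz => ne_of_gt hz) (hnb x)
    obtain ⟨y, hy, hy'⟩ := mem_nhdsGT_iff_exists_Ioo_subset.1 h1
    obtain ⟨k, c, hk⟩ := affine_on_Ioo hy fun z hz => h z (hy' hz)
    refine ⟨y, hy, k, c, fun z hz => ?_⟩
    rcases hz.1.eq_or_lt with rfl | hlt
    · have e1 : Tendsto f (𝓝[>] x) (𝓝 (f x)) := (f.continuous.tendsto x).mono_left inf_le_left
      have e2 : Tendsto (fun z : ℝ => 2 ^ k * z + c) (𝓝[>] x) (𝓝 (2 ^ k * x + c)) :=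
        (Continuous.tendsto (by fun_prop) x).mono_left inf_le_left
      refine tendsto_nhds_unique (e1.congr' ?_) e2
      filter_upwards [Ioo_mem_nhdsGT hy] with z hz using hk z hz
    · exact hk z ⟨hlt, hz.2⟩
  have hL : ∀ x, ∃ y < x, ∃ (k : ℤ) (c : ℝ), ∀ z ∈ Ioc y x, f z = 2 ^ k * z + c := by
    intro x
    have h1 : ∀ᶠ z in 𝓝[<] x, z ∉ S := nhdsWithin_mono _ (fun z hz => ne_of_lt hz) (hnb x)
    obtain ⟨y, hy, hy'⟩ := mem_nhdsLT_iff_exists_Ioo_subset.1 h1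
    obtain ⟨k, c, hk⟩ := affine_on_Ioo hy fun z hz => h z (hy' hz)
    refine ⟨y, hy, k, c, fun z hz => ?_⟩
    rcases hz.2.eq_or_lt with rfl | hlt
    · have e1 : Tendsto f (𝓝[<] z) (𝓝 (f z)) := (f.continuous.tendsto z).mono_left inf_le_left
      have e2 : Tendsto (fun z : ℝ => 2 ^ k * z + c) (𝓝[<] z) (𝓝 (2 ^ k * z + c)) :=
        (Continuous.tendsto (by fun_prop) z).mono_left inf_le_left
      refine tendsto_nhds_unique (e1.congr' ?_) e2
      filter_upwards [Ioo_mem_nhdsLT hy] with z hz using hk z hz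
    · exact hk z ⟨hz.1, hlt⟩
  -- Continuous induction from the left: at the infimum `u` of the bad points the left piece
  -- inherits a dyadic intercept, and continuity at `u` makes the intercept of the right piece
  -- dyadic too, so there are no bad points just beyond `u`.
  have hD : ∀ x, ∃ (k : ℤ) (c : ℝ), IsDyadic c ∧ ∃ y < x, ∀ z ∈ Ioc y x, f z = 2 ^ k * z + c := by
    by_contra hcon
    push Not at hcon
    let T := {x | ¬ ∃ (k : ℤ) (c : ℝ), IsDyadic c ∧ ∃ y < x, ∀ z ∈ Ioc y x, f z = 2 ^ k * z + c}
    have hTne : T.Nonempty := by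
      obtain ⟨x, hx⟩ := hcon
      refine ⟨x, ?_⟩
      rintro ⟨k, c, hc, y, hy, hk⟩
      obtain ⟨z, hz, hne⟩ := hx k c hc y hy
      exact hne (hk z hz)
    have hTb : BddBelow T := by
      refine ⟨0, fun x hx => ?_⟩
      by_contra hlt
      refine hx ⟨0, 0, by simpa using IsDyadic.intCast 0, x - 1, by linarith, fun z hz => ?_⟩
      rw [h0 z (hz.2.trans (not_le.1 hlt).le)]
      simp
    set u := sInf T with hu
    have hbelow : ∀ x < u, x ∉ T := fun x hx hxT => absurd (csInf_le hTb hxT) (not_le.2 hx)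
    obtain ⟨y, hy, k, c, hk⟩ := hL u
    have hc : IsDyadic c := by
      obtain ⟨w, hw1, hw2⟩ := exists_between hy
      obtain ⟨l, d, hd, v, hv, hl⟩ := not_not.1 (hbelow w hw2)
      obtain ⟨w', h1, h2⟩ := exists_between (max_lt hv hw1)
      have e1 := hk w ⟨hw1, hw2.le⟩
      have e2 := hl w ⟨hv, le_rfl⟩
      have e3 := hk w' ⟨(le_max_right _ _).trans_lt h1, (h2.trans hw2).le⟩
      have e4 := hl w' ⟨(le_max_left _ _).trans_lt h1, h2.le⟩
      rwa [zpow_mul_add_unique h2.ne (e3.symm.trans e4) (e1.symm.trans e2)]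
    have hu_notin : u ∉ T := not_not.2 ⟨k, c, hc, y, hy, hk⟩
    obtain ⟨y', hy', l, d, hl⟩ := hR u
    have hd : IsDyadic d := by
      by_cases huS : u ∈ S
      · have e1 := hk u ⟨hy, le_rfl⟩
        have e2 := hl u ⟨le_rfl, hy'⟩
        have : d = 2 ^ k * u + c - 2 ^ l * u := by linarith
        rw [this]
        exact (((hdy u huS).two_zpow_mul k).add hc).sub ((hdy u huS).two_zpow_mul l)
      · obtain ⟨j, b, hj⟩ := h u huS
        obtain ⟨p, q, ⟨hp, hq⟩, hpq⟩ := mem_nhds_iff_exists_Ioo_subset.1 hj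
        obtain ⟨w, hw1, hw2⟩ := exists_between (max_lt hp hy)
        obtain ⟨w', hw1', hw2'⟩ := exists_between (lt_min hq hy')
        have e1 := hk u ⟨hy, le_rfl⟩
        have e2 := hl u ⟨le_rfl, hy'⟩
        have e3 : f u = 2 ^ j * u + b := hpq ⟨hp, hq⟩
        have e4 := hk w ⟨(le_max_right _ _).trans_lt hw1, hw2.le⟩
        have e5 : f w = 2 ^ j * w + b := hpq ⟨(le_max_left _ _).trans_lt hw1, hw2.trans hq⟩
        have e6 := hl w' ⟨hw1'.le, hw2'.trans_le (min_le_right _ _)⟩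
        have e7 : f w' = 2 ^ j * w' + b := hpq ⟨hp.trans hw1', hw2'.trans_le (min_le_left _ _)⟩
        rw [zpow_mul_add_unique hw1'.ne (e2.symm.trans e3) (e6.symm.trans e7),
          ← zpow_mul_add_unique hw2.ne (e4.symm.trans e5) (e1.symm.trans e3)]
        exact hc
    obtain ⟨x, hxT, hx⟩ := exists_lt_of_csInf_lt hTne (hu ▸ hy' : sInf T < y')
    have hux : u < x := lt_of_le_of_ne (csInf_le hTb hxT) fun h => hu_notin (h ▸ hxT)
    exact hxT ⟨l, d, hd, u, hux, fun z hz => hl z ⟨hz.1.le, hz.2.trans_lt hx⟩⟩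
  refine ⟨fun x => ?_, fun x => ?_, fun x hx => ?_, fun x => ?_⟩
  · obtain ⟨y, hy, k, c, hk⟩ := hR x
    refine ⟨k, ?_⟩
    filter_upwards [Ioo_mem_nhdsGT hy] with z hz
    rw [hk z ⟨hz.1.le, hz.2⟩, hk x ⟨le_rfl, hy⟩]
    ring
  · obtain ⟨y, hy, k, c, hk⟩ := hL x
    refine ⟨k, ?_⟩
    filter_upwards [Ioo_mem_nhdsLT hy] with z hz
    rw [hk z ⟨hz.1, hz.2.le⟩, hk x ⟨hy, le_rfl⟩]
    ring
  · obtain ⟨k, c, hk⟩ := h x fun hxS => hx (hdy x hxS)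
    refine ⟨k, ?_⟩
    filter_upwards [hk] with z hz
    rw [hz, hk.self_of_nhds]
    ring
  · obtain ⟨k, c, hc, y, hy, hk⟩ := hD x
    rw [hk x ⟨hy, le_rfl⟩, isDyadic_add_iff hc]
    exact ⟨fun h => h.of_two_zpow_mul, fun h => h.two_zpow_mul _⟩

theorem isPL_ext_of_mem_thompsonF {f : I ≃o I} (hf : f ∈ thompsonF) : IsPL (ext f) := by
  obtain ⟨S, hS, h⟩ := hf
  have hz : IsDyadic 0 := by simpa using IsDyadic.intCast 0
  have ho : IsDyadic 1 := by simpa using IsDyadic.intCast 1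
  -- Extending by the identity may create breakpoints at `0` and `1`, even if `S` omits them.
  refine isPL_of_finite (S := insert 0 (insert 1 (S : Set ℝ))) (S.finite_toSet.insert 1 |>.insert 0)
    ?_ ?_ ?_
  · rintro x (rfl | rfl | hx)
    exacts [hz, ho, hS x hx]
  · intro x hx
    rcases hx.eq_or_lt with rfl | hx
    · rw [show (0 : ℝ) = ((⊥ : I) : ℝ) from rfl, ext_apply_coe, f.map_bot]
    · exact ext_mem_suppGroup f x fun h => absurd h.1 (not_le.2 hx)
  · intro x hx
    simp only [mem_insert_iff, not_or] at hx
    obtain ⟨hx0, hx1, hxS⟩ := hx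
    by_cases hxI : x ∈ Icc (0 : ℝ) 1
    · obtain ⟨k, c, hk⟩ := h ⟨x, hxI⟩ hxS
      refine ⟨k, c, ?_⟩
      have hnb : Icc (0 : ℝ) 1 ∈ 𝓝 x :=
        Icc_mem_nhds (lt_of_le_of_ne hxI.1 (Ne.symm hx0)) (lt_of_le_of_ne hxI.2 hx1)
      rw [nhds_subtype_eq_comap, eventually_comap] at hk
      filter_upwards [hk, hnb] with z h1 h2
      have := h1 ⟨z, h2⟩ rfl
      rwa [← ext_apply_coe] at this
    · refine ⟨0, 0, ?_⟩
      filter_upwards [isClosed_Icc.isOpen_compl.mem_nhds hxI] with z hz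
      rw [ext_mem_suppGroup f z hz]
      simp

theorem isPL_ext_iff {f : I ≃o I} : IsPL (ext f) ↔ f ∈ thompsonF :=
  ⟨mem_thompsonF_of_isPL, isPL_ext_of_mem_thompsonF⟩

/-- `plOn r s` consists of the extensions of the elements of `F_{[r,s]}`. -/
theorem mem_plOn_iff {r s : ℝ} (hr : 0 ≤ r) (hs : s ≤ 1) {f : ℝ ≃o ℝ} :
    f ∈ plOn r s ↔ ∃ g ∈ thompsonFOn r s, ext g = f := by
  constructor
  · intro hf
    obtain ⟨g, rfl⟩ := exists_ext_eq (plOn_mono hr hs hf).2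
    exact ⟨g, ⟨isPL_ext_iff.1 hf.1, ext_mem_suppGroup_iff.1 hf.2⟩, rfl⟩
  · rintro ⟨g, ⟨h1, h2⟩, rfl⟩
    exact ⟨isPL_ext_iff.2 h1, ext_mem_suppGroup_iff.2 h2⟩

theorem IsAdmissible.plOn_eq {c₀ ν₂ ν₃ : I ≃o I} (h : IsAdmissible c₀ ν₂ ν₃) :
    plOn (1 / 16) (15 / 16) = Subgroup.closure {ext ν₂, ext ν₃} := by
  have h1 : Subgroup.closure {ext ν₂, ext ν₃} = (Subgroup.closure {ν₂, ν₃}).map ext := by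
    rw [MonoidHom.map_closure, image_pair]
  rw [h1]
  ext f
  rw [mem_plOn_iff (by norm_num) (by norm_num), Subgroup.mem_map, ← h.closure_eq]
  rfl

/-! ### Small bumps -/

/-- The properties of the extension of `c₀` to the line that are used below. -/
structure IsBump (c : ℝ ≃o ℝ) : Prop where
  isPL : IsPL c
  supp : c ∈ suppGroup (Ioo 0 (1 / 4))
  lt_apply : ∀ x ∈ Ioo (0 : ℝ) (1 / 4), x < c x
  apply_eq : ∀ x ∈ Ioo (0 : ℝ) (1 / 16), c x = 2 * x

theorem IsAdmissible.isBump {c₀ ν₂ ν₃ : I ≃o I} (h : IsAdmissible c₀ ν₂ ν₃) : IsBump (ext c₀) where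
  isPL := isPL_ext_iff.2 h.mem_F
  supp := ext_mem_suppGroup_iff.2 h.supp_eq.subset
  lt_apply x hx := by
    have hxI : x ∈ Icc (0 : ℝ) 1 := ⟨hx.1.le, by linarith [hx.2]⟩
    have := h.lt_apply ⟨x, hxI⟩ hx
    rw [← Subtype.coe_lt_coe] at this
    rwa [← ext_apply_coe] at this
  apply_eq x hx := by
    have hxI : x ∈ Icc (0 : ℝ) 1 := ⟨hx.1.le, by linarith [hx.2]⟩
    have := h.apply_eq ⟨x, hxI⟩ hx
    rwa [← ext_apply_coe] at this

theorem exists_two_zpow_lt {ε : ℝ} (h : 0 < ε) : ∃ j : ℤ, (2 : ℝ) ^ j < ε := by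
  obtain ⟨n, hn⟩ := exists_pow_lt_of_lt_one h (y := (1 / 2 : ℝ)) (by norm_num)
  refine ⟨-n, ?_⟩
  rwa [zpow_neg, zpow_natCast, ← one_div, ← one_div_pow]

namespace IsBump

variable {c : ℝ ≃o ℝ} (hc : IsBump c) {p : ℝ} (j : ℤ)

include hc

theorem copy_mem_suppGroup (p : ℝ) : affConj (twoPow j) p c ∈ suppGroup (Ioo p (p + 2 ^ j / 4)) := by
  intro x hx
  have hj : (0 : ℝ) < 2 ^ j := by positivity
  rw [affConj_def, coe_twoPow, hc.supp]
  · field_simp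
    ring
  · rintro ⟨h1, h2⟩
    rw [inv_mul_eq_div, lt_div_iff₀ hj] at h1
    rw [inv_mul_eq_div, div_lt_iff₀ hj] at h2
    exact hx ⟨by linarith, by linarith⟩

theorem copy_mem_plOn (hp : IsDyadic p) : affConj (twoPow j) p c ∈ plOn p (p + 2 ^ j / 4) :=
  ⟨hc.isPL.affConj_twoPow j hp, suppGroup_mono Ioo_subset_Icc_self (hc.copy_mem_suppGroup j p)⟩

theorem lt_copy_apply {x : ℝ} (h1 : p < x) (h2 : x < p + 2 ^ j / 4) :
    x < affConj (twoPow j) p c x := by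
  have hj : (0 : ℝ) < 2 ^ j := by positivity
  have h := hc.lt_apply (((2 : ℝ) ^ j)⁻¹ * (x - p)) ⟨by
    rw [inv_mul_eq_div, lt_div_iff₀ hj]
    linarith, by
    rw [inv_mul_eq_div, div_lt_iff₀ hj]
    linarith⟩
  rw [affConj_def, coe_twoPow]
  rw [inv_mul_lt_iff₀ hj] at h
  linarith

theorem copy_apply_eq {x : ℝ} (h1 : p < x) (h2 : x < p + 2 ^ j / 16) :
    affConj (twoPow j) p c x = p + 2 * (x - p) := by
  have hj : (0 : ℝ) < 2 ^ j := by positivity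
  rw [affConj_def, coe_twoPow, hc.apply_eq]
  · field_simp
    ring
  · constructor
    · rw [inv_mul_eq_div, lt_div_iff₀ hj]
      linarith
    · rw [inv_mul_eq_div, div_lt_iff₀ hj]
      linarith

omit j

theorem exists_lt_apply {a b u : ℝ} (h1 : a < u) (h2 : u < b) : ∃ g ∈ plc a b, u < g u := by
  obtain ⟨j, hj⟩ := exists_two_zpow_lt (sub_pos.2 h2)
  have hj0 : (0 : ℝ) < 2 ^ j := by positivity
  obtain ⟨p, hp, hp1, hp2⟩ := exists_isDyadic_btwn (max_lt h1 (show u - 2 ^ j / 4 < u by linarith))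
  have h3 := (le_max_left a (u - 2 ^ j / 4)).trans_lt hp1
  have h4 := (le_max_right a (u - 2 ^ j / 4)).trans_lt hp1
  exact ⟨_, plOn_le_plc h3 (by linarith) (hc.copy_mem_plOn j hp),
    hc.lt_copy_apply j hp2 (by linarith)⟩

/-- If the orbit of `x` were bounded by `y`, its supremum would lie in `(a, b)`; an element moving
the supremum to the right would carry a nearby orbit point beyond it. -/
theorem exists_lt_apply_of_mem {a b x y : ℝ} (hx : x ∈ Ioo a b) (hy : y ∈ Ioo a b) :
    ∃ g ∈ plc a b, y < g x := by
  by_contra! hcon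
  let S := {z | ∃ g ∈ plc a b, g x = z}
  have hne : S.Nonempty := ⟨x, 1, one_mem _, rfl⟩
  have hbdd : BddAbove S := ⟨y, by
    rintro _ ⟨g, hg, rfl⟩
    exact hcon g hg⟩
  have h1 : x ≤ sSup S := le_csSup hbdd ⟨1, one_mem _, rfl⟩
  have h2 : sSup S ≤ y := csSup_le hne (by
    rintro _ ⟨g, hg, rfl⟩
    exact hcon g hg)
  obtain ⟨g, hg, hlt⟩ := hc.exists_lt_apply (hx.1.trans_le h1) (h2.trans_lt hy.2)
  have h3 : g⁻¹ (sSup S) < sSup S := by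
    rw [← g.lt_iff_lt, RelIso.apply_inv_self]
    exact hlt
  obtain ⟨_, ⟨k, hk, rfl⟩, h4⟩ := exists_lt_of_lt_csSup hne h3
  have h5 : sSup S < g (k x) := by
    rw [← g.lt_iff_lt, RelIso.apply_inv_self] at h4
    exact h4
  exact absurd (le_csSup hbdd ⟨g * k, mul_mem hg hk, rfl⟩) (not_le.2 h5)

end IsBump

/-! ### Slopes at fixed points -/

/-- `f` fixes `p` and its slope to the right of `p` is `2 ^ k`. -/
def RightSlope (p : ℝ) (f : ℝ ≃o ℝ) (k : ℤ) : Prop := f p = p ∧ AffineGerm f (𝓝[>] p) p k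

theorem RightSlope.mul {p : ℝ} {f g : ℝ ≃o ℝ} {k l : ℤ} (hf : RightSlope p f k)
    (hg : RightSlope p g l) : RightSlope p (f * g) (k + l) := by
  refine ⟨by rw [RelIso.mul_apply, hg.1, hf.1], AffineGerm.mul (l' := 𝓝[>] p) ?_ hg.2 ?_⟩
  · rw [hg.1]
    exact hf.2
  · have := tendsto_nhdsGT g p
    rwa [hg.1] at this

theorem inv_apply_eq_self {f : ℝ ≃o ℝ} {p : ℝ} (h : f p = p) : f⁻¹ p = p := by
  conv_lhs => rw [← h]
  exact RelIso.inv_apply_self f p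

theorem RightSlope.inv {p : ℝ} {f : ℝ ≃o ℝ} {k : ℤ} (hf : RightSlope p f k) :
    RightSlope p f⁻¹ (-k) := by
  have h := inv_apply_eq_self hf.1
  refine ⟨h, AffineGerm.inv (l := 𝓝[>] p) ?_ ?_⟩
  · rw [h]
    exact hf.2
  · have := tendsto_nhdsGT f⁻¹ p
    rwa [h] at this

theorem RightSlope.of_eventually {p : ℝ} {f : ℝ ≃o ℝ} (h0 : f p = p)
    (h : ∀ᶠ z in 𝓝[>] p, f z = z) : RightSlope p f 0 := by
  refine ⟨h0, ?_⟩
  filter_upwards [h] with z hz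
  rw [hz, h0]
  simp

theorem RightSlope.one (p : ℝ) : RightSlope p 1 0 :=
  RightSlope.of_eventually rfl (Eventually.of_forall fun _ => rfl)

theorem RightSlope.zpow {p : ℝ} {f : ℝ ≃o ℝ} {k : ℤ} (hf : RightSlope p f k) (n : ℤ) :
    RightSlope p (f ^ n) (n * k) := by
  have hpow : ∀ n : ℕ, RightSlope p (f ^ n) (n * k) := by
    intro n
    induction n with
    | zero => simpa using RightSlope.one p
    | succ n ih =>
      rw [pow_succ]
      have := ih.mul hf
      push_cast
      rwa [add_mul, one_mul]
  obtain ⟨m, rfl | rfl⟩ := n.eq_nat_or_neg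
  · rw [zpow_natCast]
    exact hpow m
  · rw [zpow_neg, zpow_natCast, neg_mul]
    exact (hpow m).inv

theorem RightSlope.unique {p : ℝ} {f : ℝ ≃o ℝ} {k l : ℤ} (hk : RightSlope p f k)
    (hl : RightSlope p f l) : k = l := by
  obtain ⟨z, ⟨h1, h2⟩, h3⟩ := ((hk.2.and hl.2).and self_mem_nhdsWithin).exists
  have h4 : z - p ≠ 0 := sub_ne_zero.2 (ne_of_gt h3)
  rw [h1] at h2
  have h5 : (2 : ℝ) ^ k = 2 ^ l := by
    have := add_left_cancel h2
    exact mul_right_cancel₀ h4 this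
  exact zpow_right_injective₀ (by norm_num) (by norm_num) h5

/-! ### Prescribing germs -/

namespace IsBump

variable {c : ℝ ≃o ℝ} (hc : IsBump c)

include hc

/-- A small copy of the bump based at `x` has slope `2` to the right of `x`; its `k`-th power has
slope `2 ^ k`. -/
theorem exists_right_germ {a b x : ℝ} (hx : IsDyadic x) (h1 : a < x) (h2 : x < b) (k : ℤ) :
    ∃ g ∈ plc a b, (∀ z ≤ x, g z = z) ∧ AffineGerm g (𝓝[>] x) x k := by
  obtain ⟨j, hj⟩ := exists_two_zpow_lt (sub_pos.2 h2)
  have hj0 : (0 : ℝ) < 2 ^ j := by positivity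
  have hfix : affConj (twoPow j) x c x = x := hc.copy_mem_suppGroup j x x fun h => lt_irrefl _ h.1
  have hs : RightSlope x (affConj (twoPow j) x c) 1 := by
    refine ⟨hfix, ?_⟩
    filter_upwards [Ioo_mem_nhdsGT (show x < x + 2 ^ j / 16 by linarith)] with z hz
    rw [hc.copy_apply_eq j hz.1 hz.2, hfix]
    simp
  have hs' := hs.zpow k
  rw [mul_one] at hs'
  refine ⟨_, zpow_mem (plOn_le_plc h1 (by linarith) (hc.copy_mem_plOn j hx)) k,
    fun z hz => ?_, hs'.2⟩
  exact zpow_mem (hc.copy_mem_suppGroup j x) k z fun h => absurd h.1 (not_lt.2 hz)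

theorem exists_left_germ {a b x : ℝ} (hx : IsDyadic x) (h1 : a < x) (h2 : x < b) (k : ℤ) :
    ∃ g ∈ plc a b, (∀ z, x ≤ z → g z = z) ∧ AffineGerm g (𝓝[<] x) x k := by
  obtain ⟨g, hg, hfix, hk⟩ := hc.exists_right_germ (a := x + x - b) (b := x + x - a) hx
    (by linarith) (by linarith) k
  have hfx : ∀ z, x ≤ z → affConj (-1) (x + x) g z = z := by
    intro z hz
    rw [affConj_neg_one_apply, hfix _ (by linarith)]
    ring
  refine ⟨affConj (-1) (x + x) g, ?_, hfx, ?_⟩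
  · have := affConj_neg_one_mem_plc hg (hx.add hx)
    simpa using this
  · have ht : Tendsto (fun z : ℝ => x + x - z) (𝓝[<] x) (𝓝[>] x) := by
      have : Continuous fun z : ℝ => x + x - z := by fun_prop
      have h := this.continuousWithinAt.tendsto_nhdsWithin (s := Iio x) (x := x) (t := Ioi x)
        fun z (hz : z < x) => show x < x + x - z by linarith
      simpa using h
    filter_upwards [ht.eventually hk] with z hz
    rw [affConj_neg_one_apply, hz, hfx x le_rfl, hfix x le_rfl]
    ring

/-- Near their base points `p` and `q` two bumps double distances. Undoing the one at `q` and
applying the one at `p` gives `z ↦ z + (q - p)`, so the base points are placed just left of `x` with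
`q - p = y - x`. -/
theorem exists_small_translation {a b x y : ℝ} {j : ℤ} (hx : IsDyadic x) (hy : IsDyadic y)
    (h1 : a < x - 2 ^ j / 8) (h2 : x + 2 ^ j / 4 < b) (h3 : |y - x| < 2 ^ j / 32) :
    ∃ g ∈ plc a b, ∀ᶠ z in 𝓝 x, g z = z + (y - x) := by
  have hj0 : (0 : ℝ) < 2 ^ j := by positivity
  have hL : IsDyadic ((2 : ℝ) ^ j / 16) := by
    have := IsDyadic.two_zpow (j - 4)
    rwa [zpow_sub₀ two_ne_zero, show (2 : ℝ) ^ (4 : ℤ) = 16 by norm_num] at this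
  obtain ⟨h4, h5⟩ := abs_lt.1 h3
  set q := x - 2 ^ j / 16 with hq
  set p := x + x - y - 2 ^ j / 16 with hp
  have hqd : IsDyadic q := hx.sub hL
  have hpd : IsDyadic p := ((hx.add hx).sub hy).sub hL
  refine ⟨affConj (twoPow j) p c * (affConj (twoPow j) q c)⁻¹, mul_mem
    (plOn_le_plc (by linarith) (by linarith) (hc.copy_mem_plOn j hpd))
    (inv_mem (plOn_le_plc (by linarith) (by linarith) (hc.copy_mem_plOn j hqd))), ?_⟩
  have e1 : ∀ᶠ z in 𝓝 x, z ∈ Ioo q (q + 2 ^ j / 8) :=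
    Ioo_mem_nhds (by linarith) (by linarith)
  have e2 : ∀ᶠ z in 𝓝 x, (z + q) / 2 ∈ Ioo p (p + 2 ^ j / 16) := by
    have : Continuous fun z : ℝ => (z + q) / 2 := by fun_prop
    exact (this.tendsto x).eventually (Ioo_mem_nhds (by linarith) (by linarith))
  filter_upwards [e1, e2] with z hz1 hz2
  have h6 : affConj (twoPow j) q c ((z + q) / 2) = z := by
    rw [hc.copy_apply_eq j (by linarith [hz1.1]) (by linarith [hz1.2])]
    ring
  have h7 : (affConj (twoPow j) q c)⁻¹ z = (z + q) / 2 := by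
    conv_lhs => rw [← h6]
    exact RelIso.inv_apply_self _ _
  rw [RelIso.mul_apply, h7, hc.copy_apply_eq j hz2.1 hz2.2, hp, hq]
  ring

theorem exists_translation_of_le {a b x y : ℝ} (hx : IsDyadic x) (hy : IsDyadic y) (hax : a < x)
    (hxy : x ≤ y) (hyb : y < b) : ∃ g ∈ plc a b, ∀ᶠ z in 𝓝 x, g z = z + (y - x) := by
  obtain ⟨j, hj⟩ := exists_two_zpow_lt (lt_min (sub_pos.2 hax) (sub_pos.2 hyb))
  obtain ⟨hj1, hj2⟩ := lt_min_iff.1 hj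
  have hj0 : (0 : ℝ) < 2 ^ j := by positivity
  obtain ⟨n, hn⟩ := exists_pow_lt_of_lt_one (y := (1 / 2 : ℝ))
    (show 0 < 2 ^ j / 32 / (y - x + 1) from div_pos (by positivity) (by linarith)) (by norm_num)
  -- The displacement is cut into `2 ^ n` equal steps: a power of two keeps every intermediate point
  -- dyadic, and `n` makes `d` small enough for `exists_small_translation`.
  set d := (2 : ℝ) ^ (-(n : ℤ)) * (y - x) with hd
  have hdd : IsDyadic d := (hy.sub hx).two_zpow_mul _
  have hn' : (2 : ℝ) ^ (-(n : ℤ)) < 2 ^ j / 32 / (y - x + 1) := by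
    rwa [zpow_neg, zpow_natCast, ← one_div, ← one_div_pow]
  have hpos : (0 : ℝ) < 2 ^ (-(n : ℤ)) := by positivity
  have hd0 : 0 ≤ d := mul_nonneg hpos.le (by linarith)
  have hd1 : d < 2 ^ j / 32 := by
    rw [lt_div_iff₀ (by linarith)] at hn'
    nlinarith
  have key : ∀ i : ℕ, x + i * d ≤ y → IsDyadic (x + i * d) ∧
      ∃ g ∈ plc a b, ∀ᶠ z in 𝓝 x, g z = z + i * d := by
    intro i
    induction i with
    | zero => exact fun _ => ⟨by simpa using hx, 1, one_mem _, Eventually.of_forall fun z => by simp⟩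
    | succ i ih =>
      intro hi
      push_cast at hi ⊢
      have hi' : x + i * d ≤ y := by linarith
      have hid : 0 ≤ i * d := by positivity
      obtain ⟨h1, g, hg, hgz⟩ := ih hi'
      have h2 : IsDyadic (x + (i + 1) * d) := by
        have := h1.add hdd
        rwa [add_assoc, ← add_one_mul] at this
      obtain ⟨k, hk, hkz⟩ := hc.exists_small_translation (a := a) (b := b) (j := j) h1 h2
        (by linarith) (by linarith) (by
          rw [show x + (i + 1) * d - (x + i * d) = d by ring, abs_of_nonneg hd0]
          exact hd1)
      refine ⟨h2, k * g, mul_mem hk hg, ?_⟩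
      have hgx : g x = x + i * d := hgz.self_of_nhds
      have ht := g.continuous.tendsto x
      rw [hgx] at ht
      filter_upwards [hgz, ht.eventually hkz] with z h3 h4
      rw [RelIso.mul_apply, h4, h3]
      ring
  have h2n : ((2 ^ n : ℕ) : ℝ) * d = y - x := by
    rw [hd, zpow_neg, zpow_natCast]
    push_cast
    field_simp
  obtain ⟨-, g, hg, hgz⟩ := key (2 ^ n) (by rw [h2n]; linarith)
  rw [h2n] at hgz
  exact ⟨g, hg, hgz⟩

theorem exists_translation {a b x y : ℝ} (hx : IsDyadic x) (hy : IsDyadic y) (hxI : x ∈ Ioo a b)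
    (hyI : y ∈ Ioo a b) : ∃ g ∈ plc a b, ∀ᶠ z in 𝓝 x, g z = z + (y - x) := by
  rcases le_total x y with h | h
  · exact hc.exists_translation_of_le hx hy hxI.1 h hyI.2
  · obtain ⟨g, hg, hgz⟩ := hc.exists_translation_of_le hy hx hyI.1 h hxI.2
    refine ⟨g⁻¹, inv_mem hg, ?_⟩
    have hgy : g y = x := by
      rw [hgz.self_of_nhds]
      ring
    have hgx : g⁻¹ x = y := by rw [← hgy, RelIso.inv_apply_self]
    have ht := (g⁻¹ : ℝ ≃o ℝ).continuous.tendsto x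
    rw [hgx] at ht
    filter_upwards [ht.eventually hgz] with z hz
    rw [RelIso.apply_inv_self] at hz
    linarith

/-- Every germ, at a dyadic point, of a dyadic piecewise linear homeomorphism is the germ of one
with compact support. -/
theorem exists_eventuallyEq {f : ℝ ≃o ℝ} (hf : IsPL f) {a b x : ℝ} (hx : IsDyadic x)
    (hxI : x ∈ Ioo a b) (hfx : f x ∈ Ioo a b) : ∃ g ∈ plc a b, ∀ᶠ z in 𝓝 x, g z = f z := by
  obtain ⟨k, hk⟩ := hf.right x
  obtain ⟨l, hl⟩ := hf.left x
  obtain ⟨r, hr, hr1, hr2⟩ := hc.exists_right_germ hx hxI.1 hxI.2 k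
  obtain ⟨s, hs, hs1, hs2⟩ := hc.exists_left_germ hx hxI.1 hxI.2 l
  obtain ⟨t, ht, ht1⟩ := hc.exists_translation hx ((hf.dyadic_iff x).2 hx) hxI hfx
  have hrx := hr1 x le_rfl
  have hsx := hs1 x le_rfl
  -- `r` and `s` fix `x` and act on opposite sides of it, giving the two one-sided slopes
  -- independently; `t` then translates `x` to `f x`.
  refine ⟨t * (r * s), mul_mem ht (mul_mem hr hs), ?_⟩
  have h0 : Tendsto (r * s : ℝ ≃o ℝ) (𝓝 x) (𝓝 x) := by
    have := (r * s : ℝ ≃o ℝ).continuous.tendsto x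
    rwa [RelIso.mul_apply, hsx, hrx] at this
  have h1 := h0.eventually ht1
  have h2 : ∀ᶠ z in 𝓝[>] x, (r * s) z = x + 2 ^ k * (z - x) := by
    filter_upwards [self_mem_nhdsWithin, hr2] with z hz1 hz2
    rw [RelIso.mul_apply, hs1 z (le_of_lt hz1), hz2, hrx]
  have h3 : ∀ᶠ z in 𝓝[<] x, (r * s) z = x + 2 ^ l * (z - x) := by
    filter_upwards [self_mem_nhdsWithin, hs2] with z hz1 hz2
    rw [RelIso.mul_apply, hr1, hz2, hsx]
    have : s z < s x := s.strictMono hz1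
    exact (this.trans_eq hsx).le
  have e1 : ∀ᶠ z in 𝓝[>] x, (t * (r * s)) z = f z := by
    filter_upwards [h2, hk, mem_nhdsWithin_of_mem_nhds h1] with z a1 a2 a3
    rw [RelIso.mul_apply, a3, a1, a2]
    ring
  have e2 : ∀ᶠ z in 𝓝[<] x, (t * (r * s)) z = f z := by
    filter_upwards [h3, hl, mem_nhdsWithin_of_mem_nhds h1] with z a1 a2 a3
    rw [RelIso.mul_apply, a3, a1, a2]
    ring
  have e3 : (t * (r * s)) x = f x := by
    rw [RelIso.mul_apply, RelIso.mul_apply, hsx, hrx, ht1.self_of_nhds]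
    ring
  rw [← nhdsNE_sup_pure x, ← Iio_union_Ioi, nhdsWithin_union]
  exact eventually_sup.2 ⟨eventually_sup.2 ⟨e2, e1⟩, eventually_pure.2 e3⟩

end IsBump

/-! ### Fragmentation -/

theorem exists_mul_eq_of_fixed {w : ℝ ≃o ℝ} {a b p : ℝ} (hw : w ∈ plOn a b) (hp : IsDyadic p)
    (hwp : w p = p) :
    ∃ u ∈ plOn a p, ∃ v ∈ plOn p b, v * u = w ∧ (∀ x ≤ p, u x = w x) ∧ ∀ x, p ≤ x → v x = w x := by
  obtain ⟨u, hu, h1, h2⟩ := exists_truncation hw.1 hp hwp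
  have hup : u⁻¹ p = p := inv_apply_eq_self (h2 p le_rfl)
  have hinv : ∀ x, p ≤ x → u⁻¹ x = x := fun x hx => inv_apply_eq_self (h2 x hx)
  have hv2 : ∀ x, p ≤ x → (w * u⁻¹) x = w x := fun x hx => by rw [RelIso.mul_apply, hinv x hx]
  have hv1 : ∀ x ≤ p, (w * u⁻¹) x = x := by
    intro x hx
    have h3 : u⁻¹ x ≤ p := by
      rw [← hup]
      exact (u⁻¹ : ℝ ≃o ℝ).monotone hx
    rw [RelIso.mul_apply, ← h1 _ h3, RelIso.apply_inv_self]
  refine ⟨u, ⟨hu, fun x hx => ?_⟩, w * u⁻¹, ⟨hw.1.mul hu.inv, fun x hx => ?_⟩,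
    inv_mul_cancel_right w u, h1, hv2⟩
  · rcases le_total x p with h | h
    · rcases h.eq_or_lt with rfl | h'
      · exact h2 _ le_rfl
      rw [h1 x h]
      refine hw.2 x fun h' => hx ⟨h'.1, h⟩
    · exact h2 x h
  · rcases le_total x p with h | h
    · exact hv1 x h
    · rw [hv2 x h]
      exact hw.2 x fun h' => hx ⟨h, h'.2⟩

/-- At a dyadic point `x` of the overlap, one of the two groups contains an element with the same
value as `t` at `x`, because `t x` lies in one of the two intervals. Dividing by it leaves a map
fixing `x`, which splits there. -/
theorem IsBump.plc_le_sup {c : ℝ ≃o ℝ} (hc : IsBump c) {a₁ b₁ a₂ b₂ : ℝ} (h1 : a₁ < a₂)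
    (h2 : a₂ < b₁) (h3 : b₁ < b₂) : plc a₁ b₂ ≤ plc a₁ b₁ ⊔ plc a₂ b₂ := by
  intro t ht
  obtain ⟨x, hx, hx1, hx2⟩ := exists_isDyadic_btwn h2
  have htx : t x ∈ Ioo a₁ b₂ :=
    apply_mem_of_mem_suppGroup (plc_le_suppGroup ht) ⟨h1.trans hx1, hx2.trans h3⟩
  have htpl := isPL_of_mem_plc ht
  obtain ⟨u, hu, hu', hux⟩ : ∃ u ∈ plc a₁ b₁ ⊔ plc a₂ b₂, u ∈ plc a₁ b₂ ∧ u x = t x := by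
    rcases lt_or_ge (t x) b₁ with h | h
    · obtain ⟨u, hu, hux⟩ := hc.exists_eventuallyEq htpl hx ⟨h1.trans hx1, hx2⟩ ⟨htx.1, h⟩
      exact ⟨u, Subgroup.mem_sup_left hu, plc_mono le_rfl h3.le hu, hux.self_of_nhds⟩
    · obtain ⟨u, hu, hux⟩ := hc.exists_eventuallyEq htpl hx ⟨hx1, hx2.trans h3⟩
        ⟨h2.trans_le h, htx.2⟩
      exact ⟨u, Subgroup.mem_sup_right hu, plc_mono h1.le le_rfl hu, hux.self_of_nhds⟩
  obtain ⟨a', b', ha', hb', hw⟩ := mul_mem (inv_mem hu') ht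
  have hwx : (u⁻¹ * t) x = x := by rw [RelIso.mul_apply, ← hux, RelIso.inv_apply_self]
  obtain ⟨l, hl, r, hr, hlr, -, -⟩ := exists_mul_eq_of_fixed hw hx hwx
  have : t = u * (r * l) := by rw [hlr, mul_inv_cancel_left]
  rw [this]
  exact mul_mem hu (mul_mem (Subgroup.mem_sup_right (plOn_le_plc hx1 hb' hr))
    (Subgroup.mem_sup_left (plOn_le_plc ha' hx2 hl)))

/-! ### Groups generated by two elements -/

theorem exists_zpow_mul_zpow_mul_commutator {G : Type*} [Group G] {H : Subgroup G} {x y : G}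
    (hH : H = Subgroup.closure {x, y}) {f : G} (hf : f ∈ H) :
    ∃ m n : ℤ, ∃ c ∈ ⁅H, H⁆, f = x ^ m * y ^ n * c := by
  have hx : x ∈ H := hH ▸ Subgroup.subset_closure (by simp)
  have hy : y ∈ H := hH ▸ Subgroup.subset_closure (by simp)
  have htop : Subgroup.closure {(⟨x, hx⟩ : H), ⟨y, hy⟩} = ⊤ := by
    apply Subgroup.map_injective H.subtype_injective
    rw [MonoidHom.map_closure, image_pair, ← MonoidHom.range_eq_map, Subgroup.range_subtype]
    exact hH.symm
  have h1 : Abelianization.of (⟨f, hf⟩ : H) ∈ Subgroup.closure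
      {Abelianization.of (⟨x, hx⟩ : H), Abelianization.of (⟨y, hy⟩ : H)} := by
    rw [← image_pair, ← MonoidHom.map_closure, htop]
    exact Subgroup.mem_map_of_mem _ (Subgroup.mem_top _)
  obtain ⟨m, n, hmn⟩ := Subgroup.mem_closure_pair.1 h1
  refine ⟨m, n, (x ^ m * y ^ n)⁻¹ * f, ?_, by group⟩
  rw [← Subgroup.map_subtype_commutator]
  refine ⟨((⟨x, hx⟩ : H) ^ m * (⟨y, hy⟩ : H) ^ n)⁻¹ * ⟨f, hf⟩, ?_, by simp⟩
  have : ((⟨x, hx⟩ : H) ^ m * (⟨y, hy⟩ : H) ^ n)⁻¹ * ⟨f, hf⟩ ∈ Abelianization.of.ker := by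
    rw [MonoidHom.mem_ker, map_mul, map_inv, map_mul, map_zpow, map_zpow, hmn, inv_mul_cancel]
  rwa [Abelianization.ker_of] at this

/-! ### Perfectness of the groups `plc a b` -/

theorem apply_left_eq_self {f : ℝ ≃o ℝ} {a b : ℝ} (hab : a ≤ b) (hf : f ∈ suppGroup (Icc a b)) :
    f a = a := by
  refine le_antisymm ?_ (apply_mem_of_mem_suppGroup hf (left_mem_Icc.2 hab)).1
  have := (apply_mem_of_mem_suppGroup (inv_mem hf) (left_mem_Icc.2 hab)).1
  rwa [← f.le_iff_le, RelIso.apply_inv_self] at this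

theorem affConj_neg_one_affConj_neg_one (c : ℝ) (f : ℝ ≃o ℝ) :
    affConj (-1) c (affConj (-1) c f) = f := by
  ext x
  simp [affConj_neg_one_apply]

theorem affConj_neg_one_mem_plOn {f : ℝ ≃o ℝ} {a b c : ℝ} (hf : f ∈ plOn a b) (hc : IsDyadic c) :
    affConj (-1) c f ∈ plOn (c - b) (c - a) := by
  refine ⟨IsPL.affConj_neg_one hf.1 hc, fun x hx => ?_⟩
  rw [affConj_neg_one_apply, hf.2 _ fun h => hx ⟨by linarith [h.2], by linarith [h.1]⟩]
  ring

/-- The elements with slope `1` to the right of the fixed point `p`. -/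
def slopeOne (p : ℝ) : Subgroup (ℝ ≃o ℝ) where
  carrier := {f | RightSlope p f 0}
  mul_mem' hf hg := by simpa using RightSlope.mul hf hg
  one_mem' := RightSlope.one p
  inv_mem' hf := by simpa using RightSlope.inv hf

theorem RightSlope.commutator {p : ℝ} {f g : ℝ ≃o ℝ} {k l : ℤ} (hf : RightSlope p f k)
    (hg : RightSlope p g l) : RightSlope p ⁅f, g⁆ 0 := by
  have := ((hf.mul hg).mul hf.inv).mul hg.inv
  rwa [show k + l + -k + -l = 0 by ring] at this

theorem exists_rightSlope {f : ℝ ≃o ℝ} {a b : ℝ} (hab : a ≤ b) (hf : f ∈ plOn a b) :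
    ∃ k, RightSlope a f k := by
  obtain ⟨k, hk⟩ := IsPL.right hf.1 a
  exact ⟨k, apply_left_eq_self hab hf.2, hk⟩

theorem rightSlope_of_mem_plc {f : ℝ ≃o ℝ} {a b : ℝ} (hf : f ∈ plc a b) : RightSlope a f 0 := by
  obtain ⟨a', b', h1, h2, hf⟩ := hf
  refine RightSlope.of_eventually (hf.2 _ fun h => absurd h.1 (not_le.2 h1)) ?_
  filter_upwards [Ioo_mem_nhdsGT h1] with z hz
  exact hf.2 _ fun h => absurd h.1 (not_le.2 hz.2)

theorem commutator_le_slopeOne {a b : ℝ} (hab : a ≤ b) :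
    ⁅plOn a b, plOn a b⁆ ≤ slopeOne a := by
  rw [Subgroup.commutator_le]
  intro f hf g hg
  obtain ⟨k, hk⟩ := exists_rightSlope hab hf
  obtain ⟨l, hl⟩ := exists_rightSlope hab hg
  exact hk.commutator hl

/-- The logarithms of the slopes at the two ends map the group onto `ℤ²`, as bumps at the ends show.
A two-generated abelian group surjecting onto `ℤ²` does so injectively, so an element with slope `1`
at both ends is trivial in the abelianization. The right end is handled as the left end of the
mirror image under `x ↦ 1 - x`. -/
theorem plc_le_commutator_of_closure {c n₂ n₃ : ℝ ≃o ℝ} (hc : IsBump c)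
    (hn : plOn (1 / 16) (15 / 16) = Subgroup.closure {n₂, n₃}) :
    plc (1 / 16) (15 / 16) ≤ ⁅plOn (1 / 16) (15 / 16), plOn (1 / 16) (15 / 16)⁆ := by
  set F := plOn (1 / 16) (15 / 16) with hF
  have hone : IsDyadic 1 := by simpa using IsDyadic.intCast 1
  have hle : (1 / 16 : ℝ) ≤ 15 / 16 := by norm_num
  have hrefl : ∀ {f}, f ∈ F → affConj (-1) 1 f ∈ F := by
    intro f hf
    have := affConj_neg_one_mem_plOn hf hone
    norm_num at this
    exact this
  have h2 : n₂ ∈ F := hn ▸ Subgroup.subset_closure (by simp)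
  have h3 : n₃ ∈ F := hn ▸ Subgroup.subset_closure (by simp)
  obtain ⟨k₂, hk₂⟩ := exists_rightSlope hle h2
  obtain ⟨k₃, hk₃⟩ := exists_rightSlope hle h3
  obtain ⟨l₂, hl₂⟩ := exists_rightSlope hle (hrefl h2)
  obtain ⟨l₃, hl₃⟩ := exists_rightSlope hle (hrefl h3)
  have hslopes : ∀ f ∈ F, ∃ m n : ℤ, (∃ d ∈ ⁅F, F⁆, f = n₂ ^ m * n₃ ^ n * d) ∧
      RightSlope (1 / 16) f (m * k₂ + n * k₃) ∧
      RightSlope (1 / 16) (affConj (-1) 1 f) (m * l₂ + n * l₃) := by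
    intro f hf
    obtain ⟨m, n, d, hd, rfl⟩ := exists_zpow_mul_zpow_mul_commutator hn hf
    refine ⟨m, n, ⟨d, hd, rfl⟩, ?_, ?_⟩
    · have := ((hk₂.zpow m).mul (hk₃.zpow n)).mul (commutator_le_slopeOne hle hd)
      rwa [add_zero] at this
    · have hd' : affConj (-1) 1 d ∈ ⁅F, F⁆ := by
        have h := Subgroup.mem_map_of_mem (affConj (-1) 1) hd
        rw [Subgroup.map_commutator] at h
        have hmap : F.map (affConj (-1) 1) ≤ F := by
          rintro _ ⟨g, hg, rfl⟩
          exact hrefl hg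
        exact Subgroup.commutator_mono hmap hmap h
      have := ((hl₂.zpow m).mul (hl₃.zpow n)).mul (commutator_le_slopeOne hle hd')
      rwa [add_zero, ← map_zpow, ← map_zpow, ← map_mul, ← map_mul] at this
  have hpd : IsDyadic (1 / 16) := ⟨1, 4, by norm_num⟩
  set e := affConj (twoPow 0) (1 / 16) c with he
  have heF : e ∈ F := plOn_mono le_rfl (by norm_num) (hc.copy_mem_plOn 0 hpd)
  have he1 : RightSlope (1 / 16) e 1 := by
    have hfix : e (1 / 16) = 1 / 16 :=
      hc.copy_mem_suppGroup 0 (1 / 16) _ fun h => lt_irrefl _ h.1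
    refine ⟨hfix, ?_⟩
    filter_upwards [Ioo_mem_nhdsGT (show (1 / 16 : ℝ) < 1 / 16 + 1 / 16 by norm_num)] with z hz
    rw [hc.copy_apply_eq 0 hz.1 (by simpa using hz.2), hfix]
    simp
  have he2 : RightSlope (1 / 16) (affConj (-1) 1 e) 0 := by
    have h := affConj_neg_one_mem_plOn (hc.copy_mem_plOn 0 hpd) hone
    exact rightSlope_of_mem_plc (plOn_le_plc (b := 1) (by norm_num) (by norm_num) h)
  intro t ht
  obtain ⟨m, n, ⟨d, hd, hmn⟩, ht1, ht2⟩ := hslopes t (by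
    obtain ⟨a', b', ha, hb, h⟩ := ht
    exact plOn_mono ha.le hb.le h)
  obtain ⟨m₁, n₁, -, h11, h12⟩ := hslopes e heF
  obtain ⟨m₂, n₂, -, h21, h22⟩ := hslopes _ (hrefl heF)
  rw [affConj_neg_one_affConj_neg_one] at h22
  have q11 := h11.unique he1
  have q12 := h12.unique he2
  have q21 := h21.unique he2
  have q22 := h22.unique he1
  have q1 := ht1.unique (rightSlope_of_mem_plc ht)
  have q2 := ht2.unique (rightSlope_of_mem_plc (b := 15 / 16) (by
    have := affConj_neg_one_mem_plc ht hone
    norm_num at this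
    exact this))
  -- The bumps have slope vectors `(1, 0)` and `(0, 1)`, so the matrix of their exponents times the
  -- slope matrix of the generators is the identity. Cramer's rule then forces the exponents of `t`
  -- to vanish.
  have hdet : (m₁ * n₂ - n₁ * m₂) * (k₂ * l₃ - k₃ * l₂) = 1 := by
    linear_combination (m₂ * l₂ + n₂ * l₃) * q11 - (m₁ * l₂ + n₁ * l₃) * q21 + q22
  have hm : m = 0 := by
    linear_combination (m₁ * n₂ - n₁ * m₂) * (l₃ * q1 - k₃ * q2) - m * hdet
  have hn' : n = 0 := by
    linear_combination (m₁ * n₂ - n₁ * m₂) * (k₂ * q2 - l₂ * q1) - n * hdet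
  rw [hmn, hm, hn']
  simpa using hd

theorem conj_mem_plOn {t φ : ℝ ≃o ℝ} {a b : ℝ} (hφ : IsPL φ) (ht : t ∈ plOn a b) :
    φ * t * φ⁻¹ ∈ plOn (φ a) (φ b) := by
  refine ⟨(hφ.mul ht.1).mul hφ.inv, fun x hx => ?_⟩
  rw [RelIso.mul_apply, RelIso.mul_apply, ht.2, RelIso.apply_inv_self]
  intro h
  apply hx
  rw [← RelIso.apply_inv_self φ x]
  exact ⟨φ.monotone h.1, φ.monotone h.2⟩

theorem conj_mem_commutator_plOn {t φ : ℝ ≃o ℝ} {a b : ℝ} (hφ : IsPL φ)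
    (ht : t ∈ ⁅plOn a b, plOn a b⁆) :
    φ * t * φ⁻¹ ∈ ⁅plOn (φ a) (φ b), plOn (φ a) (φ b)⁆ := by
  have h := Subgroup.mem_map_of_mem (MulAut.conj φ).toMonoidHom ht
  rw [Subgroup.map_commutator] at h
  have hle : (plOn a b).map (MulAut.conj φ).toMonoidHom ≤ plOn (φ a) (φ b) := by
    rintro _ ⟨g, hg, rfl⟩
    exact conj_mem_plOn hφ hg
  exact Subgroup.commutator_mono hle hle h

theorem affConj_twoPow_mem_plOn {t : ℝ ≃o ℝ} {a b p : ℝ} (j : ℤ) (hp : IsDyadic p)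
    (ht : t ∈ plOn a b) :
    affConj (twoPow j) p t ∈ plOn (2 ^ j * a + p) (2 ^ j * b + p) := by
  have hj0 : (0 : ℝ) < 2 ^ j := by positivity
  refine ⟨IsPL.affConj_twoPow ht.1 j hp, fun x hx => ?_⟩
  rw [affConj_def, coe_twoPow, ht.2]
  · field_simp
    ring
  · intro h
    rw [inv_mul_eq_div, mem_Icc, le_div_iff₀ hj0, div_le_iff₀ hj0] at h
    exact hx ⟨by linarith [h.1], by linarith [h.2]⟩

/-- Compression of the support in two moves: `φ⁻¹` drags its right end below `v' < v`, then `ψ`,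
which fixes `v`, pushes its left end above `u`. -/
theorem IsBump.exists_conj_mem {c : ℝ ≃o ℝ} (hc : IsBump c) {t : ℝ ≃o ℝ} {a b u v : ℝ}
    (hau : a < u) (huv : u < v) (hvb : v < b) (ht : t ∈ plc a b) :
    ∃ φ ∈ plc a b, φ * t * φ⁻¹ ∈ plc u v := by
  obtain ⟨a₁, b₁, ha, hb, ht⟩ := ht
  replace ht := plOn_mono (min_le_left a₁ u) (le_max_left b₁ v) ht
  obtain ⟨v', hv1, hv2⟩ := exists_between huv
  have hlt : min a₁ u < max b₁ v := (min_le_right _ _).trans_lt (huv.trans_le (le_max_right _ _))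
  have ha' : a < min a₁ u := lt_min ha hau
  have hb' : max b₁ v < b := max_lt hb hvb
  obtain ⟨φ, hφ, h1⟩ := hc.exists_lt_apply_of_mem (a := a) (b := b) (x := v') (y := max b₁ v)
    ⟨hau.trans hv1, hv2.trans hvb⟩ ⟨ha'.trans hlt, hb'⟩
  have h2 : φ⁻¹ (max b₁ v) < v' := by
    rw [← φ.lt_iff_lt, RelIso.apply_inv_self]
    exact h1
  have h3 : a < φ⁻¹ (min a₁ u) :=
    (apply_mem_of_mem_suppGroup (plc_le_suppGroup (inv_mem hφ)) ⟨ha', hlt.trans hb'⟩).1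
  have h4 : φ⁻¹ (min a₁ u) < φ⁻¹ (max b₁ v) := (φ⁻¹ : ℝ ≃o ℝ).strictMono hlt
  obtain ⟨ψ, hψ, h5⟩ := hc.exists_lt_apply_of_mem (a := a) (b := v) (x := φ⁻¹ (min a₁ u)) (y := u)
    ⟨h3, (h4.trans h2).trans hv2⟩ ⟨hau, huv⟩
  have h6 : ψ (φ⁻¹ (max b₁ v)) < v := by
    have h7 : ψ (φ⁻¹ (max b₁ v)) < ψ v := ψ.strictMono (h2.trans hv2)
    rwa [plc_le_suppGroup hψ v fun h => lt_irrefl _ h.2] at h7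
  have hmem : ψ * φ⁻¹ ∈ plc a b := mul_mem (plc_mono le_rfl hvb.le hψ) (inv_mem hφ)
  exact ⟨ψ * φ⁻¹, hmem, plOn_le_plc h5 h6 (conj_mem_plOn (isPL_of_mem_plc hmem) ht)⟩

/-- Every element of `plc a b` is a product of commutators of elements with a common compact
support. -/
theorem IsAdmissible.exists_mem_commutator {c₀ ν₂ ν₃ : I ≃o I} (h : IsAdmissible c₀ ν₂ ν₃)
    {a b : ℝ} (hab : a < b) {t : ℝ ≃o ℝ} (ht : t ∈ plc a b) :
    ∃ a' b', a < a' ∧ a' < b' ∧ b' < b ∧ t ∈ ⁅plOn a' b', plOn a' b'⁆ := by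
  have hc := h.isBump
  obtain ⟨p, hp, hp1, hp2⟩ := exists_isDyadic_btwn hab
  obtain ⟨j, hj⟩ := exists_two_zpow_lt (sub_pos.2 hp2)
  have hj0 : (0 : ℝ) < 2 ^ j := by positivity
  -- `[u, v]` is a dyadic affine copy of `[1/16, 15/16]` inside `(a, b)`. The commutator expression
  -- found in the model is transported there, and then to `t` by conjugation.
  set u := 2 ^ j * (1 / 16) + p with hu
  set v := 2 ^ j * (15 / 16) + p with hv
  have hau : a < u := by linarith
  have huv : u < v := by linarith
  have hvb : v < b := by linarith
  have hcopy : plc u v ≤ ⁅plOn u v, plOn u v⁆ := by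
    rintro s ⟨a', b', ha, hb, hs⟩
    set s' := affConj (twoPow (-j)) (-((2 : ℝ) ^ (-j) * p)) s with hs'
    have h1 : s' ∈ plc (1 / 16) (15 / 16) := by
      refine plOn_le_plc ?_ ?_ (affConj_twoPow_mem_plOn (-j) (hp.two_zpow_mul _).neg hs)
      · rw [zpow_neg, ← sub_eq_add_neg, ← mul_sub, inv_mul_eq_div, lt_div_iff₀ hj0]
        linarith
      · rw [zpow_neg, ← sub_eq_add_neg, ← mul_sub, inv_mul_eq_div, div_lt_iff₀ hj0]
        linarith
    have h2 := Subgroup.mem_map_of_mem (affConj (twoPow j) p)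
      (plc_le_commutator_of_closure hc h.plOn_eq h1)
    rw [Subgroup.map_commutator] at h2
    have hle : (plOn (1 / 16) (15 / 16)).map (affConj (twoPow j) p) ≤ plOn u v := by
      rintro _ ⟨g, hg, rfl⟩
      exact affConj_twoPow_mem_plOn j hp hg
    have h3 : affConj (twoPow j) p s' = s := by
      ext x
      simp only [hs', affConj_def, coe_twoPow, zpow_neg, inv_inv]
      field_simp
      ring_nf
    rw [h3] at h2
    exact Subgroup.commutator_mono hle hle h2
  obtain ⟨φ, hφ, hmem⟩ := hc.exists_conj_mem hau huv hvb ht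
  have hφ' := inv_mem hφ
  have h4 := conj_mem_commutator_plOn (isPL_of_mem_plc hφ') (hcopy hmem)
  rw [inv_inv, show φ⁻¹ * (φ * t * φ⁻¹) * φ = t by group] at h4
  have h5 := plc_le_suppGroup hφ'
  exact ⟨_, _, (apply_mem_of_mem_suppGroup h5 ⟨hau, huv.trans hvb⟩).1,
    (φ⁻¹ : ℝ ≃o ℝ).strictMono huv, (apply_mem_of_mem_suppGroup h5 ⟨hau.trans huv, hvb⟩).2, h4⟩

theorem IsAdmissible.plc_le_commutator {c₀ ν₂ ν₃ : I ≃o I} (h : IsAdmissible c₀ ν₂ ν₃)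
    {a b : ℝ} (hab : a < b) : plc a b ≤ ⁅plc a b, plc a b⁆ := by
  intro t ht
  obtain ⟨a', b', h1, -, h3, h4⟩ := h.exists_mem_commutator hab ht
  exact Subgroup.commutator_mono (plOn_le_plc h1 h3) (plOn_le_plc h1 h3) h4

/-! ### Products of commutators of displaceable elements -/

theorem commutatorElement_mul_mul_of_commute {Γ : Type*} [Group Γ] {a b x y : Γ}
    (hax : Commute a x) (hay : Commute a y) (hbx : Commute b x) (hby : Commute b y) :
    ⁅a * x, b * y⁆ = ⁅a, b⁆ * ⁅x, y⁆ := by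
  have h1 : a * x * (b * y) = a * b * (x * y) := by
    rw [mul_assoc, ← mul_assoc x b y, ← hbx.eq]
    simp only [mul_assoc]
  have h2 : (a * x)⁻¹ * (b * y)⁻¹ = a⁻¹ * b⁻¹ * (x⁻¹ * y⁻¹) := by
    rw [← mul_inv_rev, ← mul_inv_rev, ← mul_inv_rev, ← mul_inv_rev, inv_inj, mul_assoc,
      ← mul_assoc y a x, ← hay.eq, mul_assoc, ← mul_assoc b]
    exact ((hby.mul_right hbx).mul_left (hay.mul_right hax)).eq
  have h3 : Commute (x * y) (a⁻¹ * b⁻¹) :=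
    ((hax.symm.mul_left hay.symm).inv_right).mul_right ((hbx.symm.mul_left hby.symm).inv_right)
  calc ⁅a * x, b * y⁆ = a * x * (b * y) * ((a * x)⁻¹ * (b * y)⁻¹) := by
        rw [commutatorElement_def, mul_assoc (a * x * (b * y))]
    _ = a * b * ((x * y) * (a⁻¹ * b⁻¹)) * (x⁻¹ * y⁻¹) := by
        rw [h1, h2]
        simp only [mul_assoc]
    _ = ⁅a, b⁆ * ⁅x, y⁆ := by
        rw [h3.eq, commutatorElement_def, commutatorElement_def]
        simp only [mul_assoc]

/-- A displacement trick: conjugation by `φ` moves `D` and `E` into `E`, which commutes with `D`.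
Each new commutator `⁅a, b⁆` is first merged with the stored one, `⁅a, b⁆ * ⁅x, y⁆ = ⁅a * x, b *
y⁆`, and the result is shifted by `φ`. The error made by shifting is absorbed in a commutator with
`φ`, so the number of commutators stays two however long the product is. -/
theorem exists_eq_commutator_mul_commutator {Γ : Type*} [Group Γ] {A D E : Subgroup Γ} {φ : Γ}
    (hφ : φ ∈ A) (hDA : D ≤ A) (hcomm : ∀ x ∈ D, ∀ y ∈ E, Commute x y)
    (hD : ∀ x ∈ D, φ * x * φ⁻¹ ∈ E) (hE : ∀ x ∈ E, φ * x * φ⁻¹ ∈ E) {t : Γ}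
    (ht : t ∈ ⁅D, D⁆) : ∃ q ∈ A, ∃ x ∈ E, ∃ y ∈ E, t = ⁅q, φ⁆ * ⁅x, y⁆ := by
  have step : ∀ a ∈ D, ∀ b ∈ D, ∀ t : Γ,
      (t ∈ D ∧ ∃ q ∈ A, ∃ x ∈ E, ∃ y ∈ E, t = ⁅q, φ⁆ * ⁅x, y⁆) →
      ⁅a, b⁆ * t ∈ D ∧ ∃ q ∈ A, ∃ x ∈ E, ∃ y ∈ E, ⁅a, b⁆ * t = ⁅q, φ⁆ * ⁅x, y⁆ := by
    rintro a ha b hb t ⟨ht, q, hq, x, hx, y, hy, hqxy⟩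
    have hab : ⁅a, b⁆ ∈ D := mul_mem (mul_mem (mul_mem ha hb) (inv_mem ha)) (inv_mem hb)
    have hxy : ⁅x, y⁆ ∈ E := mul_mem (mul_mem (mul_mem hx hy) (inv_mem hx)) (inv_mem hy)
    have hct : ⁅a, b⁆ * t ∈ D := mul_mem hab ht
    have hconj : ∀ u ∈ D, ∀ v ∈ E, φ * (u * v) * φ⁻¹ ∈ E := by
      intro u hu v hv
      rw [show φ * (u * v) * φ⁻¹ = φ * u * φ⁻¹ * (φ * v * φ⁻¹) by group]
      exact mul_mem (hD u hu) (hE v hv)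
    refine ⟨hct, ⁅a, b⁆ * t * (φ * q * φ⁻¹),
      mul_mem (hDA hct) (mul_mem (mul_mem hφ hq) (inv_mem hφ)), φ * (a * x) * φ⁻¹,
      hconj a ha x hx, φ * (b * y) * φ⁻¹, hconj b hb y hy, ?_⟩
    have h1 : ⁅φ * (a * x) * φ⁻¹, φ * (b * y) * φ⁻¹⁆ = φ * (⁅a, b⁆ * ⁅x, y⁆) * φ⁻¹ := by
      rw [← commutatorElement_mul_mul_of_commute (hcomm a ha x hx) (hcomm a ha y hy)
        (hcomm b hb x hx) (hcomm b hb y hy), commutatorElement_def, commutatorElement_def]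
      group
    have h2 : ⁅q, φ⁆ = t * ⁅x, y⁆⁻¹ := by rw [hqxy, mul_inv_cancel_right]
    have h3 : ⁅⁅a, b⁆ * t * (φ * q * φ⁻¹), φ⁆ =
        ⁅a, b⁆ * t * (φ * (⁅q, φ⁆ * (⁅a, b⁆ * t)⁻¹) * φ⁻¹) := by
      simp only [commutatorElement_def]
      group
    have h4 : Commute t ⁅x, y⁆ := hcomm t ht _ hxy
    rw [h3, h1, h2]
    generalize ⁅a, b⁆ = c at *
    generalize ⁅x, y⁆ = w at *
    have h5 : t * w⁻¹ * (c * t)⁻¹ * (c * w) = 1 := by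
      rw [h4.inv_right.eq]
      group
    calc c * t = c * t * (φ * (t * w⁻¹ * (c * t)⁻¹ * (c * w)) * φ⁻¹) := by
          rw [h5]
          group
      _ = _ := by group
  suffices h : t ∈ D ∧ ∃ q ∈ A, ∃ x ∈ E, ∃ y ∈ E, t = ⁅q, φ⁆ * ⁅x, y⁆ from h.2
  rw [Subgroup.commutator_def] at ht
  induction ht using Subgroup.closure_induction_left with
  | one => exact ⟨one_mem _, 1, one_mem _, 1, one_mem _, 1, one_mem _, by simp⟩
  | mul_left x hx y hy ih =>
    obtain ⟨a, ha, b, hb, rfl⟩ := hx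
    exact step a ha b hb y ih
  | inv_mul_cancel x hx y hy ih =>
    obtain ⟨a, ha, b, hb, rfl⟩ := hx
    rw [commutatorElement_inv]
    exact step b hb a ha y ih

/-! ### Spreading homeomorphisms along a labelling -/

/-- The pair `(s, t)` with `s = ± 1` stands for the isometry `x ↦ s x + t` of the line, which acts on
the index `m` of the half-integer `m / 2` by `m ↦ s m + 2 t`. It matches the signs `e` on `B` if the
word read at the image of `B` is the word, or the formal inverse of the word, read at `B`. -/
def Matches (e : ℤ → ℤ) (B : Set ℤ) (s t : ℤ) : Prop :=
  (s = 1 ∨ s = -1) ∧ ∀ m ∈ B, e (s * m + 2 * t) = s * e m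

theorem Matches.mono {e : ℤ → ℤ} {B B' : Set ℤ} {s t : ℤ} (h : Matches e B s t) (hB : B' ⊆ B) :
    Matches e B' s t := ⟨h.1, fun m hm => h.2 m (hB hm)⟩

theorem Matches.union {e : ℤ → ℤ} {B B' : Set ℤ} {s t : ℤ} (h : Matches e B s t)
    (h' : Matches e B' s t) : Matches e (B ∪ B') s t :=
  ⟨h.1, fun m hm => hm.elim (h.2 m) (h'.2 m)⟩

theorem Matches.one (e : ℤ → ℤ) (B : Set ℤ) : Matches e B 1 0 := ⟨Or.inl rfl, fun m _ => by simp⟩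

/-- `g` acts as `h` on the images of `K` under the isometries which match on `B`, and trivially
elsewhere. -/
structure SpreadsOn (e : ℤ → ℤ) (B : Set ℤ) (K : Set ℝ) (h g : ℝ ≃o ℝ) : Prop where
  inside : ∀ s t : ℤ, Matches e B s t → ∀ x ∈ K, g (s * x + t) = s * h x + t
  outside : ∀ y : ℝ, (∀ s t : ℤ, Matches e B s t → ∀ x ∈ K, y ≠ s * x + t) → g y = y

/-- The images of `K` under distinct isometries which match on `B` and on `B'` are disjoint. -/
def Separates (e : ℤ → ℤ) (B B' : Set ℤ) (K : Set ℝ) : Prop :=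
  ∀ s t s' t' : ℤ, Matches e B s t → Matches e B' s' t' → ∀ x ∈ K, ∀ x' ∈ K,
    (s * x + t : ℝ) = s' * x' + t' → s = s' ∧ t = t'

namespace SpreadsOn

variable {e : ℤ → ℤ} {B B' : Set ℤ} {K K' : Set ℝ} {h h' g g' : ℝ ≃o ℝ}

theorem mul (H : SpreadsOn e B K h g) (H' : SpreadsOn e B K h' g') (hK : h' ∈ suppGroup K) :
    SpreadsOn e B K (h * h') (g * g') where
  inside s t hst x hx := by
    rw [RelIso.mul_apply, H'.inside s t hst x hx,
      H.inside s t hst _ (apply_mem_of_mem_suppGroup hK hx), RelIso.mul_apply]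
  outside y hy := by rw [RelIso.mul_apply, H'.outside y hy, H.outside y hy]

theorem one : SpreadsOn e B K 1 1 := ⟨fun _ _ _ _ _ => rfl, fun _ _ => rfl⟩

theorem inv (H : SpreadsOn e B K h g) (hK : h ∈ suppGroup K) : SpreadsOn e B K h⁻¹ g⁻¹ where
  inside s t hst x hx := by
    have := H.inside s t hst _ (apply_mem_of_mem_suppGroup (inv_mem hK) hx)
    rw [RelIso.apply_inv_self] at this
    rw [← this, RelIso.inv_apply_self]
  outside y hy := inv_apply_eq_self (H.outside y hy)

theorem shrink (H : SpreadsOn e B K h g) (hK : h ∈ suppGroup K') (hKK : K' ⊆ K) :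
    SpreadsOn e B K' h g where
  inside s t hst x hx := H.inside s t hst x (hKK hx)
  outside y hy := by
    by_cases hout : ∀ s t : ℤ, Matches e B s t → ∀ x ∈ K, y ≠ s * x + t
    · exact H.outside y hout
    · push Not at hout
      obtain ⟨s, t, hst, x, hx, rfl⟩ := hout
      rw [H.inside s t hst x hx, hK x fun hx' => hy s t hst x hx' rfl]

/-- Separation on `K'` keeps the added part of each copy clear of all the copies of `K`, so `g` is
trivial there, like `h`. -/
theorem enlarge (H : SpreadsOn e B K h g) (hK : h ∈ suppGroup K) (hKK : K ⊆ K')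
    (hsep : Separates e B B K') : SpreadsOn e B K' h g where
  inside s t hst x hx := by
    by_cases hxK : x ∈ K
    · exact H.inside s t hst x hxK
    · rw [hK x hxK]
      refine H.outside _ fun s' t' hst' x' hx' heq => hxK ?_
      obtain ⟨rfl, rfl⟩ := hsep s t s' t' hst hst' x hx x' (hKK hx') heq
      have hs : (s : ℝ) ≠ 0 := by
        rcases hst.1 with rfl | rfl <;> simp
      rwa [mul_left_cancel₀ hs (add_right_cancel heq)]
  outside y hy := H.outside y fun s t hst x hx => hy s t hst x (hKK hx)

/-- On a copy of `K` that matches only one of the two words, separation makes one factor the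
identity and the commutator cancels. Commutators thus select the occurrences of the longer word. -/
theorem commutator (H : SpreadsOn e B K h g) (H' : SpreadsOn e B' K h' g') (hK : h ∈ suppGroup K)
    (hK' : h' ∈ suppGroup K) (hsep : Separates e B B' K) :
    SpreadsOn e (B ∪ B') K ⁅h, h'⁆ ⁅g, g'⁆ where
  inside s t hst x hx := by
    have hB := hst.mono (subset_union_left (s := B) (t := B'))
    have hB' := hst.mono (subset_union_right (s := B) (t := B'))
    have hx₁ := apply_mem_of_mem_suppGroup (inv_mem hK') hx
    have hx₂ := apply_mem_of_mem_suppGroup (inv_mem hK) hx₁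
    have hx₃ := apply_mem_of_mem_suppGroup hK' hx₂
    simp only [commutatorElement_def, RelIso.mul_apply]
    rw [(H'.inv hK').inside s t hB' x hx, (H.inv hK).inside s t hB _ hx₁,
      H'.inside s t hB' _ hx₂, H.inside s t hB _ hx₃]
  outside y hy := by
    simp only [commutatorElement_def, RelIso.mul_apply]
    by_cases h1 : ∃ s t : ℤ, Matches e B s t ∧ ∃ x ∈ K, y = s * x + t
    · obtain ⟨s, t, hst, x, hx, rfl⟩ := h1
      have key : ∀ z ∈ K, g' (s * z + t) = s * z + t := by
        refine fun z hz => H'.outside _ fun s' t' hst' z' hz' heq => ?_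
        obtain ⟨rfl, rfl⟩ := hsep s t s' t' hst hst' z hz z' hz' heq
        exact hy s t (hst.union hst') x hx rfl
      rw [inv_apply_eq_self (key x hx), (H.inv hK).inside s t hst x hx,
        key _ (apply_mem_of_mem_suppGroup (inv_mem hK) hx), ← (H.inv hK).inside s t hst x hx,
        RelIso.apply_inv_self]
    · push Not at h1
      have hgy : g y = y := H.outside y h1
      by_cases h2 : ∃ s t : ℤ, Matches e B' s t ∧ ∃ x ∈ K, y = s * x + t
      · obtain ⟨s, t, hst, x, hx, rfl⟩ := h2
        have key : ∀ z ∈ K, g (s * z + t) = s * z + t := by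
          refine fun z hz => H.outside _ fun s' t' hst' z' hz' heq => ?_
          obtain ⟨rfl, rfl⟩ := hsep s' t' s t hst' hst z' hz' z hz heq.symm
          exact hy s' t' (hst'.union hst) x hx rfl
        rw [(H'.inv hK').inside s t hst x hx,
          inv_apply_eq_self (key _ (apply_mem_of_mem_suppGroup (inv_mem hK') hx)),
          ← (H'.inv hK').inside s t hst x hx, RelIso.apply_inv_self, hgy]
      · push Not at h2
        have hgy' : g' y = y := H'.outside y h2
        rw [inv_apply_eq_self hgy', inv_apply_eq_self hgy, hgy', hgy]

/-- The copies for the longer word `B` are among those for `B'`, and `g'` preserves each of the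
latter. So the conjugator needs only to spread along the shorter word. -/
theorem conj (H : SpreadsOn e B K h g) (H' : SpreadsOn e B' K h' g') (hBB : B' ⊆ B)
    (hK : h ∈ suppGroup K) (hK' : h' ∈ suppGroup K) (hsep : Separates e B' B' K) :
    SpreadsOn e B K (h' * h * h'⁻¹) (g' * g * g'⁻¹) where
  inside s t hst x hx := by
    have hx₁ := apply_mem_of_mem_suppGroup (inv_mem hK') hx
    have hx₂ := apply_mem_of_mem_suppGroup hK hx₁
    simp only [RelIso.mul_apply]
    rw [(H'.inv hK').inside s t (hst.mono hBB) x hx, H.inside s t hst _ hx₁,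
      H'.inside s t (hst.mono hBB) _ hx₂]
  outside y hy := by
    simp only [RelIso.mul_apply]
    by_cases h2 : ∃ s t : ℤ, Matches e B' s t ∧ ∃ x ∈ K, y = s * x + t
    · obtain ⟨s, t, hst, x, hx, rfl⟩ := h2
      rw [(H'.inv hK').inside s t hst x hx, H.outside, ← (H'.inv hK').inside s t hst x hx,
        RelIso.apply_inv_self]
      intro s' t' hst' x' hx' heq
      obtain ⟨rfl, rfl⟩ := hsep s t s' t' hst (hst'.mono hBB) _
        (apply_mem_of_mem_suppGroup (inv_mem hK') hx) x' hx' heq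
      exact hy s t hst' x hx rfl
    · push Not at h2
      have hgy' : g' y = y := H'.outside y h2
      rw [inv_apply_eq_self hgy', H.outside y hy, hgy']

end SpreadsOn

/-- The homeomorphisms supported in `K` which can be spread, along the occurrences of the word read
at `B`, to an element of `G`. -/
def spreadGroup (G : Subgroup (ℝ ≃o ℝ)) (e : ℤ → ℤ) (B : Set ℤ) (K : Set ℝ) :
    Subgroup (ℝ ≃o ℝ) where
  carrier := {h | h ∈ suppGroup K ∧ ∃ g ∈ G, SpreadsOn e B K h g}
  mul_mem' := by
    rintro h h' ⟨hK, g, hg, H⟩ ⟨hK', g', hg', H'⟩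
    exact ⟨mul_mem hK hK', g * g', mul_mem hg hg', H.mul H' hK'⟩
  one_mem' := ⟨one_mem _, 1, one_mem _, SpreadsOn.one⟩
  inv_mem' := by
    rintro h ⟨hK, g, hg, H⟩
    exact ⟨inv_mem hK, g⁻¹, inv_mem hg, H.inv hK⟩

section

variable {G : Subgroup (ℝ ≃o ℝ)} {e : ℤ → ℤ} {B B' : Set ℤ} {K K' : Set ℝ}

theorem mem_spreadGroup_shrink {h : ℝ ≃o ℝ} (H : h ∈ spreadGroup G e B K)
    (hK : h ∈ suppGroup K') (hKK : K' ⊆ K) : h ∈ spreadGroup G e B K' := by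
  obtain ⟨-, g, hg, hs⟩ := H
  exact ⟨hK, g, hg, hs.shrink hK hKK⟩

theorem spreadGroup_mono (hKK : K ⊆ K') (hsep : Separates e B B K') :
    spreadGroup G e B K ≤ spreadGroup G e B K' := by
  rintro h ⟨hK, g, hg, hs⟩
  exact ⟨suppGroup_mono hKK hK, g, hg, hs.enlarge hK hKK hsep⟩

theorem commutator_spreadGroup_le (hsep : Separates e B B' K) :
    ⁅spreadGroup G e B K, spreadGroup G e B' K⁆ ≤ spreadGroup G e (B ∪ B') K := by
  rw [Subgroup.commutator_le]
  rintro h ⟨hK, g, hg, hs⟩ h' ⟨hK', g', hg', hs'⟩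
  exact ⟨mul_mem (mul_mem (mul_mem hK hK') (inv_mem hK)) (inv_mem hK'), ⁅g, g'⁆,
    mul_mem (mul_mem (mul_mem hg hg') (inv_mem hg)) (inv_mem hg'), hs.commutator hs' hK hK' hsep⟩

theorem conj_mem_spreadGroup {h k : ℝ ≃o ℝ} (hBB : B' ⊆ B) (hsep : Separates e B' B' K)
    (hk : k ∈ spreadGroup G e B' K) (hh : h ∈ spreadGroup G e B K) :
    k * h * k⁻¹ ∈ spreadGroup G e B K := by
  obtain ⟨hK', g', hg', hs'⟩ := hk
  obtain ⟨hK, g, hg, hs⟩ := hh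
  exact ⟨mul_mem (mul_mem hK' hK) (inv_mem hK'), g' * g * g'⁻¹,
    mul_mem (mul_mem hg' hg) (inv_mem hg'), hs.conj hs' hBB hK hK' hsep⟩

/-- No condition on the signs is needed: overlapping copies of opposite orientation would give an
integer `x + x'` strictly between `m` and `m + 1`. -/
theorem separates_half (m : ℤ) : Separates e B B' (Ioo ((m : ℝ) / 2) ((m + 1) / 2)) := by
  rintro s t s' t' ⟨hs, -⟩ ⟨hs', -⟩ x ⟨hx1, hx2⟩ x' ⟨hx1', hx2'⟩ heq
  rcases hs with rfl | rfl <;> rcases hs' with rfl | rfl <;> push_cast at heq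
  · have h1 : (t : ℝ) < t' + 1 := by linarith
    have h2 : (t' : ℝ) < t + 1 := by linarith
    norm_cast at h1 h2
    omega
  · have h1 : (m : ℝ) < t' - t := by linarith
    have h2 : (t' - t : ℝ) < m + 1 := by linarith
    norm_cast at h1 h2
    omega
  · have h1 : (m : ℝ) < t - t' := by linarith
    have h2 : (t - t' : ℝ) < m + 1 := by linarith
    norm_cast at h1 h2
    omega
  · have h1 : (t : ℝ) < t' + 1 := by linarith
    have h2 : (t' : ℝ) < t + 1 := by linarith
    norm_cast at h1 h2
    omega

/-- Overlapping copies of opposite orientation must send the index `m` to the same place, where the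
sign would have to be both `e m` and `-e m`. -/
theorem separates_of_mem (he : ∀ m, e m ≠ 0) {m : ℤ} (hm : m ∈ B) :
    Separates e B B (Ioo (((m : ℝ) - 1) / 2) ((m + 1) / 2)) := by
  rintro s t s' t' ⟨hs, hB⟩ ⟨hs', hB'⟩ x ⟨hx1, hx2⟩ x' ⟨hx1', hx2'⟩ heq
  have e1 := hB m hm
  have e2 := hB' m hm
  have e0 := he m
  rcases hs with rfl | rfl <;> rcases hs' with rfl | rfl <;> push_cast at heq
  · have h1 : (t : ℝ) < t' + 1 := by linarith
    have h2 : (t' : ℝ) < t + 1 := by linarith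
    norm_cast at h1 h2
    omega
  · have h1 : (m : ℝ) - 1 < t' - t := by linarith
    have h2 : (t' - t : ℝ) < m + 1 := by linarith
    norm_cast at h1 h2
    rw [show -1 * m + 2 * t' = 1 * m + 2 * t by omega, e1] at e2
    omega
  · have h1 : (m : ℝ) - 1 < t - t' := by linarith
    have h2 : (t - t' : ℝ) < m + 1 := by linarith
    norm_cast at h1 h2
    rw [show -1 * m + 2 * t = 1 * m + 2 * t' by omega, e2] at e1
    omega
  · have h1 : (t : ℝ) < t' + 1 := by linarith
    have h2 : (t' : ℝ) < t + 1 := by linarith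
    norm_cast at h1 h2
    omega

/-! ### From single letters to arbitrary words -/

variable {c : ℝ ≃o ℝ}

/-- Supports are compressed into `(u, v)` by a map that spreads along the letter at `m` alone, and
conjugating back does not lose the longer word. -/
theorem plc_le_spreadGroup_of_subinterval (hc : IsBump c) (he : ∀ m, e m ≠ 0) {m : ℤ} (hm : m ∈ B)
    (hbase : plc (((m : ℝ) - 1) / 2) ((m + 1) / 2) ≤
      spreadGroup G e {m} (Ioo (((m : ℝ) - 1) / 2) ((m + 1) / 2)))
    {u v : ℝ} (hu : ((m : ℝ) - 1) / 2 < u) (huv : u < v) (hv : v < (m + 1) / 2)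
    (h : plc u v ≤ spreadGroup G e B (Ioo (((m : ℝ) - 1) / 2) ((m + 1) / 2))) :
    plc (((m : ℝ) - 1) / 2) ((m + 1) / 2) ≤
      spreadGroup G e B (Ioo (((m : ℝ) - 1) / 2) ((m + 1) / 2)) := by
  intro t ht
  obtain ⟨φ, hφ, hmem⟩ := hc.exists_conj_mem hu huv hv ht
  have := conj_mem_spreadGroup (singleton_subset_iff.2 hm) (separates_of_mem he (mem_singleton m))
    (inv_mem (hbase hφ)) (h hmem)
  rwa [inv_inv, show φ⁻¹ * (φ * t * φ⁻¹) * φ = t by group] at this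

/-- Homeomorphisms supported in `[(m - 1) / 2, (m + 1) / 2]` can be spread along the occurrences
of any word around `m`. -/
theorem plc_le_spreadGroup_Icc (hc : IsBump c) (he : ∀ m, e m ≠ 0)
    (hperf : ∀ a b : ℝ, a < b → plc a b ≤ ⁅plc a b, plc a b⁆)
    (hbase : ∀ m : ℤ, plc (((m : ℝ) - 1) / 2) ((m + 1) / 2) ≤
      spreadGroup G e {m} (Ioo (((m : ℝ) - 1) / 2) ((m + 1) / 2)))
    (n : ℕ) : ∀ i m : ℤ, m ∈ Icc i (i + n) → plc (((m : ℝ) - 1) / 2) ((m + 1) / 2) ≤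
      spreadGroup G e (Icc i (i + n)) (Ioo (((m : ℝ) - 1) / 2) ((m + 1) / 2)) := by
  induction n with
  | zero =>
    intro i m hm
    have : m = i := by
      simp only [mem_Icc] at hm
      omega
    subst this
    simpa using hbase m
  | succ n ih =>
    intro i
    set S := Icc i (i + ((n + 1 : ℕ) : ℤ)) with hS
    have hSunion : S = Icc i (i + n) ∪ Icc (i + 1) (i + 1 + n) := by
      ext m
      simp only [hS, mem_Icc, mem_union]
      push_cast
      omega
    have hsub : ∀ m : ℤ, Ioo ((m : ℝ) / 2) ((m + 1) / 2) ⊆ Ioo (((m : ℝ) - 1) / 2) ((m + 1) / 2) :=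
      fun m => Ioo_subset_Ioo_left (by linarith)
    have hsub' : ∀ m : ℤ, Ioo ((m : ℝ) / 2) ((m + 1) / 2) ⊆
        Ioo ((((m + 1 : ℤ) : ℝ) - 1) / 2) (((m + 1 : ℤ) + 1) / 2) := fun m => by
      push_cast
      exact Ioo_subset_Ioo (by linarith) (by linarith)
    have hle : ∀ m : ℤ, plc ((m : ℝ) / 2) ((m + 1) / 2) ≤ plc (((m : ℝ) - 1) / 2) ((m + 1) / 2) :=
      fun m => plc_mono (by linarith) le_rfl
    have hle' : ∀ m : ℤ, plc ((m : ℝ) / 2) ((m + 1) / 2) ≤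
        plc ((((m + 1 : ℤ) : ℝ) - 1) / 2) (((m + 1 : ℤ) + 1) / 2) := fun m => by
      push_cast
      exact plc_mono (by linarith) (by linarith)
    have hi : i ∈ S := by
      simp only [hS, mem_Icc]
      omega
    -- The half-length interval lies in the unit intervals around both `i / 2` and `(i + 1) / 2`. By
    -- induction its maps spread along the word without its last letter and along the word without
    -- its first; perfectness and commutators combine the two.
    have hstart : plc ((i : ℝ) / 2) ((i + 1) / 2) ≤
        spreadGroup G e S (Ioo ((i : ℝ) / 2) ((i + 1) / 2)) := by
      have h1 : plc ((i : ℝ) / 2) ((i + 1) / 2) ≤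
          spreadGroup G e (Icc i (i + n)) (Ioo ((i : ℝ) / 2) ((i + 1) / 2)) := fun t ht =>
        mem_spreadGroup_shrink (ih i i (by simp) (hle i ht)) (plc_le_suppGroup ht) (hsub i)
      have h2 : plc ((i : ℝ) / 2) ((i + 1) / 2) ≤
          spreadGroup G e (Icc (i + 1) (i + 1 + n)) (Ioo ((i : ℝ) / 2) ((i + 1) / 2)) := fun t ht =>
        mem_spreadGroup_shrink (ih (i + 1) (i + 1) (by simp) (hle' i ht)) (plc_le_suppGroup ht)
          (hsub' i)
      rw [hSunion]
      exact (hperf _ _ (by linarith)).trans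
        ((Subgroup.commutator_mono h1 h2).trans (commutator_spreadGroup_le (separates_half i)))
    -- Consecutive unit intervals share a half, so the property passes from one to the next:
    -- restrict to the common half, then recover the next full interval by compression.
    have hfull : ∀ k : ℕ, k ≤ n + 1 → plc ((((i + k : ℤ) : ℝ) - 1) / 2) (((i + k : ℤ) + 1) / 2) ≤
        spreadGroup G e S (Ioo ((((i + k : ℤ) : ℝ) - 1) / 2) (((i + k : ℤ) + 1) / 2)) := by
      intro k
      induction k with
      | zero =>
        intro _
        rw [Nat.cast_zero, add_zero]
        refine plc_le_spreadGroup_of_subinterval hc he hi (hbase i)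
          (u := (i : ℝ) / 2 + 1 / 8) (v := (i : ℝ) / 2 + 1 / 4) (by linarith) (by linarith)
          (by linarith) ?_
        exact (plc_mono (by linarith) (by linarith)).trans
          (hstart.trans (spreadGroup_mono (hsub i) (separates_of_mem he hi)))
      | succ k ihk =>
        intro hk
        have hprev := ihk (by omega)
        set m : ℤ := i + k with hm
        have hm1 : i + ((k + 1 : ℕ) : ℤ) = m + 1 := by
          push_cast
          omega
        rw [hm1]
        have hmem : m + 1 ∈ S := by
          simp only [hS, mem_Icc]
          omega
        refine plc_le_spreadGroup_of_subinterval hc he hmem (hbase (m + 1))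
          (u := (m : ℝ) / 2 + 1 / 8) (v := (m : ℝ) / 2 + 1 / 4) (by push_cast; linarith)
          (by linarith) (by push_cast; linarith) ?_
        have h1 : plc ((m : ℝ) / 2) ((m + 1) / 2) ≤
            spreadGroup G e S (Ioo ((m : ℝ) / 2) ((m + 1) / 2)) := fun t ht =>
          mem_spreadGroup_shrink (hprev (hle m ht)) (plc_le_suppGroup ht) (hsub m)
        exact (plc_mono (by linarith) (by linarith)).trans
          (h1.trans (spreadGroup_mono (hsub' m) (separates_of_mem he hmem)))
    intro m hm
    rw [hS, mem_Icc] at hm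
    have := hfull (m - i).toNat (by omega)
    rwa [show i + ((m - i).toNat : ℤ) = m by omega] at this

/-- A subgroup containing all the `plc` of unit length contains the longer ones. -/
theorem plc_le_of_unit_intervals (hc : IsBump c) {H : Subgroup (ℝ ≃o ℝ)} {i : ℤ} (n : ℕ)
    (h : ∀ m : ℤ, i < m → m < i + n + 2 → plc (((m : ℝ) - 1) / 2) ((m + 1) / 2) ≤ H) :
    plc ((i : ℝ) / 2) ((i + n + 2) / 2) ≤ H := by
  induction n with
  | zero =>
    have := h (i + 1) (by omega) (by omega)
    push_cast at this
    refine le_trans (plc_mono ?_ ?_) this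
    · linarith
    · push_cast
      linarith
  | succ n ih =>
    have h1 := ih fun m h1 h2 => h m h1 (by push_cast; omega)
    have h2 := h (i + n + 2) (by omega) (by push_cast; omega)
    have hn : (0 : ℝ) ≤ n := by positivity
    push_cast at h2 ⊢
    refine (hc.plc_le_sup (a₁ := (i : ℝ) / 2) (b₁ := (i + n + 2) / 2) (a₂ := (i + n + 2 - 1) / 2)
      (b₂ := (i + (n + 1) + 2) / 2) (by linarith) (by linarith) (by linarith)).trans
      (sup_le h1 (le_trans (plc_mono le_rfl (by linarith)) h2))

/-- Fragmentation reduces to unit intervals, whose maps spread along any word around them;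
separation of the copies of `(p, q)` allows the enlargement from each unit interval to the whole. -/
theorem plc_le_spreadGroup (hc : IsBump c) (he : ∀ m, e m ≠ 0)
    (hperf : ∀ a b : ℝ, a < b → plc a b ≤ ⁅plc a b, plc a b⁆)
    (hbase : ∀ m : ℤ, plc (((m : ℝ) - 1) / 2) ((m + 1) / 2) ≤
      spreadGroup G e {m} (Ioo (((m : ℝ) - 1) / 2) ((m + 1) / 2)))
    {i j p q : ℤ} (hpq : p < q) (hi : i ≤ 2 * p) (hj : 2 * q ≤ j)
    (hsep : Separates e (Icc i j) (Icc i j) (Ioo p q)) :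
    plc p q ≤ spreadGroup G e (Icc i j) (Ioo p q) := by
  have h := plc_le_of_unit_intervals hc (H := spreadGroup G e (Icc i j) (Ioo (p : ℝ) q))
    (i := 2 * p) (2 * q - 2 * p - 2).toNat ?_
  · have hn : (((2 * q - 2 * p - 2).toNat : ℤ) : ℝ) = 2 * q - 2 * p - 2 := by
      rw [Int.toNat_of_nonneg (by omega)]
      push_cast
      ring
    rw [Int.cast_natCast] at hn
    rw [hn] at h
    refine le_trans (plc_mono ?_ ?_) h
    · push_cast
      linarith
    · push_cast
      linarith
  · intro m h1 h2
    have h3 : 2 * p + 1 ≤ m := by omega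
    have h4 : m + 1 ≤ 2 * q := by omega
    have h3' : (2 * p + 1 : ℝ) ≤ m := by exact_mod_cast h3
    have h4' : (m + 1 : ℝ) ≤ 2 * q := by exact_mod_cast h4
    have h5 := plc_le_spreadGroup_Icc hc he hperf hbase (j - i).toNat i m
    rw [show i + ((j - i).toNat : ℤ) = j by omega] at h5
    exact (h5 ⟨by omega, by omega⟩).trans
      (spreadGroup_mono (Ioo_subset_Ioo (by linarith) (by linarith)) hsep)

end

/-! ### The generators of `G_ρ` -/

/-- The sign of a letter. -/
def letterSign (l : Letter) : ℤ := if l.2 = true then 1 else -1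

theorem letterSign_eq (l : Letter) : letterSign l = 1 ∨ letterSign l = -1 := by
  unfold letterSign
  split_ifs <;> simp

theorem letterSign_ne_zero (l : Letter) : letterSign l ≠ 0 := by
  rcases letterSign_eq l with h | h <;> simp [h]

/-- In the coordinate centred at the midpoint, `ι` is a change of sign, so one formula serves both
orientations. -/
theorem glue_orient_apply (φ : ℤ → (I ≃o I)) {l : Letter} {ν : I ≃o I} {n : ℤ}
    (h : φ n = orient l ν) (y : I) :
    glue φ (n + 1 / 2 + letterSign l * (y - 1 / 2)) = n + 1 / 2 + letterSign l * (ν y - 1 / 2) := by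
  unfold letterSign
  unfold orient at h
  split_ifs at h ⊢ with hl
  · have e1 : (n + 1 / 2 + ((1 : ℤ) : ℝ) * ((y : ℝ) - 1 / 2)) = n + y := by push_cast; ring
    rw [e1, glue_apply, h]
    push_cast
    ring
  · have e1 : (n + 1 / 2 + ((-1 : ℤ) : ℝ) * ((y : ℝ) - 1 / 2)) = n + (unitInterval.symm y : I) := by
      rw [unitInterval.coe_symm_eq]
      push_cast
      ring
    rw [e1, glue_apply, h]
    change (n : ℝ) + ((unitInterval.symm (ν (unitInterval.symm (unitInterval.symm y))) : I) : ℝ) = _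
    rw [unitInterval.symm_symm, unitInterval.coe_symm_eq]
    push_cast
    ring

/-- The homeomorphism built from `ν` on the intervals centred at the half-integers `m' / 2` with
`m'` of the parity of `m`. -/
noncomputable def generator (ρ : ℤ → Letter) (m : ℤ) (ν : I ≃o I) : ℝ ≃o ℝ :=
  if Even m then chi ρ ν else zeta ρ ν

theorem generator_congr (ρ : ℤ → Letter) {m m' : ℤ} (h : Even (m' - m)) (ν : I ≃o I) :
    generator ρ m' ν = generator ρ m ν := by
  unfold generator
  rw [Int.even_sub] at h
  simp [h]

theorem generator_apply (ρ : ℤ → Letter) (m : ℤ) (ν : I ≃o I) (y : I) :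
    generator ρ m ν (m / 2 + letterSign (ρ m) * (y - 1 / 2)) =
      m / 2 + letterSign (ρ m) * (ν y - 1 / 2) := by
  unfold generator
  split_ifs with hm
  · obtain ⟨n, rfl⟩ := hm.two_dvd
    have h := glue_orient_apply (fun n => orient (ρ (2 * n)) ν) (l := ρ (2 * n)) (n := n) rfl y
    change glue (fun n => orient (ρ (2 * n)) ν) (_ + 1 / 2) - 1 / 2 = _
    push_cast
    rw [show (2 * (n : ℝ)) / 2 + letterSign (ρ (2 * n)) * ((y : ℝ) - 1 / 2) + 1 / 2 =
      n + 1 / 2 + letterSign (ρ (2 * n)) * ((y : ℝ) - 1 / 2) by ring, h]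
    ring
  · obtain ⟨n, rfl⟩ := Int.not_even_iff_odd.1 hm
    have h := glue_orient_apply (fun n => orient (ρ (2 * n + 1)) ν) (l := ρ (2 * n + 1)) (n := n)
      rfl y
    change glue (fun n => orient (ρ (2 * n + 1)) ν) _ = _
    push_cast
    rw [show (2 * (n : ℝ) + 1) / 2 = n + 1 / 2 by ring, h]

theorem exists_coord (ρ : ℤ → Letter) (m' : ℤ) {x : ℝ} (h1 : ((m' : ℝ) - 1) / 2 ≤ x)
    (h2 : x ≤ (m' + 1) / 2) : ∃ y : I, x = m' / 2 + letterSign (ρ m') * (y - 1 / 2) := by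
  rcases letterSign_eq (ρ m') with h | h <;> rw [h]
  · refine ⟨⟨x - (m' - 1) / 2, by linarith, by linarith⟩, ?_⟩
    push_cast
    ring
  · refine ⟨⟨(m' + 1) / 2 - x, by linarith, by linarith⟩, ?_⟩
    push_cast
    ring

theorem exists_index (m : ℤ) (x : ℝ) :
    ∃ m' : ℤ, Even (m' - m) ∧ ((m' : ℝ) - 1) / 2 ≤ x ∧ x < (m' + 1) / 2 := by
  refine ⟨m + 2 * ⌊x - (m - 1) / 2⌋, by simp, ?_, ?_⟩
  · have := Int.floor_le (x - (m - 1) / 2)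
    push_cast
    linarith
  · have := Int.lt_floor_add_one (x - (m - 1) / 2)
    push_cast
    linarith

theorem exists_index' (m : ℤ) (x : ℝ) :
    ∃ m' : ℤ, Even (m' - m) ∧ ((m' : ℝ) - 1) / 2 < x ∧ x ≤ (m' + 1) / 2 := by
  obtain ⟨m', h0, h1, h2⟩ := exists_index m x
  rcases h1.eq_or_lt with h | h
  · refine ⟨m' - 2, ?_, ?_, ?_⟩
    · rw [sub_right_comm]
      exact h0.sub (by decide)
    · push_cast
      linarith
    · push_cast
      linarith
  · exact ⟨m', h0, h, h2.le⟩

theorem abs_coord_le (ρ : ℤ → Letter) (m : ℤ) (y : I) :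
    |(m : ℝ) / 2 - (m / 2 + letterSign (ρ m) * (y - 1 / 2))| ≤ 1 := by
  have h1 := y.2.1
  have h2 := y.2.2
  rw [abs_le]
  rcases letterSign_eq (ρ m) with h | h <;> rw [h] <;> push_cast <;> constructor <;> linarith

/-! ### A generator on a single unit interval -/

/-- The translate of `ν` to the interval centred at `m / 2`, oriented by the letter at `m / 2`. -/
noncomputable def translate (ρ : ℤ → Letter) (m : ℤ) : (I ≃o I) →* (ℝ ≃o ℝ) :=
  (if (ρ m).2 = true then affConj (twoPow 0) ((m - 1) / 2) else affConj (-1) ((m + 1) / 2)).comp ext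

theorem translate_apply (ρ : ℤ → Letter) (m : ℤ) (ν : I ≃o I) (y : I) :
    translate ρ m ν (m / 2 + letterSign (ρ m) * (y - 1 / 2)) =
      m / 2 + letterSign (ρ m) * (ν y - 1 / 2) := by
  unfold translate letterSign
  split_ifs
  · rw [MonoidHom.comp_apply, show (m / 2 + ((1 : ℤ) : ℝ) * ((y : ℝ) - 1 / 2)) =
      (twoPow 0 : ℝˣ) * y + ((m : ℝ) - 1) / 2 by rw [coe_twoPow]; push_cast; ring, affConj_apply,
      ext_apply_coe, coe_twoPow]
    push_cast
    ring
  · rw [MonoidHom.comp_apply, affConj_neg_one_apply,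
      show ((m : ℝ) + 1) / 2 - (m / 2 + ((-1 : ℤ) : ℝ) * ((y : ℝ) - 1 / 2)) = y by push_cast; ring,
      ext_apply_coe]
    push_cast
    ring

theorem ext_mem_suppGroup_Ioo (ν : I ≃o I) : ext ν ∈ suppGroup (Ioo 0 1) := by
  rw [ext_mem_suppGroup_iff]
  rintro x ⟨y, rfl, hy⟩
  refine ⟨lt_of_le_of_ne y.2.1 fun h => hy ?_, lt_of_le_of_ne y.2.2 fun h => hy ?_⟩
  · rw [show y = ⊥ from Subtype.ext h.symm, ν.map_bot]
  · rw [show y = ⊤ from Subtype.ext h, ν.map_top]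

theorem translate_mem_suppGroup (ρ : ℤ → Letter) (m : ℤ) (ν : I ≃o I) :
    translate ρ m ν ∈ suppGroup (Ioo (((m : ℝ) - 1) / 2) ((m + 1) / 2)) := by
  intro x hx
  unfold translate
  split_ifs
  · rw [MonoidHom.comp_apply, affConj_def, coe_twoPow, ext_mem_suppGroup_Ioo]
    · simp
    · rw [zpow_zero, inv_one, one_mul]
      exact fun h => hx ⟨by linarith [h.1], by linarith [h.2]⟩
  · rw [MonoidHom.comp_apply, affConj_neg_one_apply, ext_mem_suppGroup_Ioo]
    · ring
    · exact fun h => hx ⟨by linarith [h.2], by linarith [h.1]⟩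

theorem isPL_translate (ρ : ℤ → Letter) (m : ℤ) {ν : I ≃o I} (hν : IsPL (ext ν)) :
    IsPL (translate ρ m ν) := by
  unfold translate
  split_ifs
  · exact hν.affConj_twoPow 0 ⟨m - 1, 1, by push_cast; ring⟩
  · exact hν.affConj_neg_one ⟨m + 1, 1, by push_cast; ring⟩

theorem generator_eq_translate (ρ : ℤ → Letter) (m : ℤ) (ν : I ≃o I) {x : ℝ}
    (h1 : ((m : ℝ) - 1) / 2 ≤ x) (h2 : x ≤ (m + 1) / 2) :
    generator ρ m ν x = translate ρ m ν x := by
  obtain ⟨y, rfl⟩ := exists_coord ρ m h1 h2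
  rw [generator_apply, translate_apply]

theorem isPL_generator (ρ : ℤ → Letter) (m : ℤ) {ν : I ≃o I} (hν : IsPL (ext ν)) :
    IsPL (generator ρ m ν) := by
  refine IsPL.of_local (fun x => ?_) (fun x => ?_) (fun x hx => ?_)
  · obtain ⟨m', h0, h1, h2⟩ := exists_index m x
    rw [← generator_congr ρ h0]
    refine ⟨translate ρ m' ν, isPL_translate ρ m' hν, generator_eq_translate ρ m' ν h1 h2.le, ?_⟩
    filter_upwards [Ioo_mem_nhdsGT h2] with z hz
    exact generator_eq_translate ρ m' ν (h1.trans hz.1.le) hz.2.le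
  · obtain ⟨m', h0, h1, h2⟩ := exists_index' m x
    rw [← generator_congr ρ h0]
    refine ⟨translate ρ m' ν, isPL_translate ρ m' hν, generator_eq_translate ρ m' ν h1.le h2, ?_⟩
    filter_upwards [Ioo_mem_nhdsLT h1] with z hz
    exact generator_eq_translate ρ m' ν hz.1.le (hz.2.le.trans h2)
  · obtain ⟨m', h0, h1, h2⟩ := exists_index m x
    rw [← generator_congr ρ h0]
    have h1' : ((m' : ℝ) - 1) / 2 < x := by
      refine lt_of_le_of_ne h1 fun h => hx (h ▸ ⟨m' - 1, 1, ?_⟩)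
      push_cast
      ring
    refine ⟨translate ρ m' ν, isPL_translate ρ m' hν, ?_⟩
    filter_upwards [Ioo_mem_nhds h1' h2] with z hz
    exact generator_eq_translate ρ m' ν hz.1.le hz.2.le

theorem generator_apply_isometry (ρ : ℤ → Letter) (m : ℤ) (ν : I ≃o I) {m' s t : ℤ}
    (hm' : Even (m' - m)) (hs : s = 1 ∨ s = -1)
    (h : letterSign (ρ (s * m' + 2 * t)) = s * letterSign (ρ m')) (y : I) :
    generator ρ m ν (s * (m' / 2 + letterSign (ρ m') * (y - 1 / 2)) + t) =
      s * (m' / 2 + letterSign (ρ m') * (ν y - 1 / 2)) + t := by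
  have h0 : Even (s * m' + 2 * t - m) := by
    rw [show s * m' + 2 * t - m = (m' - m) + (2 * t + (s - 1) * m') by ring]
    refine hm'.add ((even_two_mul t).add (Even.mul_right ?_ m'))
    rcases hs with rfl | rfl <;> decide
  rw [← generator_congr ρ h0]
  have h1 := generator_apply ρ (s * m' + 2 * t) ν y
  rw [h] at h1
  push_cast at h1
  rw [show (s : ℝ) * (m' / 2 + letterSign (ρ m') * (y - 1 / 2)) + t =
    (s * m' + 2 * t) / 2 + s * letterSign (ρ m') * (y - 1 / 2) by ring, h1]
  ring

/-- Each interval of the right parity is the image of the one at `m` under an isometry matching the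
single letter there, the sign being dictated by the two letters. Only interval endpoints escape, and
these are fixed. -/
theorem spreadsOn_generator (ρ : ℤ → Letter) (m : ℤ) (ν : I ≃o I) :
    SpreadsOn (fun m => letterSign (ρ m)) {m} (Ioo (((m : ℝ) - 1) / 2) ((m + 1) / 2))
      (translate ρ m ν) (generator ρ m ν) where
  inside := by
    rintro s t ⟨hs, h⟩ x hx
    obtain ⟨y, rfl⟩ := exists_coord ρ m hx.1.le hx.2.le
    rw [translate_apply]
    exact generator_apply_isometry ρ m ν (by simp) hs (h m (mem_singleton m)) y
  outside := by
    intro x hx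
    obtain ⟨m', h0, h1, h2⟩ := exists_index m x
    obtain ⟨y, rfl⟩ := exists_coord ρ m' h1 h2.le
    rw [← generator_congr ρ h0, generator_apply]
    obtain ⟨r, hr⟩ := h0.two_dvd
    obtain ⟨s, hs, hss⟩ : ∃ s : ℤ, (s = 1 ∨ s = -1) ∧
        letterSign (ρ m') = s * letterSign (ρ m) := by
      rcases letterSign_eq (ρ m') with h | h <;> rcases letterSign_eq (ρ m) with h' | h' <;>
        rw [h, h']
      exacts [⟨1, by simp⟩, ⟨-1, by simp⟩, ⟨-1, by simp⟩, ⟨1, by simp⟩]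
    obtain ⟨t, ht⟩ : ∃ t, m' = s * m + 2 * t := by
      rcases hs with rfl | rfl
      exacts [⟨r, by omega⟩, ⟨r + m, by omega⟩]
    have h3 := hx s t ⟨hs, fun k hk => by rw [mem_singleton_iff.1 hk, ← ht]; exact hss⟩
      (m / 2 + letterSign (ρ m) * (y - 1 / 2))
    have h4 : (m' : ℝ) / 2 + letterSign (ρ m') * (y - 1 / 2) =
        s * (m / 2 + letterSign (ρ m) * (y - 1 / 2)) + t := by
      rw [hss, ht]
      push_cast
      ring
    have hy : y = ⊥ ∨ y = ⊤ := by
      by_contra hcon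
      push Not at hcon
      have hy0 : (0 : ℝ) < y := lt_of_le_of_ne y.2.1 fun h => hcon.1 (Subtype.ext h.symm)
      have hy1 : (y : ℝ) < 1 := lt_of_le_of_ne y.2.2 fun h => hcon.2 (Subtype.ext h)
      refine h3 ?_ h4
      rcases letterSign_eq (ρ m) with h | h <;> rw [h] <;> push_cast <;> constructor <;> linarith
    rcases hy with rfl | rfl
    · rw [ν.map_bot]
    · rw [ν.map_top]

/-! ### Local homeomorphisms -/

/-- `f` commutes with the isometries which match near the given point. -/
def IsLocal (e : ℤ → ℤ) (r : ℝ) (f : ℝ ≃o ℝ) : Prop :=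
  ∀ (s t : ℤ) (x : ℝ), Matches e {m : ℤ | |(m : ℝ) / 2 - x| ≤ r} s t → f (s * x + t) = s * f x + t

/-- The group of local homeomorphisms with bounded displacement. -/
def localGroup (e : ℤ → ℤ) : Subgroup (ℝ ≃o ℝ) where
  carrier := {f | ∃ r d, IsLocal e r f ∧ ∀ x, |f x - x| ≤ d}
  mul_mem' := by
    rintro f g ⟨r, d, hf, hfd⟩ ⟨r', d', hg, hgd⟩
    -- The word must also be visible to `f` at `g x`, which is up to `d'` away from `x`.
    refine ⟨max r' (r + d'), d + d', fun s t x h => ?_, fun x => ?_⟩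
    · rw [RelIso.mul_apply, hg s t x (h.mono fun m (hm : |(m : ℝ) / 2 - x| ≤ r') =>
        show |(m : ℝ) / 2 - x| ≤ max r' (r + d') from le_trans hm (le_max_left _ _)),
        hf s t (g x), RelIso.mul_apply]
      refine h.mono fun m (hm : |(m : ℝ) / 2 - g x| ≤ r) =>
        show |(m : ℝ) / 2 - x| ≤ max r' (r + d') from le_trans ?_ (le_max_right _ _)
      have := abs_add_le ((m : ℝ) / 2 - g x) (g x - x)
      rw [sub_add_sub_cancel] at this
      linarith [hgd x]
    · have := abs_add_le (f (g x) - g x) (g x - x)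
      rw [sub_add_sub_cancel] at this
      rw [RelIso.mul_apply]
      linarith [hgd x, hfd (g x)]
  one_mem' := ⟨0, 0, fun s t x _ => rfl, fun x => by simp⟩
  inv_mem' := by
    rintro f ⟨r, d, hf, hfd⟩
    have hd : ∀ x, |x - f⁻¹ x| ≤ d := fun x => by
      have := hfd (f⁻¹ x)
      rwa [RelIso.apply_inv_self] at this
    refine ⟨r + d, d, fun s t x h => ?_, fun x => by rw [abs_sub_comm]; exact hd x⟩
    have h1 := hf s t (f⁻¹ x) (h.mono fun m (hm : |(m : ℝ) / 2 - f⁻¹ x| ≤ r) => by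
      have := abs_sub_le ((m : ℝ) / 2) (f⁻¹ x) x
      have h2 := hd x
      rw [abs_sub_comm] at h2
      exact show |(m : ℝ) / 2 - x| ≤ r + d from this.trans (add_le_add hm h2))
    rw [RelIso.apply_inv_self] at h1
    rw [← h1, RelIso.inv_apply_self]

theorem generator_mem_localGroup (ρ : ℤ → Letter) (m : ℤ) (ν : I ≃o I) :
    generator ρ m ν ∈ localGroup fun m => letterSign (ρ m) := by
  refine ⟨1, 1, fun s t x h => ?_, fun x => ?_⟩
  · obtain ⟨m', h0, h1, h2⟩ := exists_index m x
    obtain ⟨y, rfl⟩ := exists_coord ρ m' h1 h2.le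
    rw [generator_apply_isometry ρ m ν h0 h.1 (h.2 m' (abs_coord_le ρ m' y)) y,
      ← generator_congr ρ h0, generator_apply]
  · obtain ⟨m', h0, h1, h2⟩ := exists_index m x
    obtain ⟨y, rfl⟩ := exists_coord ρ m' h1 h2.le
    rw [← generator_congr ρ h0, generator_apply, abs_le]
    have a1 := y.2.1
    have a2 := y.2.2
    have a3 := (ν y).2.1
    have a4 := (ν y).2.2
    rcases letterSign_eq (ρ m') with h | h <;> rw [h] <;> push_cast <;> constructor <;> linarith

/-! ### The group `G_ρ` -/

section

variable {ρ : ℤ → Letter} {c₀ ν₂ ν₃ : I ≃o I}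

theorem groupG_le {H : Subgroup (ℝ ≃o ℝ)}
    (h : ∀ ν ∈ ({nuOne c₀, ν₂, ν₃} : Set (I ≃o I)), ∀ m, generator ρ m ν ∈ H) :
    groupG ρ c₀ ν₂ ν₃ ≤ H := by
  have h0 : ∀ ν, generator ρ 0 ν = chi ρ ν := fun ν => if_pos (by decide)
  have h1 : ∀ ν, generator ρ 1 ν = zeta ρ ν := fun ν => if_neg (by decide)
  unfold groupG
  rw [Subgroup.closure_le]
  rintro g (rfl | rfl | rfl | rfl | rfl | rfl)
  · exact h1 _ ▸ h _ (by simp) 1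
  · exact h1 _ ▸ h _ (by simp) 1
  · exact h1 _ ▸ h _ (by simp) 1
  · exact h0 _ ▸ h _ (by simp) 0
  · exact h0 _ ▸ h _ (by simp) 0
  · exact h0 _ ▸ h _ (by simp) 0

theorem generator_mem_groupG {ν : I ≃o I} (hν : ν ∈ ({nuOne c₀, ν₂, ν₃} : Set (I ≃o I))) (m : ℤ) :
    generator ρ m ν ∈ groupG ρ c₀ ν₂ ν₃ := by
  unfold generator groupG
  apply Subgroup.subset_closure
  rcases hν with rfl | rfl | rfl <;> split_ifs <;> simp

theorem groupG_le_localGroup : groupG ρ c₀ ν₂ ν₃ ≤ localGroup fun m => letterSign (ρ m) :=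
  groupG_le fun ν _ m => generator_mem_localGroup ρ m ν

variable (h : IsAdmissible c₀ ν₂ ν₃)

include h

theorem IsAdmissible.isPL_nuOne : IsPL (ext (nuOne c₀)) := by
  rw [nuOne, map_mul, ext_conjIota]
  exact h.isBump.isPL.mul (h.isBump.isPL.affConj_neg_one (by simpa using IsDyadic.intCast 1))

theorem IsAdmissible.isPL_of_mem_closure {ν : I ≃o I} (hν : ν ∈ Subgroup.closure {ν₂, ν₃}) :
    IsPL (ext ν) := by
  have : ν ∈ thompsonFOn (1 / 16) (15 / 16) := by
    rw [← h.closure_eq]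
    exact hν
  exact isPL_ext_iff.2 this.1

theorem IsAdmissible.groupG_le_plGroup : groupG ρ c₀ ν₂ ν₃ ≤ plGroup := by
  refine groupG_le fun ν hν m => isPL_generator ρ m ?_
  rcases hν with rfl | rfl | rfl
  · exact h.isPL_nuOne
  · exact h.isPL_of_mem_closure (Subgroup.subset_closure (by simp))
  · exact h.isPL_of_mem_closure (Subgroup.subset_closure (by simp))

theorem IsAdmissible.nuOne_apply {x : ℝ} (h0 : 0 < x) (h1 : x < 1 / 16) :
    ext (nuOne c₀) x = 2 * x ∧ ext (nuOne c₀) (1 - x) = 1 - 2 * x := by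
  have hc := h.isBump
  rw [nuOne, map_mul, ext_conjIota, RelIso.mul_apply, RelIso.mul_apply, affConj_neg_one_apply,
    affConj_neg_one_apply, sub_sub_cancel, hc.apply_eq x ⟨h0, h1⟩,
    hc.supp (1 - x) fun h => by linarith [h.2], hc.supp (1 - 2 * x) fun h => by linarith [h.2],
    sub_sub_cancel, hc.apply_eq x ⟨h0, h1⟩]
  exact ⟨rfl, rfl⟩

/-- `ν₁` doubles distances to both endpoints near them, so conjugation by a high power of it moves a
compact support into `[1/16, 15/16]`, where `ν₂` and `ν₃` generate everything. -/
theorem IsAdmissible.plc_zero_one_le :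
    plc 0 1 ≤ (Subgroup.closure {nuOne c₀, ν₂, ν₃}).map ext := by
  rintro t ⟨a, b, ha, hb, ht⟩
  set H := (Subgroup.closure {nuOne c₀, ν₂, ν₃}).map ext with hH
  have hg : ext (nuOne c₀) ∈ H :=
    Subgroup.mem_map_of_mem _ (Subgroup.subset_closure (by simp))
  have hpow : ∀ n : ℕ, (ext (nuOne c₀) ^ n) ((1 / 2) ^ n / 16) = 1 / 16 ∧
      (ext (nuOne c₀) ^ n) (1 - (1 / 2) ^ n / 16) = 15 / 16 := by
    intro n
    induction n with
    | zero => norm_num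
    | succ n ih =>
      have h1 : (0 : ℝ) < (1 / 2) ^ n := by positivity
      have h2 : ((1 : ℝ) / 2) ^ n ≤ 1 := pow_le_one₀ (by norm_num) (by norm_num)
      obtain ⟨e1, e2⟩ := h.nuOne_apply (x := (1 / 2) ^ (n + 1) / 16) (by positivity) (by
        rw [pow_succ]
        linarith)
      have e3 : (2 : ℝ) * ((1 / 2) ^ (n + 1) / 16) = (1 / 2) ^ n / 16 := by
        rw [pow_succ]
        ring
      rw [pow_succ (ext (nuOne c₀)) n, RelIso.mul_apply, RelIso.mul_apply, e1, e2, e3]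
      exact ih
  obtain ⟨n, hn⟩ := exists_pow_lt_of_lt_one (lt_min ha (sub_pos.2 hb)) (y := (1 / 2 : ℝ))
    (by norm_num)
  obtain ⟨hn1, hn2⟩ := lt_min_iff.1 hn
  have hpos : (0 : ℝ) < (1 / 2) ^ n := by positivity
  have ht' : t ∈ plOn ((1 / 2) ^ n / 16) (1 - (1 / 2) ^ n / 16) :=
    plOn_mono (by linarith) (by linarith) ht
  have h3 := conj_mem_plOn (pow_mem (show ext (nuOne c₀) ∈ plGroup from h.isPL_nuOne) n) ht'
  rw [(hpow n).1, (hpow n).2, h.plOn_eq] at h3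
  have hle : Subgroup.closure {ext ν₂, ext ν₃} ≤ H := by
    rw [Subgroup.closure_le]
    rintro _ (rfl | rfl)
    · exact Subgroup.mem_map_of_mem _ (Subgroup.subset_closure (by simp))
    · exact Subgroup.mem_map_of_mem _ (Subgroup.subset_closure (by simp))
  have h4 := mul_mem (mul_mem (inv_mem (pow_mem hg n)) (hle h3)) (pow_mem hg n)
  rwa [show (ext (nuOne c₀) ^ n)⁻¹ * (ext (nuOne c₀) ^ n * t * (ext (nuOne c₀) ^ n)⁻¹) *
    ext (nuOne c₀) ^ n = t by group] at h4

theorem IsAdmissible.plc_le_spreadGroup_singleton (m : ℤ) :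
    plc (((m : ℝ) - 1) / 2) ((m + 1) / 2) ≤ spreadGroup (groupG ρ c₀ ν₂ ν₃)
      (fun m => letterSign (ρ m)) {m} (Ioo (((m : ℝ) - 1) / 2) ((m + 1) / 2)) := by
  have h1 : Subgroup.closure {nuOne c₀, ν₂, ν₃} ≤ (spreadGroup (groupG ρ c₀ ν₂ ν₃)
      (fun m => letterSign (ρ m)) {m} (Ioo (((m : ℝ) - 1) / 2) ((m + 1) / 2))).comap
      (translate ρ m) := by
    rw [Subgroup.closure_le]
    intro ν hν
    exact ⟨translate_mem_suppGroup ρ m ν, _, generator_mem_groupG hν m, spreadsOn_generator ρ m ν⟩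
  intro t ht
  obtain ⟨t', ht', rfl⟩ : ∃ t' ∈ plc 0 1, (if (ρ m).2 = true then
      affConj (twoPow 0) ((m - 1) / 2) else affConj (-1) ((m + 1) / 2)) t' = t := by
    split_ifs
    · refine ⟨affConj (twoPow 0) (-((m - 1) / 2)) t, ?_, ?_⟩
      · obtain ⟨a, b, ha, hb, ht⟩ := ht
        refine plOn_le_plc ?_ ?_ (affConj_twoPow_mem_plOn 0 (IsDyadic.neg ?_) ht)
        · rw [zpow_zero]
          linarith
        · rw [zpow_zero]
          linarith
        · exact ⟨m - 1, 1, by push_cast; ring⟩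
      · ext x
        simp [affConj_def, coe_twoPow]
    · refine ⟨affConj (-1) ((m + 1) / 2) t, ?_, affConj_neg_one_affConj_neg_one _ _⟩
      have := affConj_neg_one_mem_plc ht (c := (m + 1) / 2) ⟨m + 1, 1, by push_cast; ring⟩
      rwa [sub_self, show ((m : ℝ) + 1) / 2 - (m - 1) / 2 = 1 by ring] at this
  obtain ⟨ν, hν, rfl⟩ := h.plc_zero_one_le ht'
  exact h1 hν

end

/-! ### Combinatorics of quasi-periodic labellings -/

theorem getElem?_blockWord (ρ : ℤ → Letter) (k : ℤ) {n i : ℕ} (hi : i ≤ n) :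
    (blockWord ρ k n)[i]? = some (ρ (k + i)) := by
  have hmap : blockWord ρ k n = (List.range (n + 1)).map fun i : ℕ => ρ (k + (i : ℤ)) := by
    simp only [blockWord, List.pure_def, List.bind_eq_flatMap, List.map_flatMap, List.map_cons,
      List.map_nil]
    exact List.map_eq_flatMap.symm
  rw [hmap, List.getElem?_map, List.getElem?_range (by omega)]
  rfl

theorem length_blockWord (ρ : ℤ → Letter) (k : ℤ) (n : ℕ) : (blockWord ρ k n).length = n + 1 := by
  simp [blockWord]

theorem IsLabelling.even_sub_of_fst_eq {ρ : ℤ → Letter} (h : IsLabelling ρ) {m m' : ℤ}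
    (heq : (ρ m).1 = (ρ m').1) : Even (m - m') := by
  rcases Int.even_or_odd' m with ⟨k, rfl | rfl⟩ <;> rcases Int.even_or_odd' m' with ⟨k', rfl | rfl⟩
  · exact ⟨k - k', by ring⟩
  · rw [h.at_int, h.at_half] at heq
    cases heq
  · rw [h.at_int, h.at_half] at heq
    cases heq
  · exact ⟨k - k', by ring⟩

/-- Translations which match on a given block are relatively dense. -/
theorem IsQuasiPeriodic.exists_matches {ρ : ℤ → Letter} (h : IsQuasiPeriodic ρ) (R : ℕ) :
    ∃ N : ℕ, ∀ k : ℤ, ∃ t, k ≤ t ∧ t ≤ k + N ∧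
      Matches (fun m => letterSign (ρ m)) (Icc (-(R : ℤ)) R) 1 t := by
  obtain ⟨N, hN⟩ := h.recurrent (-R) (2 * R)
  refine ⟨N, fun k => ?_⟩
  obtain ⟨l, l', hl⟩ := hN (2 * k - R) N (by omega)
  have hlen := congrArg List.length hl
  simp only [List.length_append, length_blockWord] at hlen
  have key : ∀ i : ℕ, i ≤ 2 * R → ρ (2 * k - R + (l.length + i : ℕ)) = ρ (-R + i) := by
    intro i hi
    have h1 : (blockWord ρ (2 * k - R) N)[l.length + i]? = (blockWord ρ (-R) (2 * R))[i]? := by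
      rw [← hl, List.append_assoc, List.getElem?_append_right (by omega), Nat.add_sub_cancel_left,
        List.getElem?_append_left (by rw [length_blockWord]; omega)]
    rw [getElem?_blockWord _ _ (by omega), getElem?_blockWord _ _ hi] at h1
    exact Option.some.inj h1
  -- Letter types alternate, so the occurrence is displaced by an even number of indices, that is,
  -- by an integer translation.
  have hev := h.isLabelling.even_sub_of_fst_eq (congrArg Prod.fst (key 0 (by omega)))
  push_cast at hev
  obtain ⟨j, hj⟩ : Even (l.length : ℤ) := by
    rw [Int.even_iff] at hev ⊢
    omega
  refine ⟨k + j, by omega, by omega, Or.inl rfl, fun m hm => ?_⟩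
  have := key (m + R).toNat (by have := hm.2; omega)
  have hm1 := hm.1
  rw [show (2 * k - R + (l.length + (m + R).toNat : ℕ) : ℤ) = 1 * m + 2 * (k + j) by
    push_cast; omega, show (-R + ((m + R).toNat : ℤ) : ℤ) = m by omega] at this
  dsimp only
  rw [this, one_mul]

theorem letterSign_inv (l : Letter) : letterSign (l.1, !l.2) = -letterSign l := by
  unfold letterSign
  rcases l with ⟨x, _ | _⟩ <;> simp

/-- The inverse of a word covering a full period occurs somewhere, so some reflection of the indices
reverses all signs on that word. Letter types make its centre an integer index `c`. By periodicity
`c` has a representative in the word, whose sign would have to be its own negative. -/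
theorem IsQuasiPeriodic.not_periodic {ρ : ℤ → Letter} (h : IsQuasiPeriodic ρ) {u : ℤ}
    (hu : u ≠ 0) : ∃ m, letterSign (ρ m) ≠ letterSign (ρ (m + 2 * u)) := by
  by_contra! hper
  have hp : Function.Periodic (fun m => letterSign (ρ m)) (2 * u) := fun m => (hper m).symm
  obtain ⟨k, n, hkn⟩ := h.inverse 0 (2 * u.natAbs)
  have hlen := congrArg List.length hkn
  rw [FreeGroup.invRev_length, length_blockWord, length_blockWord] at hlen
  obtain rfl : n = 2 * u.natAbs := by omega
  set n := 2 * u.natAbs with hn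
  have key : ∀ i : ℕ, i ≤ n → ρ (k + (n - i : ℕ)) = ((ρ i).1, !(ρ i).2) := by
    intro i hi
    have h1 := congrArg (fun l => l[n - i]?) hkn
    rw [getElem?_blockWord _ _ (by omega), FreeGroup.invRev, List.getElem?_reverse (by
      rw [List.length_map, length_blockWord]; omega), List.length_map, length_blockWord,
      List.getElem?_map, getElem?_blockWord _ _ (by omega)] at h1
    have h2 := Option.some.inj h1
    rw [h2, show n + 1 - 1 - (n - i) = i by omega, zero_add]
  have hev := h.isLabelling.even_sub_of_fst_eq (m := k + (n - 0 : ℕ)) (m' := (0 : ℕ))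
    (by rw [key 0 (by omega)])
  obtain ⟨c, hc⟩ : Even (k + n) := by simpa using hev
  have hmod := Int.emod_add_mul_ediv c (2 * u)
  have hnn := Int.emod_nonneg c (show 2 * u ≠ 0 by omega)
  have hlt := Int.emod_lt_abs c (show 2 * u ≠ 0 by omega)
  have hnu : (n : ℤ) = |2 * u| := by
    rw [hn, abs_mul]
    push_cast
    rfl
  have h1 := key (c % (2 * u)).toNat (by omega)
  have h2 := congrArg letterSign h1
  rw [letterSign_inv, Int.toNat_of_nonneg hnn, Nat.cast_sub (by omega),
    Int.toNat_of_nonneg hnn] at h2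
  have h3 : letterSign (ρ (c % (2 * u))) = letterSign (ρ c) := by
    have := hp.int_mul (c / (2 * u)) (c % (2 * u))
    rw [Int.cast_id, show c % (2 * u) + c / (2 * u) * (2 * u) = c by linarith] at this
    exact this.symm
  have h4 : letterSign (ρ (k + (n - c % (2 * u)))) = letterSign (ρ c) := by
    have := hp.int_mul (c / (2 * u)) c
    rw [Int.cast_id, show c + c / (2 * u) * (2 * u) = k + (n - c % (2 * u)) by linarith] at this
    exact this
  rw [h3, h4] at h2
  have := letterSign_ne_zero (ρ c)
  omega

/-- Overlap bounds the relative translation by `2 * D`. Each of the finitely many nonzero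
translations fails at a witness `μ u`, and the radius is chosen to contain all witnesses and their
translates. For opposite orientations the two isometries agree at an index in the block, where the
signs conflict. -/
theorem IsQuasiPeriodic.exists_separates {ρ : ℤ → Letter} (h : IsQuasiPeriodic ρ) (D R₀ : ℕ) :
    ∃ R : ℕ, R₀ ≤ R ∧ Separates (fun m => letterSign (ρ m)) (Icc (-(R : ℤ)) R) (Icc (-(R : ℤ)) R)
      (Ioo (-(D : ℝ)) D) := by
  choose! μ hμ using fun (u : ℤ) (hu : u ≠ 0) => h.not_periodic hu
  set S := ∑ u ∈ Finset.Icc (-(2 * D : ℤ)) (2 * D), ((μ u).natAbs + (μ u + 2 * u).natAbs) with hS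
  have hle : ∀ u ∈ Finset.Icc (-(2 * D : ℤ)) (2 * D),
      (μ u).natAbs + (μ u + 2 * u).natAbs ≤ S := fun u hu =>
    Finset.single_le_sum (f := fun u => (μ u).natAbs + (μ u + 2 * u).natAbs)
      (fun _ _ => Nat.zero_le _) hu
  refine ⟨R₀ + 2 * D + S, by omega, ?_⟩
  have hcontra : ∀ u : ℤ, u ≠ 0 → -(2 * D : ℤ) ≤ u → u ≤ 2 * D →
      (∀ m ∈ Icc (-((R₀ + 2 * D + S : ℕ) : ℤ)) (R₀ + 2 * D + S : ℕ),
        m + 2 * u ∈ Icc (-((R₀ + 2 * D + S : ℕ) : ℤ)) (R₀ + 2 * D + S : ℕ) →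
        letterSign (ρ m) = letterSign (ρ (m + 2 * u))) → False := by
    intro u hu h1 h2 h3
    have h4 := hle u (Finset.mem_Icc.2 ⟨h1, h2⟩)
    refine hμ u hu (h3 _ ?_ ?_) <;> rw [mem_Icc] <;> constructor <;> omega
  rintro s t s' t' ⟨hs, hB⟩ ⟨hs', hB'⟩ x ⟨hx1, hx2⟩ x' ⟨hx1', hx2'⟩ heq
  rcases hs with rfl | rfl <;> rcases hs' with rfl | rfl <;> push_cast at heq
  · refine ⟨rfl, ?_⟩
    by_contra hne
    have h1 : (t : ℝ) - t' < 2 * D := by linarith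
    have h2 : (t' : ℝ) - t < 2 * D := by linarith
    norm_cast at h1 h2
    refine hcontra (t - t') (by omega) (by omega) (by omega) fun m hm hm' => ?_
    have e1 := hB m hm
    have e2 := hB' _ hm'
    dsimp only at e1 e2
    rw [show 1 * (m + 2 * (t - t')) + 2 * t' = 1 * m + 2 * t by ring] at e2
    omega
  · have h1 : (t' : ℝ) - t < 2 * D := by linarith
    have h2 : -(2 * D : ℝ) < t' - t := by linarith
    norm_cast at h1 h2
    have hm : t' - t ∈ Icc (-((R₀ + 2 * D + S : ℕ) : ℤ)) (R₀ + 2 * D + S : ℕ) := by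
      rw [mem_Icc]
      omega
    have e1 := hB _ hm
    have e2 := hB' _ hm
    dsimp only at e1 e2
    rw [show -1 * (t' - t) + 2 * t' = 1 * (t' - t) + 2 * t by ring] at e2
    have := letterSign_ne_zero (ρ (t' - t))
    omega
  · have h1 : (t : ℝ) - t' < 2 * D := by linarith
    have h2 : -(2 * D : ℝ) < t - t' := by linarith
    norm_cast at h1 h2
    have hm : t - t' ∈ Icc (-((R₀ + 2 * D + S : ℕ) : ℤ)) (R₀ + 2 * D + S : ℕ) := by
      rw [mem_Icc]
      omega
    have e1 := hB _ hm
    have e2 := hB' _ hm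
    dsimp only at e1 e2
    rw [show -1 * (t - t') + 2 * t = 1 * (t - t') + 2 * t' by ring] at e1
    have := letterSign_ne_zero (ρ (t - t'))
    omega
  · refine ⟨rfl, ?_⟩
    by_contra hne
    have h1 : (t : ℝ) - t' < 2 * D := by linarith
    have h2 : (t' : ℝ) - t < 2 * D := by linarith
    norm_cast at h1 h2
    refine hcontra (t' - t) (by omega) (by omega) (by omega) fun m hm hm' => ?_
    have e1 := hB m hm
    have e2 := hB' _ hm'
    dsimp only at e1 e2
    rw [show -1 * (m + 2 * (t' - t)) + 2 * t' = -1 * m + 2 * t by ring] at e2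
    omega

/-! ### Making an element trivial near the occurrences of a word -/

/-- A germ at `0` is the germ of a commutator. -/
theorem IsBump.exists_commutator_germ {c f : ℝ ≃o ℝ} (hc : IsBump c) (hf : IsPL f) {D : ℝ}
    (h1 : -D < f 0) (h2 : f 0 < D) : ∃ α ∈ plc (-D - 1) (D + 1), ∃ β ∈ plc (-D - 1) (D + 1),
      ∀ᶠ z in 𝓝 0, ⁅α, β⁆ z = f z := by
  have hD : 0 < D := by linarith
  obtain ⟨α, hα, hαf⟩ := hc.exists_eventuallyEq hf (by simpa using IsDyadic.intCast 0)
    (a := -D) (b := D) (x := 0) ⟨by linarith, hD⟩ ⟨h1, h2⟩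
  obtain ⟨β, hβ, hβD⟩ := hc.exists_lt_apply_of_mem (a := -D - 1) (b := D + 1) (x := -D) (y := D)
    ⟨by linarith, by linarith⟩ ⟨by linarith, by linarith⟩
  -- `β⁻¹` sends a neighbourhood of `0` to the left of the support of `α`, so the inner `α⁻¹` does
  -- nothing and `⁅α, β⁆` acts as `α`.
  refine ⟨α, plc_mono (by linarith) (by linarith) hα, β, hβ, ?_⟩
  filter_upwards [hαf, Iio_mem_nhds hD] with z hz hzD
  have h3 : β⁻¹ z < -D := by
    rw [← β.lt_iff_lt, RelIso.apply_inv_self]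
    exact lt_trans hzD hβD
  have h4 : α⁻¹ (β⁻¹ z) = β⁻¹ z :=
    plc_le_suppGroup (inv_mem hα) _ fun h => absurd h.1 (not_lt.2 h3.le)
  simp only [commutatorElement_def, RelIso.mul_apply]
  rw [h4, RelIso.apply_inv_self, hz]

section

variable {ρ : ℤ → Letter} {c₀ ν₂ ν₃ : I ≃o I}

theorem exists_commutator_eq_near (hρ : IsQuasiPeriodic ρ) (h : IsAdmissible c₀ ν₂ ν₃)
    {f : ℝ ≃o ℝ} (hf : f ∈ groupG ρ c₀ ν₂ ν₃) :
    ∃ a ∈ groupG ρ c₀ ν₂ ν₃, ∃ b ∈ groupG ρ c₀ ν₂ ν₃, ∃ R : ℕ, ∀ s t : ℤ,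
      Matches (fun m => letterSign (ρ m)) (Icc (-(R : ℤ)) R) s t →
      ∀ᶠ z in 𝓝 (t : ℝ), ⁅a, b⁆ z = f z := by
  obtain ⟨r, d, hloc, -⟩ := groupG_le_localGroup hf
  obtain ⟨D, hD⟩ := exists_nat_gt |f 0|
  obtain ⟨h1, h2⟩ := abs_lt.1 hD
  obtain ⟨r', hr'⟩ := exists_nat_gt r
  -- In the lower bound for `R`, `2 * D + 2` makes the block cover `(-D - 1, D + 1)`, and `2 * r' +
  -- 2` covers what `f` sees from points within `1 / 2` of `0`.
  obtain ⟨R, hR, hsep⟩ := hρ.exists_separates (D + 1) (2 * D + 2 + (2 * r' + 2))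
  obtain ⟨α, hα, β, hβ, hαβ⟩ :=
    h.isBump.exists_commutator_germ (h.groupG_le_plGroup hf) h1 h2
  have hle := plc_le_spreadGroup (G := groupG ρ c₀ ν₂ ν₃) (e := fun m => letterSign (ρ m))
    h.isBump (fun m => letterSign_ne_zero _) (fun a b hab => h.plc_le_commutator hab)
    h.plc_le_spreadGroup_singleton (i := -(R : ℤ)) (j := R) (p := -(D + 1 : ℤ)) (q := D + 1)
    (by omega) (by omega) (by omega) (by
      push_cast at hsep ⊢
      exact hsep)
  push_cast at hle
  rw [show -((D : ℝ) + 1) = -D - 1 by ring] at hle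
  obtain ⟨hα', a, ha, hsa⟩ := hle hα
  obtain ⟨hβ', b, hb, hsb⟩ := hle hβ
  refine ⟨a, ha, b, hb, R, fun s t hst => ?_⟩
  have hcom := ((hsa.mul hsb hβ').mul (hsa.inv hα') (inv_mem hα')).mul (hsb.inv hβ') (inv_mem hβ')
  have hs : (s : ℝ) * s = 1 := by
    rcases hst.1 with rfl | rfl <;> norm_num
  have ht : Tendsto (fun z : ℝ => s * (z - t)) (𝓝 (t : ℝ)) (𝓝 0) := by
    have : Continuous fun z : ℝ => s * (z - t) := by fun_prop
    simpa using this.tendsto (t : ℝ)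
  have hD0 : (0 : ℝ) ≤ D := by positivity
  filter_upwards [ht.eventually hαβ,
    ht.eventually (Ioo_mem_nhds (show (-1 / 2 : ℝ) < 0 by norm_num) one_half_pos)] with z hz1 hz2
  set x := (s : ℝ) * (z - t) with hx
  have hzx : z = s * x + t := by rw [hx, ← mul_assoc, hs]; ring
  rw [hzx, hloc s t x (hst.mono fun m (hm : |(m : ℝ) / 2 - x| ≤ r) => ?_), ← hz1]
  · exact hcom.inside s t hst x ⟨by linarith [hz2.1], by linarith [hz2.2]⟩
  · obtain ⟨h3, h4⟩ := abs_le.1 hm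
    have hR' : (2 * D + 2 + (2 * r' + 2) : ℝ) ≤ R := by exact_mod_cast hR
    have h5 : (m : ℝ) ≤ R := by linarith [hz2.2]
    have h6 : -(R : ℝ) ≤ m := by linarith [hz2.1]
    exact ⟨by exact_mod_cast h6, by exact_mod_cast h5⟩

end

/-! ### Spreading families of homeomorphisms -/

/-- The version of `SpreadsOn` for a family of homeomorphisms. -/
structure FamSpreads {ι : Type*} (e : ℤ → ℤ) (B : ι → Set ℤ) (K : ι → Set ℝ) (h : ι → (ℝ ≃o ℝ))
    (g : ℝ ≃o ℝ) : Prop where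
  inside : ∀ (i : ι) (s t : ℤ), Matches e (B i) s t → ∀ x ∈ K i, g (s * x + t) = s * h i x + t
  outside : ∀ y : ℝ, (∀ (i : ι) (s t : ℤ), Matches e (B i) s t → ∀ x ∈ K i, y ≠ s * x + t) → g y = y

/-- The images of the sets `K i` under the isometries which match on `B i` are disjoint. -/
def FamSeparates {ι : Type*} (e : ℤ → ℤ) (B : ι → Set ℤ) (K : ι → Set ℝ) : Prop :=
  ∀ (i j : ι) (s t s' t' : ℤ), Matches e (B i) s t → Matches e (B j) s' t' → ∀ x ∈ K i, ∀ x' ∈ K j,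
    (s * x + t : ℝ) = s' * x' + t' → i = j ∧ s = s' ∧ t = t'

namespace FamSpreads

variable {ι : Type*} {e : ℤ → ℤ} {B : ι → Set ℤ} {K : ι → Set ℝ} {h h' : ι → (ℝ ≃o ℝ)}
  {g g' : ℝ ≃o ℝ}

theorem mul (H : FamSpreads e B K h g) (H' : FamSpreads e B K h' g')
    (hK : ∀ i, h' i ∈ suppGroup (K i)) : FamSpreads e B K (h * h') (g * g') where
  inside i s t hst x hx := by
    rw [RelIso.mul_apply, H'.inside i s t hst x hx,
      H.inside i s t hst _ (apply_mem_of_mem_suppGroup (hK i) hx), Pi.mul_apply, RelIso.mul_apply]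
  outside y hy := by rw [RelIso.mul_apply, H'.outside y hy, H.outside y hy]

theorem one : FamSpreads e B K 1 1 := ⟨fun _ _ _ _ _ _ => rfl, fun _ _ => rfl⟩

theorem inv (H : FamSpreads e B K h g) (hK : ∀ i, h i ∈ suppGroup (K i)) :
    FamSpreads e B K h⁻¹ g⁻¹ where
  inside i s t hst x hx := by
    have := H.inside i s t hst _ (apply_mem_of_mem_suppGroup (inv_mem (hK i)) hx)
    rw [RelIso.apply_inv_self] at this
    rw [← this, RelIso.inv_apply_self, Pi.inv_apply]
  outside y hy := inv_apply_eq_self (H.outside y hy)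

theorem commutator (H : FamSpreads e B K h g) (H' : FamSpreads e B K h' g')
    (hK : ∀ i, h i ∈ suppGroup (K i)) (hK' : ∀ i, h' i ∈ suppGroup (K i)) :
    FamSpreads e B K ⁅h, h'⁆ ⁅g, g'⁆ :=
  ((H.mul H' hK').mul (H.inv hK) fun i => inv_mem (hK i)).mul (H'.inv hK') fun i => inv_mem (hK' i)

theorem unique (H : FamSpreads e B K h g) (H' : FamSpreads e B K h g') : g = g' := by
  ext y
  by_cases hy : ∀ (i : ι) (s t : ℤ), Matches e (B i) s t → ∀ x ∈ K i, y ≠ s * x + t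
  · rw [H.outside y hy, H'.outside y hy]
  · push Not at hy
    obtain ⟨i, s, t, hst, x, hx, rfl⟩ := hy
    rw [H.inside i s t hst x hx, H'.inside i s t hst x hx]

end FamSpreads

/-- The families which can be spread to an element of `G`. -/
def famGroup {ι : Type*} (G : Subgroup (ℝ ≃o ℝ)) (e : ℤ → ℤ) (B : ι → Set ℤ) (K : ι → Set ℝ) :
    Subgroup (ι → (ℝ ≃o ℝ)) where
  carrier := {h | (∀ i, h i ∈ suppGroup (K i)) ∧ ∃ g ∈ G, FamSpreads e B K h g}
  mul_mem' := by
    rintro h h' ⟨hK, g, hg, H⟩ ⟨hK', g', hg', H'⟩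
    exact ⟨fun i => mul_mem (hK i) (hK' i), g * g', mul_mem hg hg', H.mul H' hK'⟩
  one_mem' := ⟨fun i => one_mem _, 1, one_mem _, FamSpreads.one⟩
  inv_mem' := by
    rintro h ⟨hK, g, hg, H⟩
    exact ⟨fun i => inv_mem (hK i), g⁻¹, inv_mem hg, H.inv hK⟩

/-- Copies belonging to different members are disjoint, so the spread of one member is trivial on
the copies of all the others. -/
theorem mulSingle_mem_famGroup {ι : Type*} [DecidableEq ι] {G : Subgroup (ℝ ≃o ℝ)} {e : ℤ → ℤ}
    {B : ι → Set ℤ} {K : ι → Set ℝ} (hsep : FamSeparates e B K) {i : ι} {k : ℝ ≃o ℝ}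
    (hk : k ∈ spreadGroup G e (B i) (K i)) : Pi.mulSingle i k ∈ famGroup G e B K := by
  obtain ⟨hK, g, hg, H⟩ := hk
  refine ⟨fun j => ?_, g, hg, fun j s t hst x hx => ?_, fun y hy => H.outside y (hy i)⟩
  · by_cases hj : j = i
    · subst hj
      rwa [Pi.mulSingle_eq_same]
    · rw [Pi.mulSingle_eq_of_ne hj]
      exact one_mem _
  · by_cases hj : j = i
    · subst hj
      rw [Pi.mulSingle_eq_same]
      exact H.inside s t hst x hx
    · rw [Pi.mulSingle_eq_of_ne hj]
      exact H.outside _ fun s' t' hst' x' hx' heq =>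
        hj (hsep j i s t s' t' hst hst' x hx x' hx' heq).1

/-! ### Cells -/

/-- `(p, q)` is a cell of `P` if `p < q` are consecutive elements of `P`. -/
structure IsCell (P : Set ℤ) (c : ℤ × ℤ) : Prop where
  left_mem : c.1 ∈ P
  right_mem : c.2 ∈ P
  lt : c.1 < c.2
  gap : ∀ r ∈ P, r ≤ c.1 ∨ c.2 ≤ r

/-- The block around the interval `[p, q]`. -/
def cellBlock (r : ℕ) (c : ℤ × ℤ) : Set ℤ := Icc (2 * c.1 - r) (2 * c.2 + r)

/-- The isometry `x ↦ s x + t` maps `c` to `c'` and matches around `c`. -/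
structure CellIso (e : ℤ → ℤ) (r : ℕ) (c c' : ℤ × ℤ) (s t : ℤ) : Prop where
  matches_block : Matches e (cellBlock r c) s t
  midpoint : c'.1 + c'.2 = s * (c.1 + c.2) + 2 * t
  length : c'.2 - c'.1 = c.2 - c.1

theorem Matches.symm {e : ℤ → ℤ} {B B' : Set ℤ} {s t : ℤ} (h : Matches e B s t)
    (hB : ∀ m ∈ B', s * m + 2 * -(s * t) ∈ B) : Matches e B' s (-(s * t)) := by
  refine ⟨h.1, fun m hm => ?_⟩
  have h1 := h.2 _ (hB m hm)
  rcases h.1 with rfl | rfl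
  · rw [show 1 * (1 * m + 2 * -(1 * t)) + 2 * t = m by ring] at h1
    omega
  · rw [show -1 * (-1 * m + 2 * -(-1 * t)) + 2 * t = m by ring] at h1
    omega

theorem Matches.comp {e : ℤ → ℤ} {B B' : Set ℤ} {s t s' t' : ℤ} (h : Matches e B s t)
    (h' : Matches e B' s' t') (hB : ∀ m ∈ B, s * m + 2 * t ∈ B') :
    Matches e B (s' * s) (s' * t + t') := by
  refine ⟨?_, fun m hm => ?_⟩
  · rcases h.1 with rfl | rfl <;> rcases h'.1 with rfl | rfl <;> simp
  · have h1 := h'.2 _ (hB m hm)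
    rw [h.2 m hm] at h1
    rw [mul_assoc s' s (e m), ← h1]
    congr 1
    ring

namespace CellIso

variable {e : ℤ → ℤ} {r : ℕ} {c c' c'' : ℤ × ℤ} {s t s' t' : ℤ}

theorem mapsTo (h : CellIso e r c c' s t) {m : ℤ} (hm : m ∈ cellBlock r c) :
    s * m + 2 * t ∈ cellBlock r c' := by
  have h1 := h.midpoint
  have h2 := h.length
  simp only [cellBlock, mem_Icc] at hm ⊢
  rcases h.matches_block.1 with rfl | rfl <;> constructor <;> omega

theorem refl (c : ℤ × ℤ) : CellIso e r c c 1 0 := ⟨Matches.one _ _, by ring, rfl⟩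

theorem symm (h : CellIso e r c c' s t) : CellIso e r c' c s (-(s * t)) := by
  have h1 := h.midpoint
  have h2 := h.length
  refine ⟨h.matches_block.symm fun m hm => ?_, ?_, h2.symm⟩
  · simp only [cellBlock, mem_Icc] at hm ⊢
    rcases h.matches_block.1 with rfl | rfl <;> constructor <;> omega
  · rcases h.matches_block.1 with rfl | rfl <;> omega

theorem trans (h : CellIso e r c c' s t) (h' : CellIso e r c' c'' s' t') :
    CellIso e r c c'' (s' * s) (s' * t + t') := by
  refine ⟨h.matches_block.comp h'.matches_block fun m hm => h.mapsTo hm, ?_, ?_⟩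
  · rw [h'.midpoint, h.midpoint]
    ring
  · rw [h'.length, h.length]

theorem mem_Ioo (h : CellIso e r c c' s t) {x : ℝ} (hx : x ∈ Ioo (c.1 : ℝ) c.2) :
    (s * x + t : ℝ) ∈ Ioo (c'.1 : ℝ) c'.2 := by
  have h1 := h.midpoint
  have h2 := h.length
  rcases h.matches_block.1 with rfl | rfl
  · have h3 : c'.1 = c.1 + t := by omega
    have h4 : c'.2 = c.2 + t := by omega
    rw [h3, h4]
    push_cast
    exact ⟨by linarith [hx.1], by linarith [hx.2]⟩
  · have h3 : c'.1 = -c.2 + t := by omega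
    have h4 : c'.2 = -c.1 + t := by omega
    rw [h3, h4]
    push_cast
    exact ⟨by linarith [hx.2], by linarith [hx.1]⟩

/-- A reflection of the cell to itself would fix its midpoint, which has index `c.1 + c.2`, and
would reverse the sign there. -/
theorem eq_one_zero (h : CellIso e r c c s t) (he : ∀ m, e m ≠ 0) (hc : c.1 < c.2) :
    s = 1 ∧ t = 0 := by
  have h1 := h.midpoint
  rcases h.matches_block.1 with rfl | rfl
  · exact ⟨rfl, by omega⟩
  · exfalso
    have h2 := h.matches_block.2 (c.1 + c.2) (by
      simp only [cellBlock, mem_Icc]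
      omega)
    rw [← h1] at h2
    have := he (c.1 + c.2)
    omega

end CellIso

/-- The positions of the occurrences of the central word of radius `R`, up to formal inversion. -/
def centers (e : ℤ → ℤ) (R : ℕ) : Set ℤ := {p | ∃ s, Matches e (Icc (-(R : ℤ)) R) s p}

theorem apply_mem_centers {e : ℤ → ℤ} {R : ℕ} {p s t : ℤ} (hp : p ∈ centers e R)
    (h : Matches e (Icc (2 * p - R) (2 * p + R)) s t) : s * p + t ∈ centers e R := by
  obtain ⟨s', hs'⟩ := hp
  refine ⟨s * s', hs'.comp h fun m hm => ?_⟩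
  rw [mem_Icc] at hm ⊢
  rcases hs'.1 with rfl | rfl <;> constructor <;> omega

/-- Since `R ≤ r`, the block around the cell shows which of its integer points are centers. The
isometry and its inverse therefore preserve centers there, and consecutive centers remain
consecutive. -/
theorem IsCell.exists_cellIso {e : ℤ → ℤ} {R r : ℕ} (hR : R ≤ r) {c : ℤ × ℤ} {s t : ℤ}
    (hc : IsCell (centers e R) c) (h : Matches e (cellBlock r c) s t) :
    ∃ c', IsCell (centers e R) c' ∧ CellIso e r c c' s t := by
  have hlt := hc.lt
  have h1 := apply_mem_centers hc.left_mem (h.mono (Icc_subset_Icc (by omega) (by omega)))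
  have h2 := apply_mem_centers hc.right_mem (h.mono (Icc_subset_Icc (by omega) (by omega)))
  have hpre : ∀ u ∈ centers e R, (∃ v, s * v + t = u ∧ c.1 < v ∧ v < c.2) → False := by
    rintro u hu ⟨v, hv, hv1, hv2⟩
    have hsymm : Matches e (Icc (2 * u - R) (2 * u + R)) s (-(s * t)) := by
      refine h.symm fun m hm => ?_
      simp only [cellBlock, mem_Icc] at hm ⊢
      rcases h.1 with rfl | rfl <;> constructor <;> omega
    have h3 := apply_mem_centers hu hsymm
    have h4 : s * u + -(s * t) = v := by
      rcases h.1 with rfl | rfl <;> omega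
    rw [h4] at h3
    have := hc.gap v h3
    omega
  rcases h.1 with rfl | rfl
  · refine ⟨(c.1 + t, c.2 + t), ⟨by simpa using h1, by simpa using h2, by simpa using hlt,
      fun u hu => ?_⟩, ⟨h, by dsimp only; ring, by dsimp only; ring⟩⟩
    by_contra hcon
    exact hpre u hu ⟨u - t, by ring, by omega, by omega⟩
  · refine ⟨(-c.2 + t, -c.1 + t), ⟨by simpa using h2, by simpa using h1, by dsimp only; omega,
      fun u hu => ?_⟩, ⟨h, by dsimp only; ring, by dsimp only; ring⟩⟩
    by_contra hcon
    exact hpre u hu ⟨t - u, by ring, by omega, by omega⟩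

theorem IsCell.eq_of_mem {P : Set ℤ} {c c' : ℤ × ℤ} (hc : IsCell P c) (hc' : IsCell P c') {x : ℝ}
    (hx : x ∈ Ioo (c.1 : ℝ) c.2) (hx' : x ∈ Ioo (c'.1 : ℝ) c'.2) : c = c' := by
  have h1 : c.1 < c'.2 := by exact_mod_cast hx.1.trans hx'.2
  have h2 : c'.1 < c.2 := by exact_mod_cast hx'.1.trans hx.2
  have h3 := hc.gap _ hc'.left_mem
  have h4 := hc.gap _ hc'.right_mem
  have h5 := hc'.gap _ hc.left_mem
  have h6 := hc'.gap _ hc.right_mem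
  ext <;> omega

theorem exists_mem_or_isCell {P : Set ℤ} {N : ℕ} (hP : ∀ k : ℤ, ∃ p ∈ P, k ≤ p ∧ p ≤ k + N) (y : ℝ) :
    (∃ p ∈ P, (p : ℝ) = y) ∨ ∃ c, IsCell P c ∧ y ∈ Ioo (c.1 : ℝ) c.2 := by
  obtain ⟨p, ⟨hp1, hp2⟩, hp3⟩ := Int.exists_greatest_of_bdd (P := fun p => p ∈ P ∧ p ≤ ⌊y⌋)
    ⟨⌊y⌋, fun z hz => hz.2⟩ (by
      obtain ⟨p, hp, -, h⟩ := hP (⌊y⌋ - N)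
      exact ⟨p, hp, by omega⟩)
  obtain ⟨q, ⟨hq1, hq2⟩, hq3⟩ := Int.exists_least_of_bdd (P := fun q => q ∈ P ∧ ⌊y⌋ < q)
    ⟨⌊y⌋, fun z hz => hz.2.le⟩ (by
      obtain ⟨p, hp, h, -⟩ := hP (⌊y⌋ + 1)
      exact ⟨p, hp, by omega⟩)
  rcases (Int.le_floor.1 hp2).eq_or_lt with h | h
  · exact Or.inl ⟨p, hp1, h⟩
  · refine Or.inr ⟨(p, q), ⟨hp1, hq1, by dsimp only; omega, fun r hr => ?_⟩, h, Int.floor_lt.1 hq2⟩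
    rcases le_or_gt r ⌊y⌋ with hr' | hr'
    · exact Or.inl (hp3 r ⟨hr, hr'⟩)
    · exact Or.inr (hq3 r ⟨hr, hr'⟩)

theorem IsCell.length_le {P : Set ℤ} {N : ℕ}
    (hP : ∀ k : ℤ, ∃ p ∈ P, k ≤ p ∧ p ≤ k + N) {c : ℤ × ℤ}
    (hc : IsCell P c) : c.2 - c.1 ≤ N + 1 := by
  obtain ⟨p, hp, h1, h2⟩ := hP (c.1 + 1)
  rcases hc.gap p hp with h | h <;> omega

/-- Two cells are equivalent if some matching isometry maps one to the other. -/
def cellSetoid (e : ℤ → ℤ) (r : ℕ) (P : Set ℤ) : Setoid {c : ℤ × ℤ // IsCell P c} where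
  r c c' := ∃ s t, CellIso e r c.1 c'.1 s t
  iseqv :=
    { refl := fun _ => ⟨1, 0, CellIso.refl _⟩
      symm := fun ⟨_, _, h⟩ => ⟨_, _, h.symm⟩
      trans := fun ⟨_, _, h⟩ ⟨_, _, h'⟩ => ⟨_, _, h.trans h'⟩ }

/-- Cells have length at most `N + 1`, and the length with the signs read around a cell determines
its class, already through translations. -/
theorem finite_cellSetoid {e : ℤ → ℤ} (he : ∀ m, e m = 1 ∨ e m = -1) (r : ℕ) {P : Set ℤ} {N : ℕ}
    (hP : ∀ k : ℤ, ∃ p ∈ P, k ≤ p ∧ p ≤ k + N) : Finite (Quotient (cellSetoid e r P)) := by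
  -- The block of a cell has at most `2 * (N + 1) + 2 * r + 1` indices; shorter blocks are simply
  -- read past their end.
  let F : {c : ℤ × ℤ // IsCell P c} → Fin (N + 2) × (Fin (2 * N + 2 * r + 3) → Bool) := fun c =>
    (⟨(c.1.2 - c.1.1).toNat, by have := c.2.length_le hP; omega⟩,
      fun k => decide (e (2 * c.1.1 - r + k) = 1))
  refine Finite.of_injective (fun i : Quotient (cellSetoid e r P) => F i.out) fun i j hij => ?_
  obtain ⟨h1, h2⟩ := Prod.mk.inj hij
  have h1' := Fin.mk.inj_iff.1 h1
  have hi := i.out.2.lt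
  have hj := j.out.2.lt
  have hlen := i.out.2.length_le hP
  rw [← Quotient.out_eq i, ← Quotient.out_eq j]
  refine Quotient.sound ⟨1, j.out.1.1 - i.out.1.1, ⟨Or.inl rfl, fun m hm => ?_⟩, by omega, by omega⟩
  simp only [cellBlock, mem_Icc] at hm
  have h3 := congrFun h2 ⟨(m - (2 * i.out.1.1 - r)).toNat, by omega⟩
  dsimp only at h3
  rw [decide_eq_decide, Int.toNat_of_nonneg (by omega), add_sub_cancel,
    show 2 * j.out.1.1 - (r : ℤ) + (m - (2 * i.out.1.1 - r)) =
      1 * m + 2 * (j.out.1.1 - i.out.1.1) by ring] at h3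
  rcases he m with h4 | h4 <;> rcases he (1 * m + 2 * (j.out.1.1 - i.out.1.1)) with h5 | h5 <;>
    rw [h4, h5] at h3 ⊢ <;> simp at h3 ⊢

/-! ### Elements which are trivial near the centers -/

theorem exists_restriction {f : ℝ ≃o ℝ} (hf : IsPL f) {p q : ℤ} (hpq : p < q)
    (hp : ∀ᶠ z in 𝓝 (p : ℝ), f z = z) (hq : ∀ᶠ z in 𝓝 (q : ℝ), f z = z) :
    ∃ h ∈ plc p q, ∀ x ∈ Icc (p : ℝ) q, h x = f x := by
  have hpq' : (p : ℝ) < q := by exact_mod_cast hpq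
  obtain ⟨u, hu, hu1, hu2⟩ := exists_truncation hf (IsDyadic.intCast q) hq.self_of_nhds
  have hup : u p = p := by rw [hu1 p hpq'.le, hp.self_of_nhds]
  obtain ⟨v, hv, hv1, hv2⟩ := exists_truncation hu (IsDyadic.intCast p) hup
  have h1 : ∀ x, (p : ℝ) ≤ x → (u * v⁻¹) x = u x := fun x hx => by
    rw [RelIso.mul_apply, inv_apply_eq_self (hv2 x hx)]
  have h2 : ∀ x ≤ (p : ℝ), (u * v⁻¹) x = x := by
    intro x hx
    have h3 : v⁻¹ x ≤ p := by
      rw [← inv_apply_eq_self (hv2 p le_rfl)]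
      exact (v⁻¹ : ℝ ≃o ℝ).monotone hx
    rw [RelIso.mul_apply, ← hv1 _ h3, RelIso.apply_inv_self]
  obtain ⟨a, b, ⟨ha, hb⟩, hab⟩ := mem_nhds_iff_exists_Ioo_subset.1 hp
  obtain ⟨a', b', ⟨ha', hb'⟩, hab'⟩ := mem_nhds_iff_exists_Ioo_subset.1 hq
  obtain ⟨w, hw1, hw2⟩ := exists_between hb
  obtain ⟨w', hw1', hw2'⟩ := exists_between ha'
  refine ⟨u * v⁻¹, ⟨w, w', hw1, hw2', hu.mul hv.inv, fun x hx => ?_⟩,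
    fun x hx => (h1 x hx.1).trans (hu1 x hx.2)⟩
  rcases le_total x p with h | h
  · exact h2 x h
  rw [h1 x h]
  rcases le_total (q : ℝ) x with h' | h'
  · exact hu2 x h'
  rw [hu1 x h']
  by_cases hxw : x < w
  · exact hab ⟨ha.trans_le h, hxw.trans hw2⟩
  · have hxw' : w' < x := by
      by_contra hcon
      exact hx ⟨not_lt.1 hxw, not_lt.1 hcon⟩
    exact hab' ⟨hw1'.trans hxw', h'.trans_lt hb'⟩

theorem commute_of_mem_plOn {a b : ℝ} {x y : ℝ ≃o ℝ} (hx : x ∈ plOn a b)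
    (hy : ∀ z ≤ b, y z = z) : Commute x y := by
  have hsub : ∀ z ≤ b, x z ≤ b := fun z hz => by
    by_cases h : z ∈ Icc a b
    · exact (apply_mem_of_mem_suppGroup hx.2 h).2
    · rwa [hx.2 z h]
  have hyb := hy b le_rfl
  ext z
  rw [RelIso.mul_apply, RelIso.mul_apply]
  rcases le_or_gt z b with h | h
  · rw [hy z h, hy _ (hsub z h)]
  · have h1 : b < y z := by
      rw [← hyb]
      exact y.strictMono h
    rw [hx.2 _ fun h' => absurd h'.2 (not_le.2 h1), hx.2 _ fun h' => absurd h'.2 (not_le.2 h)]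

/-- A family of compactly supported homeomorphisms is a product of two commutators of such
families. -/
theorem IsAdmissible.exists_family_commutators {c₀ ν₂ ν₃ : I ≃o I} (h : IsAdmissible c₀ ν₂ ν₃)
    {ι : Type*} [Finite ι] {p q : ι → ℝ} (hpq : ∀ i, p i < q i) {f : ι → (ℝ ≃o ℝ)}
    (hf : ∀ i, f i ∈ plc (p i) (q i)) :
    ∃ k φ x y : ι → (ℝ ≃o ℝ), (∀ i, k i ∈ plc (p i) (q i)) ∧ (∀ i, φ i ∈ plc (p i) (q i)) ∧
      (∀ i, x i ∈ plc (p i) (q i)) ∧ (∀ i, y i ∈ plc (p i) (q i)) ∧ f = ⁅k, φ⁆ * ⁅x, y⁆ := by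
  classical
  choose a b ha hab hb hmem using fun i => h.exists_mem_commutator (hpq i) (hf i)
  choose φ hφ hφab using fun i => h.isBump.exists_lt_apply_of_mem (a := p i) (b := q i)
    (x := a i) (y := b i) ⟨ha i, (hab i).trans (hb i)⟩ ⟨(ha i).trans (hab i), hb i⟩
  let A : Subgroup (ι → (ℝ ≃o ℝ)) := Subgroup.pi univ fun i => plc (p i) (q i)
  let D : Subgroup (ι → (ℝ ≃o ℝ)) := Subgroup.pi univ fun i => plOn (a i) (b i)
  -- In each coordinate `φ` moves `a i` beyond `b i`, so conjugation by it throws `[a i, b i]`, and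
  -- everything to its right, into the region beyond `b i`.
  let E : Subgroup (ι → (ℝ ≃o ℝ)) :=
    A ⊓ Subgroup.pi univ fun i => suppGroup (Ioi (b i))
  have hφA : φ ∈ A := fun i _ => hφ i
  have hDA : D ≤ A := fun x hx i hi => plOn_le_plc (ha i) (hb i) (hx i hi)
  have hE : ∀ x ∈ E, ∀ i, ∀ z ≤ b i, x i z = z := fun x hx i z hz =>
    hx.2 i (mem_univ i) z (not_lt.2 hz)
  have hφinv : ∀ i, ∀ z ≤ b i, (φ i)⁻¹ z < a i := fun i z hz => by
    rw [← (φ i).lt_iff_lt, RelIso.apply_inv_self]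
    exact hz.trans_lt (hφab i)
  have hconj : ∀ x ∈ A, (∀ i, ∀ z < a i, x i z = z) → φ * x * φ⁻¹ ∈ E := by
    intro x hx hfix
    refine ⟨A.mul_mem (A.mul_mem hφA hx) (A.inv_mem hφA), fun i _ z hz => ?_⟩
    simp only [Pi.mul_apply, Pi.inv_apply, RelIso.mul_apply]
    rw [hfix i _ (hφinv i z (not_lt.1 hz)), RelIso.apply_inv_self]
  -- The coordinates may need different numbers of commutators; finiteness of `ι` lets them be
  -- treated one at a time.
  have hfD : f ∈ ⁅D, D⁆ := by
    refine Subgroup.pi_mem_of_mulSingle_mem _ fun i => ?_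
    have h1 := Subgroup.mem_map_of_mem (MonoidHom.mulSingle (fun _ : ι => ℝ ≃o ℝ) i) (hmem i)
    rw [Subgroup.map_commutator] at h1
    have hle : (plOn (a i) (b i)).map (MonoidHom.mulSingle (fun _ : ι => ℝ ≃o ℝ) i) ≤ D := by
      rintro _ ⟨g, hg, rfl⟩ j -
      change (Pi.mulSingle i g : ι → (ℝ ≃o ℝ)) j ∈ _
      by_cases hj : j = i
      · subst hj
        rwa [Pi.mulSingle_eq_same]
      · rw [Pi.mulSingle_eq_of_ne hj]
        exact (plOn (a j) (b j)).one_mem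
    exact Subgroup.commutator_mono hle hle h1
  obtain ⟨k, hk, x, hx, y, hy, hfk⟩ := exists_eq_commutator_mul_commutator hφA hDA
    (E := E) (fun x hx y hy => by
      funext i
      exact commute_of_mem_plOn (hx i (mem_univ i)) (hE y hy i))
    (fun x hx => hconj x (hDA hx) fun i z hz =>
      (hx i (mem_univ i)).2 z fun h' => absurd h'.1 (not_le.2 hz))
    (fun x hx => hconj x hx.1 fun i z hz => hE x hx i z (hz.trans (hab i)).le) hfD
  exact ⟨k, φ, x, y, fun i => hk i (mem_univ i), hφ, fun i => hx.1 i (mem_univ i),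
    fun i => hy.1 i (mem_univ i), hfk⟩

section

variable {ρ : ℤ → Letter} {c₀ ν₂ ν₃ : I ≃o I}

/-- Being trivial near the centers, `f` restricts to a compactly supported map on each cell. By
locality these restrictions agree along matching isometries, so `f` is the spread of its
restrictions to finitely many representative cells, and an identity between families spreads to one
in `G_ρ`. -/
theorem exists_eq_two_commutators (hρ : IsQuasiPeriodic ρ) (h : IsAdmissible c₀ ν₂ ν₃)
    {f : ℝ ≃o ℝ} (hf : f ∈ groupG ρ c₀ ν₂ ν₃) {R : ℕ}
    (hR : ∀ p ∈ centers (fun m => letterSign (ρ m)) R, ∀ᶠ z in 𝓝 (p : ℝ), f z = z) :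
    ∃ k ∈ groupG ρ c₀ ν₂ ν₃, ∃ φ ∈ groupG ρ c₀ ν₂ ν₃, ∃ x ∈ groupG ρ c₀ ν₂ ν₃,
      ∃ y ∈ groupG ρ c₀ ν₂ ν₃, f = ⁅k, φ⁆ * ⁅x, y⁆ := by
  classical
  set e : ℤ → ℤ := fun m => letterSign (ρ m) with he
  have he0 : ∀ m, e m ≠ 0 := fun m => letterSign_ne_zero _
  obtain ⟨N, hN⟩ := hρ.exists_matches R
  set P := centers e R with hPdef
  have hP : ∀ k : ℤ, ∃ p ∈ P, k ≤ p ∧ p ≤ k + N := fun k => by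
    obtain ⟨t, h1, h2, h3⟩ := hN k
    exact ⟨t, ⟨1, h3⟩, h1, h2⟩
  obtain ⟨r₀, -, hloc, -⟩ := groupG_le_localGroup hf
  obtain ⟨r₁, hr₁⟩ := exists_nat_gt r₀
  -- Radius `R` is needed to recognise centers near a cell, and `2 * r₁` to see everything that
  -- governs `f` on it.
  set r := R + 2 * r₁ with hr
  have := finite_cellSetoid (e := e) (fun m => letterSign_eq _) r hP
  let ι := Quotient (cellSetoid e r P)
  let cell : ι → ℤ × ℤ := fun i => i.out.1
  have hcell : ∀ i, IsCell P (cell i) := fun i => i.out.2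
  let B : ι → Set ℤ := fun i => cellBlock r (cell i)
  let K : ι → Set ℝ := fun i => Ioo ((cell i).1 : ℝ) (cell i).2
  -- Images of representative cells are cells, so overlapping images coincide. Then the
  -- representatives are equivalent, hence equal, and no nontrivial isometry matches a cell with
  -- itself.
  have hsep : FamSeparates e B K := by
    intro i j s t s' t' hst hst' x hx x' hx' heq
    obtain ⟨c, hc, hic⟩ := (hcell i).exists_cellIso (by omega) hst
    obtain ⟨c', hc', hjc⟩ := (hcell j).exists_cellIso (by omega) hst'
    have hcc : c = c' := hc.eq_of_mem hc' (hic.mem_Ioo hx) (heq ▸ hjc.mem_Ioo hx')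
    subst hcc
    have hij : i = j := by
      rw [← Quotient.out_eq i, ← Quotient.out_eq j]
      exact Quotient.sound ⟨_, _, hic.trans hjc.symm⟩
    subst hij
    obtain ⟨h1, h2⟩ := (hic.trans hjc.symm).eq_one_zero he0 (hcell i).lt
    refine ⟨rfl, ?_⟩
    rcases hst.1 with rfl | rfl <;> rcases hst'.1 with rfl | rfl <;> omega
  choose g hg hgf using fun i => exists_restriction (h.groupG_le_plGroup hf) (hcell i).lt
    (hR _ (hcell i).left_mem) (hR _ (hcell i).right_mem)
  have hspread : FamSpreads e B K g f := by
    refine ⟨fun i s t hst x hx => ?_, fun y hy => ?_⟩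
    · rw [hgf i x ⟨hx.1.le, hx.2.le⟩]
      refine hloc s t x (hst.mono fun m (hm : |(m : ℝ) / 2 - x| ≤ r₀) => ?_)
      obtain ⟨h1, h2⟩ := abs_le.1 hm
      have h3 : (m : ℝ) ≤ 2 * (cell i).2 + 2 * r₁ := by linarith [hx.2]
      have h4 : (2 * (cell i).1 - 2 * r₁ : ℝ) ≤ m := by linarith [hx.1]
      norm_cast at h3 h4
      simp only [B, cellBlock, mem_Icc]
      push_cast at h3 h4 ⊢
      constructor <;> omega
    · rcases exists_mem_or_isCell hP y with ⟨p, hp, rfl⟩ | ⟨c, hc, hyc⟩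
      · exact (hR p hp).self_of_nhds
      · exfalso
        obtain ⟨s, t, hst⟩ := Quotient.mk_out (s := cellSetoid e r P) ⟨c, hc⟩
        set i : ι := Quotient.mk (cellSetoid e r P) ⟨c, hc⟩ with hi
        have hinv := hst.symm.mem_Ioo hyc
        refine hy i s t hst.matches_block _ hinv ?_
        push_cast
        rcases hst.matches_block.1 with h1 | h1 <;> rw [h1] <;> push_cast <;> ring
  have hle : ∀ k : ι → (ℝ ≃o ℝ), (∀ i, k i ∈ plc ((cell i).1 : ℝ) (cell i).2) →
      k ∈ famGroup (groupG ρ c₀ ν₂ ν₃) e B K := by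
    intro k hk
    refine Subgroup.pi_mem_of_mulSingle_mem _ fun i => mulSingle_mem_famGroup hsep ?_
    exact plc_le_spreadGroup h.isBump he0 (fun a b hab => h.plc_le_commutator hab)
      h.plc_le_spreadGroup_singleton (hcell i).lt (by omega) (by omega)
      (fun s t s' t' hst hst' x hx x' hx' heq =>
        (hsep i i s t s' t' hst hst' x hx x' hx' heq).2) (hk i)
  obtain ⟨k, φ, x, y, hk, hφ, hx, hy, hgk⟩ := h.exists_family_commutators
    (p := fun i => ((cell i).1 : ℝ)) (q := fun i => ((cell i).2 : ℝ))
    (fun i => by exact_mod_cast (hcell i).lt) hg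
  obtain ⟨hk', k', hkG, hks⟩ := hle k hk
  obtain ⟨hφ', φ', hφG, hφs⟩ := hle φ hφ
  obtain ⟨hx', x', hxG, hxs⟩ := hle x hx
  obtain ⟨hy', y', hyG, hys⟩ := hle y hy
  refine ⟨k', hkG, φ', hφG, x', hxG, y', hyG, ?_⟩
  rw [hgk] at hspread
  exact hspread.unique ((hks.commutator hφs hk' hφ').mul (hxs.commutator hys hx' hy') fun i =>
    mul_mem (mul_mem (mul_mem (hx' i) (hy' i)) (inv_mem (hx' i))) (inv_mem (hy' i)))

theorem isProdOfCommutators_three (hρ : IsQuasiPeriodic ρ) (h : IsAdmissible c₀ ν₂ ν₃)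
    (f : groupG ρ c₀ ν₂ ν₃) : IsProdOfCommutators 3 f := by
  obtain ⟨f, hf⟩ := f
  obtain ⟨a, ha, b, hb, R, hab⟩ := exists_commutator_eq_near hρ h hf
  have hmem : ⁅a, b⁆ ∈ groupG ρ c₀ ν₂ ν₃ :=
    mul_mem (mul_mem (mul_mem ha hb) (inv_mem ha)) (inv_mem hb)
  obtain ⟨k, hk, φ, hφ, x, hx, y, hy, heq⟩ := exists_eq_two_commutators hρ h
    (mul_mem (inv_mem hmem) hf) (R := R) (fun p ⟨s, hs⟩ => by
      filter_upwards [hab s p hs] with z hz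
      rw [RelIso.mul_apply, ← hz, RelIso.inv_apply_self])
  refine ⟨[⁅(⟨a, ha⟩ : groupG ρ c₀ ν₂ ν₃), ⟨b, hb⟩⁆,
    ⁅(⟨k, hk⟩ : groupG ρ c₀ ν₂ ν₃), ⟨φ, hφ⟩⁆, ⁅(⟨x, hx⟩ : groupG ρ c₀ ν₂ ν₃), ⟨y, hy⟩⁆], rfl, ?_, ?_⟩
  · intro c hc
    simp only [List.mem_cons, List.not_mem_nil, or_false] at hc
    rcases hc with rfl | rfl | rfl <;> exact commutator_mem_commutatorSet _ _
  · rw [List.prod_cons, List.prod_cons, List.prod_singleton]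
    apply Subtype.ext
    change ⁅a, b⁆ * (⁅k, φ⁆ * ⁅x, y⁆) = f
    rw [← heq, mul_inv_cancel_left]

end

/-! ### Commutator length and its stable version -/

theorem IsProdOfCommutators.mem_commutator {G : Type*} [Group G] {k : ℕ} {g : G}
    (h : IsProdOfCommutators k g) : g ∈ commutator G := by
  obtain ⟨l, -, hl, rfl⟩ := h
  refine list_prod_mem fun c hc => ?_
  rw [commutator_eq_closure]
  exact Subgroup.subset_closure (hl c hc)

theorem IsProdOfCommutators.commutatorLength_le {G : Type*} [Group G] {k : ℕ} {g : G}
    (h : IsProdOfCommutators k g) : commutatorLength g ≤ k := iInf₂_le k h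

theorem hasStableCommutatorLength_zero {G : Type*} [Group G] {k : ℕ}
    (h : ∀ g : G, commutatorLength g ≤ k) (g : G) : HasStableCommutatorLength g 0 := by
  have h1 : Tendsto (fun n : ℕ => (k : ℝ≥0∞) / n) atTop (𝓝 0) := by
    simpa [div_eq_mul_inv] using ENNReal.Tendsto.const_mul (a := (k : ℝ≥0∞))
      ENNReal.tendsto_inv_nat_nhds_zero (Or.inr (ENNReal.natCast_ne_top k))
  refine tendsto_of_tendsto_of_tendsto_of_le_of_le tendsto_const_nhds h1 (fun _ => zero_le) fun n => ?_
  refine ENNReal.div_le_div_right ?_ _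
  have := ENat.toENNReal_le.2 (h (g ^ n))
  simpa using this

end QuasiPeriodic

theorem theorem1 (ρ : ℤ → QuasiPeriodic.Letter) (hρ : QuasiPeriodic.IsQuasiPeriodic ρ)
    (c₀ ν₂ ν₃ : unitInterval ≃o unitInterval) (hν : QuasiPeriodic.IsAdmissible c₀ ν₂ ν₃) :
    (∀ f : QuasiPeriodic.groupG ρ c₀ ν₂ ν₃,
      f ∈ commutator (QuasiPeriodic.groupG ρ c₀ ν₂ ν₃) ∧
        QuasiPeriodic.commutatorLength f ≤ 3) ∧
    QuasiPeriodic.IsUniformlyPerfect (QuasiPeriodic.groupG ρ c₀ ν₂ ν₃) ∧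
    ∀ f : QuasiPeriodic.groupG ρ c₀ ν₂ ν₃, QuasiPeriodic.HasStableCommutatorLength f 0 := by
  have h3 := QuasiPeriodic.isProdOfCommutators_three hρ hν
  exact ⟨fun f => ⟨(h3 f).mem_commutator, (h3 f).commutatorLength_le⟩, ⟨3, h3⟩,
    QuasiPeriodic.hasStableCommutatorLength_zero fun f => (h3 f).commutatorLength_le⟩
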